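/- \textbf{Model.} For $p,q\in[0,1]$, $\mu,\nu\in\mathbb R^d$ and $\sigma\ge 0$, a sample of $\mathrm{CSBM}(n,p,q,\mu,\nu)$ (with feature variance $\sigma^2$) consists of labels, a graph and features on $n$ nodes. The labels $y_1,\dots,y_n$ are independent and uniform on $\{0,1\}$. Given the labels, each pair of distinct nodes is joined by an edge with probability $p$ if their labels agree and $q$ if they differ, node $i$ has a feature vector $X_i\sim\mathcal N(\mu,\sigma^2 I)$ if $y_i=0$ and $X_i\sim\mathcal N(\nu,\sigma^2 I)$ if $y_i=1$, and all edges and features are independent. Let $A$ be the adjacency matrix (no self-loops), $D$ the diagonal degree matrix, and $\tilde X=D^{-1}AX$ (with zero rows at isolated nodes). The classifier $(w,b)\in\mathbb R^d\times\mathbb R$ predicts $\hat y_i=(1+e^{-(\langle \tilde X_i,w\rangle+b)})^{-1}$, and its loss is $L(A,X,w,b)=-\frac1n\sum_{i}\bigl[y_i\log\hat y_i+(1-y_i)\log(1-\hat y_i)\bigr]$. \textbf{Theorem.} Fix $R>0$. For each $n$ let $d=d_n$, $n'=n'_n$, $p,q,p',q'\in[0,1]$, $\mu,\nu\in\mathbb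 R^{d}$ and $\sigma\ge0$ be given (all may depend on $n$) such that, as $n\to\infty$: $\|\mu\|,\|\nu\|\le 1$; $\sigma$ is bounded; $n=\omega(d\log d)$; $n'\to\infty$; $p,q=\omega(\log^2 n/n)$ and $p',q'=\omega(\log^2 n'/n')$; and $\frac{n(p-q)^2}{p+q}\to\infty$. Let the training sample $(A,X)\sim\mathrm{CSBM}(n,p,q,\mu,\nu)$ and the test sample $(A',X')\sim\mathrm{CSBM}(n',p',q',\mu,\nu)$ be independent, both with feature variance $\sigma^2$. If $(p-q)(p'-q')\le 0$ for every $n$, then there are deterministic $\varepsilon_n\to0$ such that, with probability tending to $1$ as $n\to\infty$, the training loss $L(A,X,w,b)$ has a minimizer subject to $\|w\|\le R$, $b\in\mathbb R$, and every such minimizer $(w^*,b^*)$ satisfies $$L(A',X',w^*,b^*)\ \ge\ \frac{R\,(q'-p')}{2(p'+q')}\,\|\mu-\nu\|\,(1+\varepsilon_n).$$ -/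

import Mathlib

open MeasureTheory ProbabilityTheory Filter Topology Asymptotics
open scoped ENNReal

namespace SGC

/-- Unordered pairs of distinct nodes, represented by `(i, j)` with `i < j`. -/
abbrev Pair (n : ℕ) : Type := {e : Fin n × Fin n // e.1 < e.2}

/-- A labelled graph with node features: the class labels (`false` is class `0`, `true` is
class `1`), the set of edges (as its indicator), and the feature vectors in `ℝᵈ`. -/
abbrev Sample (n d : ℕ) : Type :=
  (Fin n → Bool) × (Pair n → Bool) × (Fin n → EuclideanSpace ℝ (Fin d))

/-- Law of the edges given the labels `y`: the edges are independent, and a pair of nodes is joined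
with probability `p` if the labels agree and with probability `q` otherwise. -/
noncomputable def edgeLaw {n : ℕ} (p q : unitInterval) (y : Fin n → Bool) : Measure (Pair n → Bool) :=
  Measure.pi fun e => bernoulliMeasure true false (if y e.1.1 = y e.1.2 then p else q)

/-- Law of the features given the labels `y`: they are independent, with law `N(μ, σ² I)` for the
nodes of class `0` and `N(ν, σ² I)` for the nodes of class `1`. -/
noncomputable def featureLaw {n d : ℕ} (μ ν : EuclideanSpace ℝ (Fin d)) (σ : ℝ)
    (y : Fin n → Bool) : Measure (Fin n → EuclideanSpace ℝ (Fin d)) :=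
  Measure.pi fun i =>
    multivariateGaussian (if y i then ν else μ) (σ ^ 2 • (1 : Matrix (Fin d) (Fin d) ℝ))

/-- The contextual stochastic block model `CSBM(n, p, q, μ, ν)` with feature covariance `σ² I`:
the labels are independent and uniform on `{0, 1}`; given the labels, the edges and the features
are independent of each other, with the laws `edgeLaw` and `featureLaw`. -/
noncomputable def csbm (n d : ℕ) (p q : unitInterval) (μ ν : EuclideanSpace ℝ (Fin d)) (σ : ℝ) :
    Measure (Sample n d) :=
  ∑ y : Fin n → Bool,
    ((2 : ℝ≥0∞)⁻¹ ^ n) • (Measure.dirac y).prod ((edgeLaw p q y).prod (featureLaw μ ν σ y))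

variable {n d : ℕ}

/-- The class label of node `i` as a number in `{0, 1}`. -/
def label (s : Sample n d) (i : Fin n) : ℝ := if s.1 i then 1 else 0

/-- The adjacency matrix `A`: symmetric, with entries `0` and `1` and zero diagonal. -/
def adj (s : Sample n d) : Matrix (Fin n) (Fin n) ℝ := fun i j =>
  if h : i < j then (if s.2.1 ⟨(i, j), h⟩ then 1 else 0)
  else if h : j < i then (if s.2.1 ⟨(j, i), h⟩ then 1 else 0)
  else 0

/-- The degree of a node. -/
def deg (s : Sample n d) (i : Fin n) : ℝ := ∑ j, adj s i j

/-- Row `i` of `D⁻¹ A X`, that is, the average of the features of the neighbours of `i`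
(and `0` if `i` is isolated). -/
noncomputable def sgc (s : Sample n d) (i : Fin n) : EuclideanSpace ℝ (Fin d) :=
  (deg s i)⁻¹ • ∑ j, adj s i j • s.2.2 j

/-- The prediction of the linear-sigmoid classifier `(w, b)` at node `i`. -/
noncomputable def pred (s : Sample n d) (w : EuclideanSpace ℝ (Fin d)) (b : ℝ) (i : Fin n) : ℝ :=
  Real.sigmoid (inner ℝ (sgc s i) w + b)

/-- The binary cross-entropy loss of the classifier `(w, b)`, averaged over all nodes. -/
noncomputable def loss (s : Sample n d) (w : EuclideanSpace ℝ (Fin d)) (b : ℝ) : ℝ :=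
  -(1 / (n : ℝ)) * ∑ i, (label s i * Real.log (pred s w b i)
    + (1 - label s i) * Real.log (1 - pred s w b i))

/-- `(w, b)` minimizes the loss on `s` subject to `‖w‖ ≤ R`. -/
def IsOptimal (R : ℝ) (s : Sample n d) (w : EuclideanSpace ℝ (Fin d)) (b : ℝ) : Prop :=
  ‖w‖ ≤ R ∧ ∀ (v : EuclideanSpace ℝ (Fin d)) (c : ℝ), ‖v‖ ≤ R → loss s w b ≤ loss s v c

/-- The events `E n` hold with high probability: the (outer) probabilities of their complements
tend to `0`. -/
def WithHighProbability {Ω : ℕ → Type} [∀ n, MeasurableSpace (Ω n)]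
    (P : ∀ n, Measure (Ω n)) (E : ∀ n, Set (Ω n)) : Prop :=
  Tendsto (fun n => P n (E n)ᶜ) atTop (𝓝 0)

end SGC

/-!
The correction `ε = 0` is enough. The logistic loss is nonnegative, so that the lower bound is empty
unless `q' > p'`; then `p > q` for large `n`, by the assumption on the regimes and the gap condition.

Write `Γ = (p - q) / (p + q)`, `D = n (p + q) / 2` for the expected degree, and `γ = ‖μ - ν‖`. With
high probability the graph is regular in the sense of `IsRegular`: balanced classes, degrees near `D`,
and at most nodes an excess of neighbours of the own class close to `Γ` times the degree. On a regular
graph, the convolved feature of a node of class `0` or `1` is about `(μ + ν) / 2 ± Γ (μ - ν) / 2`, up to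
noise. Hence a weight vector of length `R` along `ν - μ` with the centred bias has loss about
`softplus (-Γ R γ / 2)` (`loss_le`). Conversely, the loss of every classifier `(w, b)` is bounded below
by affine minorants of the logistic function (`le_loss`). Choosing the slope at a node proportional to
its degree, and the total slope of both classes equal, removes the normalization by the degrees and the
bias `b`, and leaves a linear functional of `⟪μ - ν, w⟫` and of a single noise vector, `contrast`.

On the training graph both bounds hold up to a small multiple of `Γ`, because `D Γ ^ 2` tends to
infinity and `d / n` to zero. Comparing them shows that `⟪ν - μ, w⟫` is close to its maximum `R γ` for
every optimal `w` (`IsTypical.le_of_isOptimal`). On the test graph the sign of `Γ` is reversed, and the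
lower bound becomes `softplus t` up to a small constant, with `t = R γ (q' - p') / (2 (p' + q')) ≤ R`.
Since `softplus t = t + softplus (-t) ≥ t + softplus (-R)`, the constant `softplus (-R) > 0` absorbs the
errors (`le_test_loss`).

The dimension may be much larger than the number of test nodes, so the test noise is not small in all
directions, only in a direction that does not depend on it. It is therefore needed that the optimal `w`
is a function of the training sample. By strict convexity (`IsOptimal.margin_eq`) two optimal classifiers
agree on all convolved features. This forces them to have equal weights almost surely if the adjacency
matrix has rank at least `d + 1` and the features are not degenerate
(`featureLaw_exists_relation_eq_zero`); without noise there is nothing to show. The rank is bounded below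
by second and fourth moments of the centred block of edges between the classes (`edgeLaw_rank_lt_le`).
-/

namespace SGC

/-! ### The logistic loss function -/

/-- The logistic loss function `x ↦ log (1 + eˣ)`. -/
noncomputable def softplus (x : ℝ) : ℝ := Real.log (1 + Real.exp x)

theorem softplus_pos (x : ℝ) : 0 < softplus x :=
  Real.log_pos (by linarith [Real.exp_pos x])

theorem softplus_nonneg (x : ℝ) : 0 ≤ softplus x :=
  Real.log_nonneg (by linarith [Real.exp_pos x])

theorem softplus_eq_add_neg (x : ℝ) : softplus x = x + softplus (-x) := by
  have h : 1 + Real.exp x = Real.exp x * (1 + Real.exp (-x)) := by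
    rw [mul_add, ← Real.exp_add]; simp [add_comm]
  rw [softplus, h, Real.log_mul (Real.exp_pos x).ne' (by positivity), Real.log_exp, softplus]

theorem le_softplus (x : ℝ) : x ≤ softplus x := by
  rw [softplus_eq_add_neg]; linarith [softplus_nonneg (-x)]

theorem softplus_mono : Monotone softplus := fun x y h =>
  Real.log_le_log (by positivity) (by linarith [Real.exp_le_exp.2 h])

theorem continuous_softplus : Continuous softplus := by
  unfold softplus
  exact Continuous.log (by fun_prop) fun x => by positivity

theorem softplus_le_add_abs (x y : ℝ) : softplus x ≤ softplus y + |x - y| := by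
  rcases le_total x y with h | h
  · exact (softplus_mono h).trans (le_add_of_nonneg_right (abs_nonneg _))
  · rw [softplus_eq_add_neg x, softplus_eq_add_neg y, abs_of_nonneg (sub_nonneg.2 h)]
    linarith [softplus_mono (neg_le_neg h)]

theorem log_sigmoid (x : ℝ) : Real.log (Real.sigmoid x) = -softplus (-x) := by
  rw [Real.sigmoid_def, Real.log_inv, softplus]

/-- Each slope `u` gives an affine minorant of the logistic function, whose intercept is the binary
entropy of `u`: the entropy is the concave conjugate. -/
theorem mul_add_binEntropy_le_softplus {u : ℝ} (h0 : 0 < u) (h1 : u < 1) (x : ℝ) :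
    u * x + Real.binEntropy u ≤ softplus x := by
  have hc := strictConcaveOn_log_Ioi.concaveOn.2 (x := Real.exp x / u) (y := 1 / (1 - u))
    (by simp; positivity) (by simp; linarith) h0.le (sub_pos.2 h1).le (by ring)
  have h1' : 1 - u ≠ 0 := (sub_pos.2 h1).ne'
  simp only [smul_eq_mul] at hc
  rw [mul_div_cancel₀ _ h0.ne', mul_div_cancel₀ _ h1', Real.log_div (Real.exp_pos x).ne' h0.ne',
    Real.log_exp, one_div] at hc
  rw [Real.binEntropy, softplus, add_comm 1]
  simp only [Real.log_inv] at hc ⊢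
  linarith

theorem binEntropy_sigmoid (t : ℝ) :
    Real.binEntropy (Real.sigmoid t) = softplus t - Real.sigmoid t * t := by
  have h := softplus_eq_add_neg t
  rw [Real.binEntropy, ← Real.sigmoid_neg, Real.log_inv, Real.log_inv, log_sigmoid, log_sigmoid,
    neg_neg, neg_neg, neg_neg, Real.sigmoid_neg]
  linear_combination (Real.sigmoid t) * (-h)

/-- Away from the endpoints the binary entropy is Lipschitz. -/
theorem binEntropy_sub_le {a u v : ℝ} (ha : 0 < a) (hu : u ∈ Set.Icc a (1 - a))
    (hv : v ∈ Set.Icc a (1 - a)) :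
    |Real.binEntropy u - Real.binEntropy v| ≤ -(2 * Real.log a) * |u - v| := by
  have := (convex_Icc a (1 - a)).norm_image_sub_le_of_norm_hasDerivWithin_le
    (f := Real.binEntropy) (f' := fun p => Real.log (1 - p) - Real.log p) (C := -(2 * Real.log a))
    (fun p hp => (Real.hasDerivAt_binEntropy (by linarith [hp.1])
      (by linarith [hp.2])).hasDerivWithinAt) (fun p hp => ?_) hv hu
  · simpa using this
  · have e1 := Real.log_le_log ha hp.1
    have e2 := Real.log_le_log ha (show a ≤ 1 - p by linarith [hp.2])
    have e3 : Real.log p ≤ 0 := Real.log_nonpos (by linarith [hp.1]) (by linarith [hp.2])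
    have e4 : Real.log (1 - p) ≤ 0 := Real.log_nonpos (by linarith [hp.2]) (by linarith [hp.1])
    rw [Real.norm_eq_abs, abs_le]
    constructor <;> linarith

/-- Strict midpoint convexity of the logistic function. -/
theorem softplus_midpoint_lt {x y : ℝ} (h : x ≠ y) :
    softplus ((x + y) / 2) < (softplus x + softplus y) / 2 := by
  have hx := Real.exp_pos (x / 2)
  have hy := Real.exp_pos (y / 2)
  have hne : Real.exp (x / 2) ≠ Real.exp (y / 2) := fun e => h (by
    have := Real.exp_injective e; linarith)
  have e1 : Real.exp x = Real.exp (x / 2) ^ 2 := by rw [← Real.exp_nat_mul]; congr 1; push_cast; ring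
  have e2 : Real.exp y = Real.exp (y / 2) ^ 2 := by rw [← Real.exp_nat_mul]; congr 1; push_cast; ring
  have e3 : Real.exp ((x + y) / 2) = Real.exp (x / 2) * Real.exp (y / 2) := by
    rw [← Real.exp_add]; congr 1; ring
  unfold softplus
  rw [e1, e2, e3]
  have hs : 0 < (Real.exp (x / 2) - Real.exp (y / 2)) ^ 2 := by
    have := sub_ne_zero.2 hne
    positivity
  have key : Real.log ((1 + Real.exp (x / 2) * Real.exp (y / 2)) ^ 2) <
      Real.log ((1 + Real.exp (x / 2) ^ 2) * (1 + Real.exp (y / 2) ^ 2)) :=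
    Real.log_lt_log (by positivity) (by nlinarith)
  rw [Real.log_pow, Real.log_mul (by positivity) (by positivity)] at key
  push_cast at key
  linarith

theorem softplus_midpoint_le (x y : ℝ) :
    softplus ((x + y) / 2) ≤ (softplus x + softplus y) / 2 := by
  rcases eq_or_ne x y with rfl | h
  · simp
  · exact (softplus_midpoint_lt h).le

/-! ### The training problem -/

variable {n d : ℕ}

/-- The class labels as signs: `1` for class `0` and `-1` for class `1`. -/
def sgn (y : Fin n → Bool) (i : Fin n) : ℝ := if y i then -1 else 1

theorem sgn_mul_self (y : Fin n → Bool) (i : Fin n) : sgn y i * sgn y i = 1 := by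
  unfold sgn; split_ifs <;> norm_num

theorem abs_sgn (y : Fin n → Bool) (i : Fin n) : |sgn y i| = 1 := by
  unfold sgn; split_ifs <;> norm_num

theorem loss_eq (s : Sample n d) (w : EuclideanSpace ℝ (Fin d)) (b : ℝ) :
    loss s w b = 1 / (n : ℝ) * ∑ i, softplus (sgn s.1 i * (inner ℝ (sgc s i) w + b)) := by
  unfold loss
  rw [neg_mul, ← mul_neg, ← Finset.sum_neg_distrib]
  congr 1
  refine Finset.sum_congr rfl fun i _ => ?_
  unfold label pred sgn
  rw [← Real.sigmoid_neg, log_sigmoid, log_sigmoid]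
  split_ifs <;> simp

theorem loss_nonneg (s : Sample n d) (w : EuclideanSpace ℝ (Fin d)) (b : ℝ) : 0 ≤ loss s w b := by
  rw [loss_eq]
  exact mul_nonneg (by positivity) (Finset.sum_nonneg fun i _ => softplus_nonneg _)

/-- Two minimizers make the same predictions, because the logistic function is strictly convex. -/
theorem IsOptimal.margin_eq {R : ℝ} {s : Sample n d} {w₁ w₂ : EuclideanSpace ℝ (Fin d)} {b₁ b₂ : ℝ}
    (h₁ : IsOptimal R s w₁ b₁) (h₂ : IsOptimal R s w₂ b₂) (i : Fin n) :
    inner ℝ (sgc s i) (w₁ - w₂) + (b₁ - b₂) = 0 := by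
  by_contra hne
  have hmid : ‖(1 / 2 : ℝ) • (w₁ + w₂)‖ ≤ R := by
    rw [norm_smul]
    have := norm_add_le w₁ w₂
    norm_num
    linarith [h₁.1, h₂.1]
  have e1 := h₁.2 _ ((b₁ + b₂) / 2) hmid
  have e2 := h₂.2 _ ((b₁ + b₂) / 2) hmid
  have hn : 0 < n := i.pos
  have harg : ∀ j, sgn s.1 j * (inner ℝ (sgc s j) ((1 / 2 : ℝ) • (w₁ + w₂)) + (b₁ + b₂) / 2) =
      (sgn s.1 j * (inner ℝ (sgc s j) w₁ + b₁) + sgn s.1 j * (inner ℝ (sgc s j) w₂ + b₂)) / 2 := by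
    intro j
    rw [inner_smul_right, inner_add_right]; ring
  have : loss s ((1 / 2 : ℝ) • (w₁ + w₂)) ((b₁ + b₂) / 2) < (loss s w₁ b₁ + loss s w₂ b₂) / 2 := by
    rw [loss_eq, loss_eq, loss_eq, ← mul_add, mul_div_assoc, ← Finset.sum_add_distrib,
      Finset.sum_div]
    refine mul_lt_mul_of_pos_left ?_ (by positivity)
    refine Finset.sum_lt_sum (fun j _ => ?_) ⟨i, Finset.mem_univ _, ?_⟩
    · rw [harg]; exact softplus_midpoint_le _ _
    · rw [harg]
      refine softplus_midpoint_lt fun h => hne ?_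
      have hs : sgn s.1 i ≠ 0 := by
        intro h0; have := sgn_mul_self s.1 i; simp [h0] at this
      have := mul_left_cancel₀ hs h
      rw [inner_sub_right]; linarith
  linarith

theorem continuous_loss (s : Sample n d) :
    Continuous fun x : EuclideanSpace ℝ (Fin d) × ℝ => loss s x.1 x.2 := by
  simp only [loss_eq]
  exact continuous_const.mul (continuous_finsetSum _ fun i _ => continuous_softplus.comp
    (by fun_prop))

theorem loss_zero (s : Sample n d) : loss s 0 0 ≤ Real.log 2 := by
  rw [loss_eq]
  simp only [inner_zero_right, add_zero, mul_zero, softplus, Real.exp_zero]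
  rcases Nat.eq_zero_or_pos n with rfl | hn
  · simp [Real.log_nonneg]
  · have : (n : ℝ) ≠ 0 := by positivity
    norm_num
    field_simp
    exact le_rfl

/-- If both classes occur, a large bias is expensive, so that the loss has a minimizer. -/
theorem exists_isOptimal {R : ℝ} (hR : 0 ≤ R) (s : Sample n d) (h0 : ∃ i, s.1 i = false)
    (h1 : ∃ i, s.1 i = true) : ∃ w b, IsOptimal R s w b := by
  obtain ⟨i, hi⟩ := h0
  obtain ⟨j, hj⟩ := h1
  have hn : 0 < n := i.pos
  set B : ℝ := n * Real.log 2 + R * (‖sgc s i‖ + ‖sgc s j‖) with hB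
  have hB0 : 0 ≤ B := by positivity
  have hcomp : IsCompact (Metric.closedBall (0 : EuclideanSpace ℝ (Fin d)) R ×ˢ Set.Icc (-B) B) :=
    (isCompact_closedBall _ _).prod isCompact_Icc
  have h0mem : ((0 : EuclideanSpace ℝ (Fin d)), (0 : ℝ)) ∈
      Metric.closedBall (0 : EuclideanSpace ℝ (Fin d)) R ×ˢ Set.Icc (-B) B := by
    simp [hR, hB0]
  obtain ⟨⟨w, b⟩, hmem, hmin⟩ := hcomp.exists_isMinOn ⟨_, h0mem⟩ (continuous_loss s).continuousOn
  refine ⟨w, b, by simpa using hmem.1, fun v c hv => ?_⟩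
  -- outside the compact set, one of the nodes `i`, `j` alone costs more than the zero classifier
  by_cases hc : c ∈ Set.Icc (-B) B
  · exact hmin (a := (v, c)) ⟨by simpa using hv, hc⟩
  · refine (hmin h0mem).trans ((loss_zero s).trans ?_)
    have key : ∀ k, sgn s.1 k * (inner ℝ (sgc s k) v + c) ≤ n * loss s v c := by
      intro k
      rw [loss_eq, ← mul_assoc, mul_one_div_cancel (by positivity), one_mul]
      exact (le_softplus _).trans (Finset.single_le_sum
        (f := fun k => softplus (sgn s.1 k * (inner ℝ (sgc s k) v + c)))
        (fun k _ => softplus_nonneg _) (Finset.mem_univ k))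
    have hin : ∀ k, |inner ℝ (sgc s k) v| ≤ R * ‖sgc s k‖ := fun k =>
      (abs_real_inner_le_norm _ _).trans (by
        rw [mul_comm]; exact mul_le_mul_of_nonneg_right hv (norm_nonneg _))
    have hnn : (0 : ℝ) < n := by positivity
    have ki := key i
    have kj := key j
    have hii := abs_le.1 (hin i)
    have hjj := abs_le.1 (hin j)
    have p1 : 0 ≤ R * ‖sgc s i‖ := by positivity
    have p2 : 0 ≤ R * ‖sgc s j‖ := by positivity
    simp only [sgn, hi, hj, if_true, Bool.false_eq_true, if_false] at ki kj
    have hcc : B < c ∨ c < -B := by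
      by_contra hcon
      push Not at hcon
      exact hc ⟨hcon.2, hcon.1⟩
    refine le_of_mul_le_mul_left ?_ hnn
    rw [hB, mul_add] at hcc
    rcases hcc with hcc | hcc <;> linarith

/-! ### Deterministic estimates on a regular graph -/

/-- The adjacency matrix as a function of the edge indicators alone. -/
def edgeMat (e : Pair n → Bool) : Matrix (Fin n) (Fin n) ℝ := fun i j =>
  if h : i < j then (if e ⟨(i, j), h⟩ then 1 else 0)
  else if h : j < i then (if e ⟨(j, i), h⟩ then 1 else 0)
  else 0

theorem edgeMat_symm (e : Pair n → Bool) (i j : Fin n) : edgeMat e i j = edgeMat e j i := by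
  unfold edgeMat
  rcases lt_trichotomy i j with h | rfl | h
  · simp [h, h.not_gt]
  · simp
  · simp [h, h.not_gt]

/-- The sum of row `i`. -/
def rowSum (A : Matrix (Fin n) (Fin n) ℝ) (i : Fin n) : ℝ := ∑ j, A i j

/-- The excess at node `i` of neighbours of the own class over neighbours of the other class,
compared with its expected share `Γ` of the degree. -/
def excess (y : Fin n → Bool) (A : Matrix (Fin n) (Fin n) ℝ) (Γ : ℝ) (i : Fin n) : ℝ :=
  ∑ j, A i j * (sgn y i * sgn y j - Γ)

/-- The difference of the total degrees of the two classes, relative to the total degree. -/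
noncomputable def skew (y : Fin n → Bool) (A : Matrix (Fin n) (Fin n) ℝ) : ℝ :=
  (∑ i, sgn y i * rowSum A i) / ∑ i, rowSum A i

/-- The weight of the feature of node `j` in the contrast between the classes: class signs are
shifted by `skew`, so that the weights sum to zero and a bias has no influence. -/
noncomputable def coef (y : Fin n → Bool) (A : Matrix (Fin n) (Fin n) ℝ) (j : Fin n) : ℝ :=
  ∑ i, A i j * (sgn y i - skew y A)

/-- A labelled graph is regular, to the accuracies `θ` and `η`, if the classes are balanced, all
degrees are near `D`, and in quadratic mean the degrees and the excesses are what they should be. -/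
structure IsRegular (y : Fin n → Bool) (A : Matrix (Fin n) (Fin n) ℝ) (D Γ θ η : ℝ) : Prop where
  balanced : |∑ i, sgn y i| ≤ θ * n
  rowSum_near : ∀ i, |rowSum A i - D| ≤ η * D
  rowSum_sq : ∑ i, (rowSum A i - D) ^ 2 ≤ θ ^ 2 * n * D ^ 2
  excess_sq : ∑ i, excess y A Γ i ^ 2 ≤ θ ^ 2 * n * D ^ 2

theorem sum_abs_le_of_sum_sq_le {f : Fin n → ℝ} {θ D : ℝ} (hθ : 0 ≤ θ) (hD : 0 ≤ D)
    (h : ∑ i, f i ^ 2 ≤ θ ^ 2 * n * D ^ 2) : ∑ i, |f i| ≤ θ * n * D := by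
  have := sq_sum_le_card_mul_sum_sq (s := Finset.univ) (f := fun i => |f i|)
  simp only [sq_abs, Finset.card_univ, Fintype.card_fin] at this
  refine abs_le_of_sq_le_sq' ?_ (by positivity) |>.2
  calc _ ≤ (n : ℝ) * ∑ i, f i ^ 2 := this
    _ ≤ n * (θ ^ 2 * n * D ^ 2) := by gcongr
    _ = _ := by ring

namespace IsRegular

variable {y : Fin n → Bool} {A : Matrix (Fin n) (Fin n) ℝ} {D Γ θ η : ℝ}

theorem half_le_rowSum (h : IsRegular y A D Γ θ η) (hD : 0 < D) (hη : η ≤ 1 / 2) (i : Fin n) :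
    D / 2 ≤ rowSum A i := by
  have := (abs_le.1 (h.rowSum_near i)).1
  nlinarith

theorem rowSum_le (h : IsRegular y A D Γ θ η) (hD : 0 < D) (hη : η ≤ 1 / 2) (i : Fin n) :
    rowSum A i ≤ 3 / 2 * D := by
  have := (abs_le.1 (h.rowSum_near i)).2
  nlinarith

theorem sum_abs_rowSum (h : IsRegular y A D Γ θ η) (hD : 0 < D) (hθ : 0 ≤ θ) :
    ∑ i, |rowSum A i - D| ≤ θ * n * D := sum_abs_le_of_sum_sq_le hθ hD.le h.rowSum_sq

theorem sum_abs_excess (h : IsRegular y A D Γ θ η) (hD : 0 < D) (hθ : 0 ≤ θ) :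
    ∑ i, |excess y A Γ i| ≤ θ * n * D := sum_abs_le_of_sum_sq_le hθ hD.le h.excess_sq

theorem abs_sum_sgn_rowSum (h : IsRegular y A D Γ θ η) (hD : 0 < D) (hθ : 0 ≤ θ) :
    |∑ i, sgn y i * rowSum A i| ≤ 2 * θ * n * D := by
  have e : ∑ i, sgn y i * rowSum A i = ∑ i, sgn y i * (rowSum A i - D) + D * ∑ i, sgn y i := by
    rw [Finset.mul_sum, ← Finset.sum_add_distrib]
    exact Finset.sum_congr rfl fun i _ => by ring
  have e1 : |∑ i, sgn y i * (rowSum A i - D)| ≤ θ * n * D :=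
    (Finset.abs_sum_le_sum_abs _ _).trans (by
      simp only [abs_mul, abs_sgn, one_mul]; exact h.sum_abs_rowSum hD hθ)
  have e2 : |D * ∑ i, sgn y i| ≤ D * (θ * n) := by
    rw [abs_mul, abs_of_pos hD]; exact mul_le_mul_of_nonneg_left h.balanced hD.le
  rw [e]
  refine (abs_add_le _ _).trans ?_
  linarith

theorem half_le_sum_rowSum (h : IsRegular y A D Γ θ η) (hD : 0 < D) (hη : η ≤ 1 / 2) :
    n * D / 2 ≤ ∑ i, rowSum A i := by
  calc n * D / 2 = ∑ _i : Fin n, D / 2 := by simp; ring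
    _ ≤ _ := Finset.sum_le_sum fun i _ => h.half_le_rowSum hD hη i

theorem abs_skew_le (h : IsRegular y A D Γ θ η) (hn : 0 < n) (hD : 0 < D) (hθ : 0 ≤ θ)
    (hη : η ≤ 1 / 2) : |skew y A| ≤ 4 * θ := by
  have h1 := h.half_le_sum_rowSum hD hη
  have hn' : (0 : ℝ) < n := by positivity
  have h0 : 0 < ∑ i, rowSum A i := lt_of_lt_of_le (by positivity) h1
  rw [skew, abs_div, abs_of_pos h0, div_le_iff₀ h0]
  refine (h.abs_sum_sgn_rowSum hD hθ).trans ?_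
  nlinarith

theorem sum_sgn_sub_skew (h : IsRegular y A D Γ θ η) (hn : 0 < n) (hD : 0 < D)
    (hη : η ≤ 1 / 2) : ∑ i, rowSum A i * (sgn y i - skew y A) = 0 := by
  have h1 := h.half_le_sum_rowSum hD hη
  have hn' : (0 : ℝ) < n := by positivity
  have h0 : 0 < ∑ i, rowSum A i := lt_of_lt_of_le (by positivity) h1
  simp only [mul_sub, Finset.sum_sub_distrib, ← Finset.sum_mul]
  rw [skew, mul_div_cancel₀ _ h0.ne', sub_eq_zero]
  exact Finset.sum_congr rfl fun i _ => mul_comm _ _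

theorem sum_coef (h : IsRegular y A D Γ θ η) (hn : 0 < n) (hD : 0 < D)
    (hη : η ≤ 1 / 2) : ∑ j, coef y A j = 0 := by
  unfold coef
  rw [Finset.sum_comm, ← h.sum_sgn_sub_skew hn hD hη]
  exact Finset.sum_congr rfl fun i _ => by rw [rowSum, Finset.sum_mul]

theorem coef_eq (hA : ∀ i j, A i j = A j i) (j : Fin n) :
    coef y A j = sgn y j * (excess y A Γ j + Γ * rowSum A j) - skew y A * rowSum A j := by
  unfold coef excess rowSum
  simp only [Finset.mul_sum, ← Finset.sum_add_distrib, ← Finset.sum_sub_distrib]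
  refine Finset.sum_congr rfl fun i _ => ?_
  rw [hA i j]
  linear_combination (-(A j i * sgn y i)) * sgn_mul_self y j

/-- The means of the features enter the lower bound for the loss with total weight about `Γ n D`. -/
theorem sum_sgn_coef (h : IsRegular y A D Γ θ η) (hn : 0 < n) (hD : 0 < D) (hθ : 0 ≤ θ)
    (hθ1 : θ ≤ 1) (hη : η ≤ 1 / 2) (hΓ : |Γ| ≤ 1) (hA : ∀ i j, A i j = A j i) :
    |∑ j, sgn y j * coef y A j - Γ * n * D| ≤ 10 * θ * n * D := by
  have e : ∑ j, sgn y j * coef y A j - Γ * n * D = ∑ j, excess y A Γ j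
      + Γ * (∑ j, (rowSum A j - D)) - skew y A * ∑ j, sgn y j * rowSum A j := by
    have : ∀ j, sgn y j * coef y A j = excess y A Γ j + Γ * (rowSum A j - D)
        - skew y A * (sgn y j * rowSum A j) + Γ * D := fun j => by
      rw [coef_eq (Γ := Γ) hA j]
      linear_combination (excess y A Γ j + Γ * rowSum A j) * sgn_mul_self y j
    simp only [this, Finset.sum_add_distrib, Finset.sum_sub_distrib, ← Finset.mul_sum]
    simp
    ring
  have hT : 0 ≤ θ * n * D := by positivity
  have e1 : |∑ j, excess y A Γ j| ≤ θ * n * D :=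
    (Finset.abs_sum_le_sum_abs _ _).trans (h.sum_abs_excess hD hθ)
  have e2 : |Γ * (∑ j, (rowSum A j - D))| ≤ θ * n * D := by
    rw [abs_mul]
    exact (mul_le_of_le_one_left (abs_nonneg _) hΓ).trans
      ((Finset.abs_sum_le_sum_abs _ _).trans (h.sum_abs_rowSum hD hθ))
  have e3 : |skew y A * ∑ j, sgn y j * rowSum A j| ≤ 8 * (θ * n * D) := by
    rw [abs_mul]
    calc _ ≤ (4 * θ) * (2 * θ * n * D) := mul_le_mul (h.abs_skew_le hn hD hθ hη)
          (h.abs_sum_sgn_rowSum hD hθ) (abs_nonneg _) (by positivity)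
      _ = θ * (8 * (θ * n * D)) := by ring
      _ ≤ _ := mul_le_of_le_one_left (by positivity) hθ1
  rw [e]
  have := abs_sub (∑ j, excess y A Γ j + Γ * (∑ j, (rowSum A j - D)))
    (skew y A * ∑ j, sgn y j * rowSum A j)
  have := abs_add_le (∑ j, excess y A Γ j) (Γ * (∑ j, (rowSum A j - D)))
  linarith

/-- The weights are no larger than the signal, up to the accuracy: this keeps the noise of the
features below the signal, even when the latter tends to zero. -/
theorem sum_coef_sq (h : IsRegular y A D Γ θ η) (hn : 0 < n) (hD : 0 < D) (hθ : 0 ≤ θ)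
    (hη : η ≤ 1 / 2) (hA : ∀ i j, A i j = A j i) :
    ∑ j, coef y A j ^ 2 ≤ 120 * n * D ^ 2 * (Γ ^ 2 + θ ^ 2) := by
  have hsk : skew y A ^ 2 ≤ 16 * θ ^ 2 := by
    have := h.abs_skew_le hn hD hθ hη
    rw [← sq_abs]; nlinarith [abs_nonneg (skew y A)]
  have hj : ∀ j, coef y A j ^ 2 ≤ 3 * excess y A Γ j ^ 2
      + 3 * (Γ ^ 2 + 16 * θ ^ 2) * (9 / 4 * D ^ 2) := fun j => by
    have hd : rowSum A j ^ 2 ≤ 9 / 4 * D ^ 2 := by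
      have h1 := h.half_le_rowSum hD hη j
      have h2 := h.rowSum_le hD hη j
      nlinarith
    have hs : sgn y j ^ 2 = 1 := by rw [sq, sgn_mul_self]
    have h3 : coef y A j ^ 2 ≤ 3 * excess y A Γ j ^ 2 + 3 * (Γ ^ 2 + skew y A ^ 2)
        * rowSum A j ^ 2 := by
      have h4 : coef y A j ^ 2 ≤ 3 * ((sgn y j * excess y A Γ j) ^ 2
          + (sgn y j * Γ * rowSum A j) ^ 2 + (skew y A * rowSum A j) ^ 2) := by
        rw [coef_eq (Γ := Γ) hA j]
        nlinarith [sq_nonneg (sgn y j * excess y A Γ j - sgn y j * Γ * rowSum A j),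
          sq_nonneg (sgn y j * excess y A Γ j + skew y A * rowSum A j),
          sq_nonneg (sgn y j * Γ * rowSum A j + skew y A * rowSum A j)]
      simp only [mul_pow, hs] at h4
      linarith
    refine h3.trans ?_
    gcongr
  calc _ ≤ ∑ j, (3 * excess y A Γ j ^ 2 + 3 * (Γ ^ 2 + 16 * θ ^ 2) * (9 / 4 * D ^ 2)) :=
        Finset.sum_le_sum fun j _ => hj j
    _ = 3 * ∑ j, excess y A Γ j ^ 2 + n * (3 * (Γ ^ 2 + 16 * θ ^ 2) * (9 / 4 * D ^ 2)) := by
        rw [Finset.sum_add_distrib, ← Finset.mul_sum]; simp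
    _ ≤ 3 * (θ ^ 2 * n * D ^ 2) + n * (3 * (Γ ^ 2 + 16 * θ ^ 2) * (9 / 4 * D ^ 2)) := by
        have := h.excess_sq; linarith
    _ ≤ _ := by
        have : 0 ≤ n * D ^ 2 * Γ ^ 2 := by positivity
        have : 0 ≤ n * D ^ 2 * θ ^ 2 := by positivity
        nlinarith

theorem exists_label (h : IsRegular y A D Γ θ η) (hn : 0 < n) (hθ : θ < 1) :
    (∃ i, y i = false) ∧ ∃ i, y i = true := by
  have hn' : (0 : ℝ) < n := by positivity
  have hb := h.balanced
  constructor
  · by_contra hc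
    push Not at hc
    have : ∀ i, sgn y i = -1 := fun i => by simp [sgn, Bool.eq_true_of_not_eq_false (hc i)]
    simp only [this] at hb
    simp at hb
    nlinarith
  · by_contra hc
    push Not at hc
    have : ∀ i, sgn y i = 1 := fun i => by simp [sgn, Bool.eq_false_of_not_eq_true (hc i)]
    simp only [this] at hb
    simp at hb
    nlinarith

end IsRegular

/-- The deviation of the features of node `j` from the mean of its class. -/
def noise (μ ν : EuclideanSpace ℝ (Fin d)) (s : Sample n d) (j : Fin n) : EuclideanSpace ℝ (Fin d) :=
  s.2.2 j - if s.1 j then ν else μ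

theorem feature_eq (μ ν : EuclideanSpace ℝ (Fin d)) (s : Sample n d) (j : Fin n) :
    s.2.2 j = noise μ ν s j + (1 / 2 : ℝ) • (μ + ν) + (sgn s.1 j / 2) • (μ - ν) := by
  unfold noise sgn
  split_ifs <;> module

theorem deg_smul_sgc (s : Sample n d) (i : Fin n) (h : deg s i ≠ 0) :
    deg s i • sgc s i = ∑ j, adj s i j • s.2.2 j := by
  rw [sgc, smul_smul, mul_inv_cancel₀ h, one_smul]

theorem deg_eq_rowSum (s : Sample n d) (i : Fin n) : deg s i = rowSum (adj s) i := rfl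

/-- The constant in front of the accuracy in the lower bound for the loss. The logarithm comes from
the Lipschitz constant of the binary entropy at the slopes that occur. -/
noncomputable def lossConst (R : ℝ) : ℝ := 10 * R - 14 * Real.log (Real.sigmoid (-R) / 2)

theorem lossConst_pos {R : ℝ} (hR : 0 < R) : 0 < lossConst R := by
  have : Real.log (Real.sigmoid (-R) / 2) ≤ 0 :=
    Real.log_nonpos (by linarith [Real.sigmoid_pos (-R)]) (by linarith [Real.sigmoid_lt_one (-R)])
  unfold lossConst
  linarith

/-- Lower bound for the loss of any classifier by affine minorants of the logistic function. The
slope at node `i` is proportional to its degree, which cancels the normalization of the graph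
convolution, and the slopes are balanced between the classes, which cancels the bias. -/
theorem le_loss {R D Γ θ η ζ t : ℝ} {μ ν w : EuclideanSpace ℝ (Fin d)} {s : Sample n d}
    (h : IsRegular s.1 (adj s) D Γ θ η) (hn : 0 < n) (hD : 0 < D) (hθ : 0 ≤ θ)
    (hΓ : |Γ| ≤ 1) (hη : 0 ≤ η) (hηθ : η + 6 * θ ≤ Real.sigmoid (-R) / 2)
    (hμ : ‖μ‖ ≤ 1) (hν : ‖ν‖ ≤ 1) (hw : ‖w‖ ≤ R) (ht : |t| ≤ R) (b : ℝ)
    (hz : |inner ℝ (∑ j, coef s.1 (adj s) j • noise μ ν s j) w| ≤ ζ * n * D) :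
    softplus t - Real.sigmoid t * t + Real.sigmoid t * (Γ / 2) * inner ℝ (μ - ν) w
      - (lossConst R * θ + ζ) ≤ loss s w b := by
  have hR : 0 ≤ R := (norm_nonneg _).trans hw
  set a := Real.sigmoid (-R) / 2 with ha
  have ha0 : 0 < a := by have := Real.sigmoid_pos (-R); positivity
  have ha1 : a ≤ 1 / 4 := by
    have := Real.sigmoid_le (show -R ≤ 0 by linarith)
    rw [Real.sigmoid_zero] at this
    rw [ha]; linarith
  set u := Real.sigmoid t with hu
  have hu0 : 2 * a ≤ u := by
    have := Real.sigmoid_le (abs_le.1 ht).1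
    rw [ha, hu]; linarith
  have hu1 : u ≤ 1 - 2 * a := by
    have := Real.sigmoid_le (abs_le.1 ht).2
    have h2 := Real.sigmoid_neg R
    rw [ha, hu]; linarith
  have hη2 : η ≤ 1 / 2 := by linarith
  have hθ1 : θ ≤ 1 := by linarith
  have hn' : (0 : ℝ) < n := by positivity
  set A := adj s with hAdef
  have hA : ∀ i j, A i j = A j i := fun i j => edgeMat_symm _ i j
  set y := s.1 with hy
  set δ := skew y A with hδ
  have hδ4 : |δ| ≤ 4 * θ := h.abs_skew_le hn hD hθ hη2
  -- the slope at node `i` is `u * ω i`; on average over the nodes it differs little from `u`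
  set ω : Fin n → ℝ := fun i => rowSum A i / D * (1 - δ * sgn y i) with hω
  have hω1 : ∀ i, |ω i - 1| ≤ |rowSum A i - D| / D + 6 * θ := fun i => by
    have e : ω i - 1 = (rowSum A i - D) / D - rowSum A i / D * δ * sgn y i := by
      rw [hω]; field_simp; ring
    have e1 : |rowSum A i / D * δ * sgn y i| ≤ 6 * θ := by
      rw [abs_mul, abs_mul, abs_sgn, mul_one]
      have h1 := h.half_le_rowSum hD hη2 i
      have h2 := h.rowSum_le hD hη2 i
      have h3 : |rowSum A i / D| ≤ 3 / 2 := by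
        rw [abs_of_nonneg (by apply div_nonneg <;> linarith), div_le_iff₀ hD]; linarith
      calc _ ≤ 3 / 2 * (4 * θ) := mul_le_mul h3 hδ4 (abs_nonneg _) (by norm_num)
        _ = _ := by ring
    rw [e]
    refine (abs_sub _ _).trans ?_
    rw [abs_div, abs_of_pos hD]
    linarith
  have hω2 : ∀ i, |ω i - 1| ≤ a := fun i => by
    refine (hω1 i).trans ?_
    have : |rowSum A i - D| / D ≤ η := by
      rw [div_le_iff₀ hD]; exact h.rowSum_near i
    linarith
  have hsl : ∀ i, |u * ω i - u| ≤ |ω i - 1| := fun i => by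
    have : u * ω i - u = u * (ω i - 1) := by ring
    rw [this, abs_mul, abs_of_nonneg (by linarith : (0 : ℝ) ≤ u)]
    exact mul_le_of_le_one_left (abs_nonneg _) (by linarith)
  have hmem : ∀ i, u * ω i ∈ Set.Icc a (1 - a) := fun i => by
    have := abs_le.1 ((hsl i).trans (hω2 i))
    constructor <;> linarith [this.1, this.2]
  set z : Fin n → ℝ := fun i => inner ℝ (sgc s i) w + b with hz'
  set L := -(2 * Real.log a) with hL
  have hL0 : 0 ≤ L := by
    have := Real.log_nonpos ha0.le (by linarith)
    rw [hL]; linarith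
  have hnode : ∀ i, u * ω i * (sgn y i * z i) + (Real.binEntropy u
      - L * (|rowSum A i - D| / D + 6 * θ)) ≤ softplus (sgn y i * z i) := fun i => by
    have h1 := mul_add_binEntropy_le_softplus (u := u * ω i) (by linarith [(hmem i).1])
      (by linarith [(hmem i).2]) (sgn y i * z i)
    have h2 := binEntropy_sub_le ha0 (hmem i) (v := u) ⟨by linarith, by linarith⟩
    have h3 := (abs_le.1 h2).1
    have h4 := mul_le_mul_of_nonneg_left ((hsl i).trans (hω1 i)) hL0
    linarith
  have hsum := Finset.sum_le_sum fun i (_ : i ∈ Finset.univ) => hnode i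
  rw [Finset.sum_add_distrib] at hsum
  -- the linear part
  have hlin : ∑ i, u * ω i * (sgn y i * z i) = u / D *
      (inner ℝ (∑ j, coef y A j • noise μ ν s j) w
        + (∑ j, sgn y j * coef y A j) / 2 * inner ℝ (μ - ν) w) := by
    have e1 : ∀ i, u * ω i * (sgn y i * z i) = u / D * ((sgn y i - δ) *
        ∑ j, A i j * inner ℝ (s.2.2 j) w) + u / D * b * (rowSum A i * (sgn y i - δ)) := fun i => by
      have hd : deg s i ≠ 0 := by
        have := h.half_le_rowSum hD hη2 i
        rw [deg_eq_rowSum]; exact (lt_of_lt_of_le (by positivity) this).ne'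
      have e2 := congrArg (fun v => inner ℝ v w) (deg_smul_sgc s i hd)
      simp only [real_inner_smul_left, sum_inner] at e2
      rw [hω, hz']
      simp only
      rw [← e2, deg_eq_rowSum]
      linear_combination (-(u * rowSum A i / D * δ * (inner ℝ (sgc s i) w + b))) *
        sgn_mul_self y i
    have e3 : ∑ i, (sgn y i - δ) * ∑ j, A i j * inner ℝ (s.2.2 j) w =
        ∑ j, coef y A j * inner ℝ (s.2.2 j) w := by
      simp only [Finset.mul_sum, coef, Finset.sum_mul]
      rw [Finset.sum_comm]
      exact Finset.sum_congr rfl fun j _ => Finset.sum_congr rfl fun i _ => by ring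
    have e4 : ∑ j, coef y A j * inner ℝ (s.2.2 j) w =
        inner ℝ (∑ j, coef y A j • noise μ ν s j) w
        + (∑ j, sgn y j * coef y A j) / 2 * inner ℝ (μ - ν) w := by
      have : ∀ j, coef y A j * inner ℝ (s.2.2 j) w = inner ℝ (coef y A j • noise μ ν s j) w
          + coef y A j * ((1 / 2) * inner ℝ (μ + ν) w)
          + sgn y j * coef y A j * (1 / 2 * inner ℝ (μ - ν) w) := fun j => by
        rw [feature_eq μ ν s j]
        simp only [inner_add_left, real_inner_smul_left]
        ring
      simp only [this, Finset.sum_add_distrib, ← Finset.sum_mul, ← sum_inner]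
      rw [h.sum_coef hn hD hη2]
      ring
    simp only [e1, Finset.sum_add_distrib, ← Finset.mul_sum]
    rw [h.sum_sgn_sub_skew hn hD hη2, e3, e4]
    ring
  have hconst : ∑ i, (Real.binEntropy u - L * (|rowSum A i - D| / D + 6 * θ)) ≥
      n * (Real.binEntropy u - L * (7 * θ)) := by
    have h1 := h.sum_abs_rowSum hD hθ
    have h2 : (∑ i, |rowSum A i - D|) / D ≤ θ * n := by rw [div_le_iff₀ hD]; exact h1
    have h3 := mul_le_mul_of_nonneg_left h2 hL0
    have : ∑ i, (Real.binEntropy u - L * (|rowSum A i - D| / D + 6 * θ)) =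
        n * (Real.binEntropy u - L * (6 * θ)) - L * ((∑ i, |rowSum A i - D|) / D) := by
      rw [Finset.sum_sub_distrib, ← Finset.mul_sum, Finset.sum_add_distrib, Finset.sum_div]
      simp
      ring
    rw [this]
    linarith
  have hQ := h.sum_sgn_coef hn hD hθ hθ1 hη2 hΓ hA
  have hin : |inner ℝ (μ - ν) w| ≤ 2 * R := by
    refine (abs_real_inner_le_norm _ _).trans ?_
    have := norm_sub_le μ ν
    exact mul_le_mul (by linarith) hw (norm_nonneg _) (by norm_num)
  have hlin2 : n * (u * (Γ / 2) * inner ℝ (μ - ν) w - (10 * R * θ + ζ)) ≤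
      ∑ i, u * ω i * (sgn y i * z i) := by
    rw [hlin]
    have h1 : |(∑ j, sgn y j * coef y A j - Γ * n * D) * (inner ℝ (μ - ν) w)| ≤
        10 * θ * n * D * (2 * R) := by
      rw [abs_mul]; exact mul_le_mul hQ hin (abs_nonneg _) (by positivity)
    have hu01 : u / D ≤ 1 / D := by gcongr; linarith
    have h2 : -((ζ + 10 * R * θ) * n * D) ≤ inner ℝ (∑ j, coef y A j • noise μ ν s j) w
        + (∑ j, sgn y j * coef y A j - Γ * n * D) / 2 * inner ℝ (μ - ν) w := by
      have := (abs_le.1 hz).1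
      have := (abs_le.1 h1).1
      linarith
    have hζ : 0 ≤ ζ * n * D := (abs_nonneg _).trans hz
    have hnn : 0 ≤ (ζ + 10 * R * θ) * n * D := by
      have : 0 ≤ 10 * R * θ * n * D := by positivity
      linarith
    have h3 := mul_le_mul_of_nonneg_left h2 (show 0 ≤ u / D by apply div_nonneg <;> linarith)
    have h4 := mul_le_mul_of_nonneg_right hu01 hnn
    have h5 : 1 / D * ((ζ + 10 * R * θ) * n * D) = (ζ + 10 * R * θ) * n := by field_simp
    have h6 : u / D * (Γ * n * D / 2 * inner ℝ (μ - ν) w) = n * (u * (Γ / 2) * inner ℝ (μ - ν) w) := by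
      field_simp
    rw [h5] at h4
    linarith
  have hfin : n * (softplus t - u * t + u * (Γ / 2) * inner ℝ (μ - ν) w - (lossConst R * θ + ζ)) ≤
      ∑ i, softplus (sgn y i * z i) := by
    rw [← binEntropy_sigmoid]
    unfold lossConst
    rw [← ha]
    rw [hL] at hconst hsum
    linarith
  rw [loss_eq, one_div, ← div_eq_inv_mul, le_div_iff₀ hn']
  linarith

/-- Upper bound for the loss of a classifier whose bias is centred between the class means. -/
theorem loss_le {R ρ D Γ θ η : ℝ} {μ ν w : EuclideanSpace ℝ (Fin d)} {s : Sample n d}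
    (h : IsRegular s.1 (adj s) D Γ θ η) (hn : 0 < n) (hD : 0 < D) (hθ : 0 ≤ θ) (hη : η ≤ 1 / 2)
    (hw : inner ℝ (μ - ν) w = -ρ) (hρ0 : 0 ≤ ρ) (hρ : ρ ≤ 2 * R)
    (hz : ∑ i, |∑ j, adj s i j * inner ℝ (noise μ ν s j) w| ≤ θ * n * D) :
    loss s w (-inner ℝ ((1 / 2 : ℝ) • (μ + ν)) w) ≤ softplus (-Γ * ρ / 2) + (2 + 2 * R) * θ := by
  have hn' : (0 : ℝ) < n := by positivity
  set A := adj s with hAdef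
  set y := s.1 with hy
  set b := -inner ℝ ((1 / 2 : ℝ) • (μ + ν)) w with hb
  have hnode : ∀ i, softplus (sgn y i * (inner ℝ (sgc s i) w + b)) ≤ softplus (-Γ * ρ / 2)
      + 2 / D * (|∑ j, A i j * inner ℝ (noise μ ν s j) w| + R * |excess y A Γ i|) := fun i => by
    refine (softplus_le_add_abs _ (-Γ * ρ / 2)).trans ?_
    gcongr
    have hdi := h.half_le_rowSum hD hη i
    have hd0 : 0 < rowSum A i := lt_of_lt_of_le (by positivity) hdi
    have e2 := congrArg (fun v => inner ℝ v w) (deg_smul_sgc s i hd0.ne')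
    simp only [real_inner_smul_left, sum_inner] at e2
    have e3 : ∑ j, adj s i j * inner ℝ (s.2.2 j) w =
        ∑ j, A i j * inner ℝ (noise μ ν s j) w - b * rowSum A i
          - ρ / 2 * ∑ j, A i j * sgn y j := by
      rw [rowSum, Finset.mul_sum, Finset.mul_sum, ← Finset.sum_sub_distrib,
        ← Finset.sum_sub_distrib]
      refine Finset.sum_congr rfl fun j _ => ?_
      rw [feature_eq μ ν s j]
      simp only [inner_add_left, real_inner_smul_left, hw, hb]
      ring
    have e4 : sgn y i * ∑ j, A i j * sgn y j = excess y A Γ i + Γ * rowSum A i := by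
      rw [excess, rowSum, Finset.mul_sum, Finset.mul_sum, ← Finset.sum_add_distrib]
      exact Finset.sum_congr rfl fun j _ => by ring
    rw [e3, deg_eq_rowSum] at e2
    have e5 : sgn y i * (inner ℝ (sgc s i) w + b) - -Γ * ρ / 2 = (rowSum A i)⁻¹ *
        (sgn y i * (∑ j, A i j * inner ℝ (noise μ ν s j) w) - ρ / 2 * excess y A Γ i) := by
      rw [eq_inv_mul_iff_mul_eq₀ hd0.ne']
      linear_combination sgn y i * e2 - ρ / 2 * e4
    rw [e5, abs_mul]
    have hinv : |(rowSum A i)⁻¹| ≤ 2 / D := by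
      rw [abs_of_pos (inv_pos.2 hd0), inv_le_comm₀ hd0 (by positivity)]
      simpa using hdi
    refine mul_le_mul hinv ((abs_sub _ _).trans ?_) (abs_nonneg _) (by positivity)
    rw [abs_mul, abs_mul, abs_sgn, one_mul, abs_of_nonneg (by positivity : 0 ≤ ρ / 2)]
    gcongr
    linarith
  have hsum := Finset.sum_le_sum fun i (_ : i ∈ Finset.univ) => hnode i
  rw [Finset.sum_add_distrib, ← Finset.mul_sum, Finset.sum_add_distrib, ← Finset.mul_sum] at hsum
  simp only [Finset.sum_const, Finset.card_univ, Fintype.card_fin, nsmul_eq_mul] at hsum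
  rw [loss_eq, one_div, ← div_eq_inv_mul, div_le_iff₀ hn']
  have h1 := h.sum_abs_excess hD hθ
  have hR : 0 ≤ R := by linarith
  have h2 : 2 / D * (∑ i, |∑ j, A i j * inner ℝ (noise μ ν s j) w| + R * ∑ i, |excess y A Γ i|) ≤
      2 / D * (θ * n * D + R * (θ * n * D)) := by gcongr
  have h3 : 2 / D * (θ * n * D + R * (θ * n * D)) = (2 + 2 * R) * θ * n := by field_simp
  linarith

/-! ### Linear statistics of the random edges -/

/-- The probability that the nodes `i` and `j` are joined. -/
def linkProb (p q : unitInterval) (y : Fin n → Bool) (i j : Fin n) : ℝ :=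
  if y i = y j then p else q

/-- The indicator of an edge as a real number. -/
def ind (b : Bool) : ℝ := if b then 1 else 0

theorem linkProb_eq (p q : unitInterval) (y : Fin n → Bool) (i j : Fin n) :
    linkProb p q y i j = ((p : ℝ) + q) / 2 + ((p : ℝ) - q) / 2 * (sgn y i * sgn y j) := by
  unfold linkProb sgn
  cases y i <;> cases y j <;> simp <;> ring

theorem linkProb_nonneg (p q : unitInterval) (y : Fin n → Bool) (i j : Fin n) :
    0 ≤ linkProb p q y i j := by
  unfold linkProb; split_ifs <;> exact unitInterval.nonneg _

theorem linkProb_le (p q : unitInterval) (y : Fin n → Bool) (i j : Fin n) :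
    linkProb p q y i j ≤ (p : ℝ) + q := by
  have h1 := unitInterval.nonneg p
  have h2 := unitInterval.nonneg q
  unfold linkProb; split_ifs <;> linarith

instance (p q : unitInterval) (y : Fin n → Bool) : IsProbabilityMeasure (edgeLaw p q y) := by
  unfold edgeLaw; infer_instance

theorem integral_edge (p q : unitInterval) (y : Fin n → Bool) (e : Pair n) (f : Bool → ℝ) :
    ∫ x, f x ∂(bernoulliMeasure true false (if y e.1.1 = y e.1.2 then p else q)) =
      linkProb p q y e.1.1 e.1.2 * f true + (1 - linkProb p q y e.1.1 e.1.2) * f false := by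
  rw [integral_bernoulliMeasure]
  unfold linkProb
  split_ifs <;> simp

theorem sum_sum_eq_sum_pair (f : Fin n → Fin n → ℝ) (h : ∀ i, f i i = 0) :
    ∑ i, ∑ j, f i j = ∑ e : Pair n, (f e.1.1 e.1.2 + f e.1.2 e.1.1) := by
  have h1 : ∀ i, ∑ j, f i j = ∑ j, ((if i < j then f i j else 0) + if j < i then f i j else 0) := by
    intro i
    refine Finset.sum_congr rfl fun j _ => ?_
    rcases lt_trichotomy i j with hij | rfl | hij
    · simp [hij, hij.not_gt]
    · simp [h]
    · simp [hij, hij.not_gt]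
  have h2 : ∀ g : Fin n → Fin n → ℝ, ∑ e : Pair n, g e.1.1 e.1.2 =
      ∑ i, ∑ j, if i < j then g i j else 0 := by
    intro g
    rw [← Fintype.sum_prod_type' (f := fun i j => if i < j then g i j else 0), ← Finset.sum_filter]
    exact (Finset.sum_subtype (p := fun e : Fin n × Fin n => e.1 < e.2) _ (by simp)
      fun e => g e.1 e.2).symm
  simp only [h1, Finset.sum_add_distrib]
  rw [h2 f, h2 fun i j => f j i, Finset.sum_comm (f := fun i j => if j < i then f i j else 0)]

theorem edgeMat_self (e : Pair n → Bool) (i : Fin n) : edgeMat e i i = 0 := by simp [edgeMat]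

theorem edgeMat_pair (x : Pair n → Bool) (e : Pair n) : edgeMat x e.1.1 e.1.2 = ind (x e) := by
  simp [edgeMat, ind, e.2]

theorem sum_edgeMat (C : Fin n → Fin n → ℝ) (x : Pair n → Bool) :
    ∑ i, ∑ j, C i j * edgeMat x i j = ∑ e : Pair n, (C e.1.1 e.1.2 + C e.1.2 e.1.1) * ind (x e) := by
  rw [sum_sum_eq_sum_pair _ fun i => by simp [edgeMat_self]]
  refine Finset.sum_congr rfl fun e _ => ?_
  rw [edgeMat_symm x e.1.2 e.1.1, edgeMat_pair]
  ring

/-- The mean of the linear edge statistic with coefficients `C`, given the labels. -/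
def edgeMean (p q : unitInterval) (y : Fin n → Bool) (C : Fin n → Fin n → ℝ) : ℝ :=
  ∑ i, ∑ j, C i j * if i = j then 0 else linkProb p q y i j

theorem edgeMean_eq (p q : unitInterval) (y : Fin n → Bool) (C : Fin n → Fin n → ℝ) :
    edgeMean p q y C =
      ∑ e : Pair n, (C e.1.1 e.1.2 + C e.1.2 e.1.1) * linkProb p q y e.1.1 e.1.2 := by
  unfold edgeMean
  rw [sum_sum_eq_sum_pair _ fun i => by simp]
  refine Finset.sum_congr rfl fun e _ => ?_
  rw [if_neg e.2.ne, if_neg e.2.ne']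
  have : linkProb p q y e.1.2 e.1.1 = linkProb p q y e.1.1 e.1.2 := by
    unfold linkProb; simp only [eq_comm]
  rw [this]
  ring

/-- The variance of a linear statistic of independent edges. -/
theorem integral_sq_sub_edgeMean_le (p q : unitInterval) (y : Fin n → Bool)
    (C : Fin n → Fin n → ℝ) :
    ∫ x, (∑ i, ∑ j, C i j * edgeMat x i j - edgeMean p q y C) ^ 2 ∂edgeLaw p q y ≤
      2 * ((p : ℝ) + q) * ∑ i, ∑ j, C i j ^ 2 := by
  have hL : ∀ (f : Pair n → Bool → ℝ) (e : Pair n), MemLp (f e) 2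
      (bernoulliMeasure true false (if y e.1.1 = y e.1.2 then p else q)) := fun f e =>
    MemLp.of_discrete
  set c : Pair n → ℝ := fun e => C e.1.1 e.1.2 + C e.1.2 e.1.1 with hc
  have hvar := variance_sum_pi (μ := fun e : Pair n =>
    bernoulliMeasure true false (if y e.1.1 = y e.1.2 then p else q))
    (X := fun e x => c e * ind x) (fun e => hL (fun e x => c e * ind x) e)
  have hmean : ∫ x, (∑ e, c e * ind (x e)) ∂edgeLaw p q y = edgeMean p q y C := by
    rw [integral_finsetSum _ fun e _ => Integrable.of_finite, edgeMean_eq]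
    refine Finset.sum_congr rfl fun e _ => ?_
    unfold edgeLaw
    rw [integral_comp_eval (μ := fun e : Pair n =>
      bernoulliMeasure true false (if y e.1.1 = y e.1.2 then p else q)) (i := e)
      (f := fun x => c e * ind x) (by fun_prop), integral_edge]
    simp [ind, hc]
    ring
  have hfun : (∑ e : Pair n, fun x : Pair n → Bool => c e * ind (x e)) =
      fun x => ∑ e, c e * ind (x e) := by
    ext x; simp
  rw [hfun, variance_eq_integral (measurable_of_finite _).aemeasurable] at hvar
  change ∫ x, (_ - ∫ x, (∑ e, c e * ind (x e)) ∂edgeLaw p q y) ^ 2 ∂edgeLaw p q y = _ at hvar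
  rw [hmean] at hvar
  simp only [sum_edgeMat]
  rw [hvar]
  calc _ ≤ ∑ e : Pair n, 2 * ((p : ℝ) + q) * (C e.1.1 e.1.2 ^ 2 + C e.1.2 e.1.1 ^ 2) := by
        refine Finset.sum_le_sum fun e _ => ?_
        refine (variance_le_expectation_sq (by fun_prop)).trans ?_
        have h1 := integral_edge p q y e fun x => (c e * ind x) ^ 2
        simp only [ind, if_true, Bool.false_eq_true, if_false] at h1
        simp only [Pi.pow_apply, ind]
        rw [h1]
        have h2 := linkProb_le p q y e.1.1 e.1.2
        have h3 := linkProb_nonneg p q y e.1.1 e.1.2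
        have h4 : c e ^ 2 ≤ 2 * (C e.1.1 e.1.2 ^ 2 + C e.1.2 e.1.1 ^ 2) := by
          rw [hc]; nlinarith [sq_nonneg (C e.1.1 e.1.2 - C e.1.2 e.1.1)]
        have h5 := mul_le_mul h2 h4 (sq_nonneg _) (h3.trans h2)
        linarith
    _ ≤ _ := by
        rw [← Finset.mul_sum]
        have h1 := unitInterval.nonneg p
        have h2 := unitInterval.nonneg q
        refine mul_le_mul_of_nonneg_left ?_ (by linarith)
        rw [← sum_sum_eq_sum_pair (fun i j => if i = j then 0 else C i j ^ 2) (by simp) |>.trans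
          (Finset.sum_congr rfl fun e _ => by rw [if_neg e.2.ne, if_neg e.2.ne'])]
        refine Finset.sum_le_sum fun i _ => Finset.sum_le_sum fun j _ => ?_
        split_ifs
        · positivity
        · exact le_rfl

/-- The exponential moments of a sum of edges are at most those of a Poisson variable. -/
theorem mgf_edge_le (p q : unitInterval) (y : Fin n → Bool) (C : Fin n → Fin n → ℝ)
    (hC : ∀ e : Pair n, C e.1.1 e.1.2 + C e.1.2 e.1.1 = 0 ∨ C e.1.1 e.1.2 + C e.1.2 e.1.1 = 1)
    (t : ℝ) :
    mgf (fun x => ∑ i, ∑ j, C i j * edgeMat x i j) (edgeLaw p q y) t ≤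
      Real.exp ((Real.exp t - 1) * edgeMean p q y C) := by
  unfold mgf
  simp only [sum_edgeMat, Finset.mul_sum, Real.exp_sum]
  unfold edgeLaw
  rw [integral_fintype_prod_eq_prod (μ := fun e : Pair n =>
      bernoulliMeasure true false (if y e.1.1 = y e.1.2 then p else q))
      (f := fun e x => Real.exp (t * ((C e.1.1 e.1.2 + C e.1.2 e.1.1) * ind x))),
    edgeMean_eq, Finset.mul_sum, Real.exp_sum]
  refine Finset.prod_le_prod (fun e _ => integral_nonneg fun x => (Real.exp_pos _).le) fun e _ => ?_
  rw [integral_edge]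
  refine le_trans (le_of_eq ?_) (Real.add_one_le_exp _)
  rcases hC e with h | h
  · rw [h]; simp [ind]
  · rw [h]; simp [ind]; ring

/-- Coefficients that are supported on row `i`. -/
def rowCoef (i : Fin n) (c : Fin n → ℝ) (k l : Fin n) : ℝ := if k = i then c l else 0

theorem sum_rowCoef (i : Fin n) (c : Fin n → ℝ) (A : Fin n → Fin n → ℝ) :
    ∑ k, ∑ l, rowCoef i c k l * A k l = ∑ l, c l * A i l := by
  unfold rowCoef
  rw [Finset.sum_eq_single i]
  · simp
  · intro k _ hk; simp [hk]
  · simp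

theorem sum_rowCoef_sq (i : Fin n) (c : Fin n → ℝ) :
    ∑ k, ∑ l, rowCoef i c k l ^ 2 = ∑ l, c l ^ 2 := by
  unfold rowCoef
  rw [Finset.sum_eq_single i]
  · simp
  · intro k _ hk; simp [hk]
  · simp

theorem rowSum_eq_sum_rowCoef (A : Matrix (Fin n) (Fin n) ℝ) (i : Fin n) :
    rowSum A i = ∑ k, ∑ l, rowCoef i 1 k l * A k l :=
  (by simp [rowSum] : rowSum A i = ∑ l, (1 : Fin n → ℝ) l * A i l).trans (sum_rowCoef i 1 A).symm

theorem excess_eq_sum_rowCoef (y : Fin n → Bool) (A : Matrix (Fin n) (Fin n) ℝ) (Γ : ℝ)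
    (i : Fin n) : excess y A Γ i =
      ∑ k, ∑ l, rowCoef i (fun j => sgn y i * sgn y j - Γ) k l * A k l :=
  (Finset.sum_congr rfl fun _ _ => mul_comm _ _).trans (sum_rowCoef i _ A).symm

theorem edgeMean_rowCoef (p q : unitInterval) (y : Fin n → Bool) (i : Fin n) (c : Fin n → ℝ) :
    edgeMean p q y (rowCoef i c) =
      ∑ l, c l * linkProb p q y i l - c i * linkProb p q y i i := by
  unfold edgeMean
  rw [sum_rowCoef, eq_sub_iff_add_eq, ← Finset.add_sum_erase _ _ (Finset.mem_univ i),
    ← Finset.add_sum_erase _ (fun l => c l * linkProb p q y i l) (Finset.mem_univ i)]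
  simp only [if_true, mul_zero, zero_add]
  rw [add_comm]
  congr 1
  exact Finset.sum_congr rfl fun l hl => by rw [if_neg (Finset.ne_of_mem_erase hl).symm]

theorem abs_edgeMean_rowSum_sub_le (p q : unitInterval) (y : Fin n → Bool) (i : Fin n) :
    |edgeMean p q y (rowCoef i 1) - n * (((p : ℝ) + q) / 2)| ≤
      ((p : ℝ) + q) / 2 * (|∑ j, sgn y j| + 2) := by
  have h1 := unitInterval.nonneg p
  have h2 := unitInterval.nonneg q
  have e : edgeMean p q y (rowCoef i 1) - n * (((p : ℝ) + q) / 2) =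
      ((p : ℝ) - q) / 2 * (sgn y i * ∑ j, sgn y j) - p := by
    have hs := sgn_mul_self y i
    rw [edgeMean_rowCoef]
    simp only [linkProb_eq, Pi.one_apply, one_mul, Finset.sum_add_distrib, ← Finset.mul_sum, hs]
    simp
    ring
  have hb : |((p : ℝ) - q) / 2| ≤ ((p : ℝ) + q) / 2 := by rw [abs_le]; constructor <;> linarith
  rw [e]
  refine (abs_sub _ _).trans ?_
  rw [abs_mul, abs_mul, abs_sgn, one_mul, abs_of_nonneg h1]
  have := mul_le_mul_of_nonneg_right hb (abs_nonneg (∑ j, sgn y j))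
  linarith

theorem abs_edgeMean_excess_le (p q : unitInterval) (y : Fin n → Bool) (i : Fin n)
    (h : 0 < (p : ℝ) + q) :
    |edgeMean p q y (rowCoef i fun j => sgn y i * sgn y j - ((p : ℝ) - q) / (p + q))| ≤
      ((p : ℝ) + q) / 2 * (|∑ j, sgn y j| + 2) := by
  have h1 := unitInterval.nonneg p
  have h2 := unitInterval.nonneg q
  set Γ := ((p : ℝ) - q) / (p + q) with hΓ
  set α := ((p : ℝ) + q) / 2 with hα
  have hβ : ((p : ℝ) - q) / 2 = α * Γ := by rw [hΓ, hα]; field_simp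
  have hα0 : 0 < α := by positivity
  have hΓ1 : Γ ^ 2 ≤ 1 := by
    rw [hΓ, div_pow, div_le_one (by positivity)]; nlinarith
  have hs : ∀ j, sgn y i * sgn y j * (sgn y i * sgn y j) = 1 := fun j => by
    linear_combination sgn y j * sgn y j * sgn_mul_self y i + sgn_mul_self y j
  have e : ∀ j, (sgn y i * sgn y j - Γ) * linkProb p q y i j =
      α * (1 - Γ ^ 2) * (sgn y i * sgn y j) := fun j => by
    rw [linkProb_eq, hβ, ← hα]
    linear_combination α * Γ * hs j
  rw [edgeMean_rowCoef, e i]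
  simp only [e, ← Finset.mul_sum]
  rw [← mul_sub, sgn_mul_self, abs_mul, abs_of_nonneg (mul_nonneg hα0.le (by linarith)), mul_assoc]
  refine mul_le_mul_of_nonneg_left ?_ hα0.le
  have h3 : |sgn y i * ∑ j, sgn y j - 1| ≤ |∑ j, sgn y j| + 2 := by
    refine (abs_sub _ _).trans ?_
    rw [abs_mul, abs_sgn]
    simp
  exact (mul_le_of_le_one_left (abs_nonneg _) (by nlinarith)).trans h3

/-! ### Regularity of the random graph -/

/-- A Chernoff bound: all degrees are near their mean. -/
theorem edgeLaw_rowSum_le (p q : unitInterval) (y : Fin n → Bool) (i : Fin n) {D η : ℝ}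
    (hη : 0 < η) (hη1 : η ≤ 1) (hD : 0 ≤ D)
    (hM : |edgeMean p q y (rowCoef i 1) - D| ≤ η / 4 * D) :
    (edgeLaw p q y).real {x | η * D < |rowSum (edgeMat x) i - D|} ≤
      2 * Real.exp (-(D * η ^ 2 / 16)) := by
  have hC : ∀ e : Pair n, rowCoef i 1 e.1.1 e.1.2 + rowCoef i 1 e.1.2 e.1.1 = 0 ∨
      rowCoef i 1 e.1.1 e.1.2 + rowCoef i 1 e.1.2 e.1.1 = 1 := fun e => by
    unfold rowCoef
    by_cases h1 : e.1.1 = i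
    · have h2 : e.1.2 ≠ i := fun h => e.2.ne (h1.trans h.symm)
      simp [h1, h2]
    · by_cases h2 : e.1.2 = i <;> simp [h1, h2]
  set M := edgeMean p q y (rowCoef i 1) with hMdef
  have hmgf := fun t => mgf_edge_le p q y (rowCoef i 1) hC t
  have hexp : ∀ t : ℝ, |t| ≤ 1 → Real.exp t - 1 ≤ t + t ^ 2 := fun t ht => by
    have := (abs_le.1 (Real.abs_exp_sub_one_sub_id_le ht)).2
    linarith
  have hM' := abs_le.1 hM
  have hM0 : 0 ≤ M := by nlinarith
  set t := η / 4 with ht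
  have ht0 : 0 < t := by positivity
  have ht1 : t ≤ 1 / 4 := by rw [ht]; linarith
  have hη4 : η = 4 * t := by rw [ht]; ring
  have up : (edgeLaw p q y).real {x | (1 + η) * D ≤ rowSum (edgeMat x) i} ≤
      Real.exp (-(D * η ^ 2 / 16)) := by
    simp only [rowSum_eq_sum_rowCoef]
    refine (measure_ge_le_exp_mul_mgf ((1 + η) * D) ht0.le Integrable.of_finite).trans ?_
    refine (mul_le_mul_of_nonneg_left (hmgf t) (Real.exp_pos _).le).trans ?_
    rw [← Real.exp_add, Real.exp_le_exp]
    have h1 := mul_le_mul_of_nonneg_right (hexp t (by rw [abs_of_pos ht0]; linarith)) hM0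
    have h2 : (t + t ^ 2) * M ≤ (t + t ^ 2) * ((1 + t) * D) := by
      gcongr; linarith
    have h3 : -t * ((1 + η) * D) + (t + t ^ 2) * ((1 + t) * D) = D * t * (t ^ 2 - 2 * t) := by
      rw [hη4]; ring
    have h4 : D * t * (t ^ 2 - 2 * t) ≤ -(D * η ^ 2 / 16) := by
      rw [hη4]
      have : 0 ≤ D * t ^ 2 := by positivity
      nlinarith
    linarith
  have lo : (edgeLaw p q y).real {x | rowSum (edgeMat x) i ≤ (1 - η) * D} ≤
      Real.exp (-(D * η ^ 2 / 16)) := by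
    simp only [rowSum_eq_sum_rowCoef]
    refine (measure_le_le_exp_mul_mgf ((1 - η) * D) (neg_nonpos.2 ht0.le)
      Integrable.of_finite).trans ?_
    refine (mul_le_mul_of_nonneg_left (hmgf (-t)) (Real.exp_pos _).le).trans ?_
    rw [← Real.exp_add, Real.exp_le_exp]
    have h1 := mul_le_mul_of_nonneg_right (hexp (-t) (by rw [abs_neg, abs_of_pos ht0]; linarith)) hM0
    have h2 : (t - t ^ 2) * ((1 - t) * D) ≤ (t - t ^ 2) * M := by
      refine mul_le_mul_of_nonneg_left (by linarith) (by nlinarith)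
    have h3 : t * ((1 - η) * D) - (t - t ^ 2) * ((1 - t) * D) = -(D * t * (t ^ 2 + 2 * t)) := by
      rw [hη4]; ring
    have h4 : -(D * t * (t ^ 2 + 2 * t)) ≤ -(D * η ^ 2 / 16) := by
      rw [hη4]
      have : 0 ≤ D * t ^ 2 := by positivity
      have : 0 ≤ D * t ^ 3 := by positivity
      nlinarith
    linarith
  calc _ ≤ (edgeLaw p q y).real ({x | (1 + η) * D ≤ rowSum (edgeMat x) i} ∪
        {x | rowSum (edgeMat x) i ≤ (1 - η) * D}) := by
        refine measureReal_mono fun x hx => ?_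
        simp only [Set.mem_ofPred_eq, Set.mem_union] at hx ⊢
        rcases lt_abs.1 hx with h | h
        · left; linarith
        · right; linarith
    _ ≤ _ := by
        refine (measureReal_union_le _ _).trans ?_
        linarith

/-- Chebyshev bound for the mean square deviation from `m` of a family of edge statistics whose
means are close to `m`. -/
theorem edgeLaw_sum_sq_le (p q : unitInterval) (y : Fin n → Bool) (C : Fin n → Fin n → Fin n → ℝ)
    {K D θ m : ℝ} (hn : 0 < n) (hD : 0 < D) (hθ : 0 < θ) (hDα : D = n * (((p : ℝ) + q) / 2))
    (hK : ∀ i, ∑ k, ∑ l, C i k l ^ 2 ≤ K * n)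
    (hM : ∀ i, (edgeMean p q y (C i) - m) ^ 2 ≤ θ ^ 2 * D ^ 2 / 4) :
    (edgeLaw p q y).real
      {x | θ ^ 2 * n * D ^ 2 < ∑ i, (∑ k, ∑ l, C i k l * edgeMat x k l - m) ^ 2} ≤
      16 * K / (θ ^ 2 * D) := by
  have hn' : (0 : ℝ) < n := by positivity
  set f : (Pair n → Bool) → ℝ := fun x =>
    ∑ i, (∑ k, ∑ l, C i k l * edgeMat x k l - edgeMean p q y (C i)) ^ 2 with hf
  have hint : ∫ x, f x ∂edgeLaw p q y ≤ 4 * D * K * n := by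
    rw [hf, integral_finsetSum _ fun _ _ => Integrable.of_finite]
    have hp := unitInterval.nonneg p
    have hq := unitInterval.nonneg q
    calc _ ≤ ∑ _i : Fin n, 2 * ((p : ℝ) + q) * (K * n) := Finset.sum_le_sum fun i _ =>
          (integral_sq_sub_edgeMean_le p q y (C i)).trans
            (mul_le_mul_of_nonneg_left (hK i) (by linarith))
      _ = _ := by simp [hDα]; ring
  have hmark := mul_meas_ge_le_integral_of_nonneg (μ := edgeLaw p q y) (f := f)
    (ae_of_all _ fun x => Finset.sum_nonneg fun i _ => sq_nonneg _) Integrable.of_finite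
    (θ ^ 2 * n * D ^ 2 / 4)
  have hsub : (edgeLaw p q y).real {x | θ ^ 2 * n * D ^ 2 <
      ∑ i, (∑ k, ∑ l, C i k l * edgeMat x k l - m) ^ 2} ≤
      (edgeLaw p q y).real {x | θ ^ 2 * n * D ^ 2 / 4 ≤ f x} := by
    refine measureReal_mono fun x hx => ?_
    simp only [Set.mem_ofPred_eq] at hx ⊢
    have h1 : ∑ i, (∑ k, ∑ l, C i k l * edgeMat x k l - m) ^ 2 ≤
        ∑ i, (2 * (∑ k, ∑ l, C i k l * edgeMat x k l - edgeMean p q y (C i)) ^ 2 +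
          2 * (θ ^ 2 * D ^ 2 / 4)) := by
      refine Finset.sum_le_sum fun i _ => ?_
      have := hM i
      nlinarith [sq_nonneg (∑ k, ∑ l, C i k l * edgeMat x k l - edgeMean p q y (C i)
        - (edgeMean p q y (C i) - m))]
    rw [Finset.sum_add_distrib, ← Finset.mul_sum] at h1
    simp only [Finset.sum_const, Finset.card_univ, Fintype.card_fin, nsmul_eq_mul] at h1
    rw [hf]
    simp only
    linarith
  refine hsub.trans ?_
  rw [le_div_iff₀ (by positivity)]
  have h2 := hmark.trans hint
  have h3 : n * D / 4 * ((edgeLaw p q y).real {x | θ ^ 2 * n * D ^ 2 / 4 ≤ f x} * (θ ^ 2 * D)) ≤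
      n * D / 4 * (16 * K) := by linarith
  exact le_of_mul_le_mul_left h3 (by positivity)

/-- Given balanced labels, the random graph is regular with high probability. -/
theorem edgeLaw_not_isRegular_le (p q : unitInterval) (y : Fin n → Bool) {D θ η : ℝ}
    (hn : 0 < n) (hD : 0 < D) (hDα : D = n * (((p : ℝ) + q) / 2)) (hθ : 0 < θ) (hθη : θ ≤ η / 2)
    (hη1 : η ≤ 1) (hθn : 8 ≤ θ * n) (hy : |∑ i, sgn y i| ≤ θ * n / 4) :
    (edgeLaw p q y).real
      {x | ¬ IsRegular y (edgeMat x) D (((p : ℝ) - q) / (p + q)) θ η} ≤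
      80 / (θ ^ 2 * D) + n * (2 * Real.exp (-(D * η ^ 2 / 16))) := by
  have hn' : (0 : ℝ) < n := by positivity
  set Γ := ((p : ℝ) - q) / (p + q) with hΓ
  have hα : 0 < ((p : ℝ) + q) / 2 := by
    rw [hDα] at hD; exact pos_of_mul_pos_right hD hn'.le
  have hbias : ((p : ℝ) + q) / 2 * (|∑ j, sgn y j| + 2) ≤ θ * D / 2 := by
    rw [hDα]
    have := mul_le_mul_of_nonneg_left (show |∑ j, sgn y j| + 2 ≤ θ * n / 2 by linarith) hα.le
    linarith
  have hbias2 : ∀ v : ℝ, |v| ≤ ((p : ℝ) + q) / 2 * (|∑ j, sgn y j| + 2) →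
      v ^ 2 ≤ θ ^ 2 * D ^ 2 / 4 := fun v hv => by
    rw [← sq_abs]
    have : |v| ≤ θ * D / 2 := hv.trans hbias
    nlinarith [abs_nonneg v]
  -- the quadratic means
  have hr : (edgeLaw p q y).real {x | θ ^ 2 * n * D ^ 2 < ∑ i, (rowSum (edgeMat x) i - D) ^ 2} ≤
      16 * 1 / (θ ^ 2 * D) := by
    simp only [rowSum_eq_sum_rowCoef]
    refine edgeLaw_sum_sq_le p q y (fun i => rowCoef i 1) hn hD hθ hDα (fun i => ?_) fun i =>
      hbias2 _ ?_
    · rw [sum_rowCoef_sq]; simp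
    · rw [hDα]; exact abs_edgeMean_rowSum_sub_le p q y i
  have he : (edgeLaw p q y).real {x | θ ^ 2 * n * D ^ 2 < ∑ i, excess y (edgeMat x) Γ i ^ 2} ≤
      16 * 4 / (θ ^ 2 * D) := by
    simp only [excess_eq_sum_rowCoef]
    have h0 := edgeLaw_sum_sq_le p q y (fun i => rowCoef i fun j => sgn y i * sgn y j - Γ)
      (K := 4) (m := 0) hn hD hθ hDα (fun i => ?_) fun i => by
        rw [sub_zero]; exact hbias2 _ (abs_edgeMean_excess_le p q y i (by linarith))
    · simpa only [sub_zero] using h0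
    rw [sum_rowCoef_sq]
    calc _ ≤ ∑ _l : Fin n, (4 : ℝ) := Finset.sum_le_sum fun l _ => by
          have hΓ1 : |Γ| ≤ 1 := by
            rw [hΓ, abs_div, div_le_one (abs_pos.2 (by linarith)), abs_of_pos (by linarith :
              (0 : ℝ) < p + q), abs_le]
            have h1 := unitInterval.nonneg p
            have h2 := unitInterval.nonneg q
            constructor <;> linarith
          have h1 : |sgn y i * sgn y l - Γ| ≤ 2 := by
            refine (abs_sub _ _).trans ?_
            rw [abs_mul, abs_sgn, abs_sgn]; linarith
          rw [← sq_abs]; nlinarith [abs_nonneg (sgn y i * sgn y l - Γ)]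
      _ = _ := by simp [mul_comm]
  have hd : ∀ i, (edgeLaw p q y).real {x | η * D < |rowSum (edgeMat x) i - D|} ≤
      2 * Real.exp (-(D * η ^ 2 / 16)) := fun i => by
    refine edgeLaw_rowSum_le p q y i (by linarith) hη1 hD.le ?_
    have h2 := abs_edgeMean_rowSum_sub_le p q y i
    rw [← hDα] at h2
    refine h2.trans (hbias.trans ?_)
    nlinarith
  have hsub : {x | ¬ IsRegular y (edgeMat x) D Γ θ η} ⊆
      ({x | θ ^ 2 * n * D ^ 2 < ∑ i, (rowSum (edgeMat x) i - D) ^ 2} ∪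
        {x | θ ^ 2 * n * D ^ 2 < ∑ i, excess y (edgeMat x) Γ i ^ 2}) ∪
      ⋃ i ∈ (Finset.univ : Finset (Fin n)), {x | η * D < |rowSum (edgeMat x) i - D|} := by
    intro x hx
    simp only [Set.mem_ofPred_eq, Set.mem_union, Set.mem_iUnion, Finset.mem_univ, exists_prop,
      true_and] at hx ⊢
    by_contra hc
    push Not at hc
    refine hx ⟨?_, hc.2, hc.1.1, hc.1.2⟩
    have : 0 ≤ θ * n := by positivity
    linarith
  refine (measureReal_mono hsub).trans ((measureReal_union_le _ _).trans (add_le_add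
    ((measureReal_union_le _ _).trans ((add_le_add hr he).trans (le_of_eq ?_)))
    ((measureReal_biUnion_finset_le _ _).trans ((Finset.sum_le_sum fun i _ => hd i).trans
      (le_of_eq ?_)))))
  · rw [← add_div]; norm_num
  · simp

/-! ### The labels, and conditioning in the block model -/

/-- The average of the square of the class imbalance over all labellings is `n`. -/
theorem sum_imbalance_sq (n : ℕ) :
    ∑ y : Fin n → Bool, (∑ i, sgn y i) ^ 2 = (2 : ℝ) ^ n * n := by
  have h1 : ∀ i j : Fin n, i ≠ j → ∑ y : Fin n → Bool, sgn y i * sgn y j = 0 := by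
    intro i j hij
    have hinv : Function.Involutive fun y : Fin n → Bool => Function.update y i (!y i) := by
      intro y; ext k; by_cases hk : k = i
      · subst hk; simp
      · simp [hk]
    have h2 : ∑ y : Fin n → Bool, sgn (Function.update y i (!y i)) i *
        sgn (Function.update y i (!y i)) j = ∑ y : Fin n → Bool, sgn y i * sgn y j :=
      Equiv.sum_comp (Function.Involutive.toPerm _ hinv) fun y : Fin n → Bool => sgn y i * sgn y j
    have h3 : ∀ y : Fin n → Bool, sgn (Function.update y i (!y i)) i *
        sgn (Function.update y i (!y i)) j = -(sgn y i * sgn y j) := fun y => by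
      simp only [sgn, Function.update_self, Function.update_of_ne hij.symm]
      cases y i <;> cases y j <;> simp
    simp only [h3, Finset.sum_neg_distrib] at h2
    linarith
  simp only [sq, Finset.sum_mul_sum]
  rw [Finset.sum_comm]
  have h4 : ∀ i : Fin n, ∑ y : Fin n → Bool, ∑ j, sgn y i * sgn y j = 2 ^ n := fun i => by
    rw [Finset.sum_comm, Finset.sum_eq_single i]
    · simp [sgn_mul_self]
    · intro j _ hj; exact h1 i j hj.symm
    · simp
  simp [h4, mul_comm]

/-- The probability of a set of labellings. -/
noncomputable def labelProb (L : Set (Fin n → Bool)) : ℝ≥0∞ :=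
  ∑ y, L.indicator (fun _ => (2 : ℝ≥0∞)⁻¹ ^ n) y

theorem sum_two_inv_pow : ∑ _y : Fin n → Bool, (2 : ℝ≥0∞)⁻¹ ^ n = 1 := by
  simp only [Finset.sum_const, Finset.card_univ, Fintype.card_fun, Fintype.card_bool,
    Fintype.card_fin, nsmul_eq_mul]
  push_cast
  rw [← mul_pow, ENNReal.mul_inv_cancel (by norm_num) (by norm_num), one_pow]

theorem labelProb_unbalanced_le {c : ℝ} (hn : 0 < n) (hc : 0 < c) :
    labelProb {y : Fin n → Bool | c * n < |∑ i, sgn y i|} ≤ ENNReal.ofReal (1 / (c ^ 2 * n)) := by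
  classical
  have hn' : (0 : ℝ) < n := by positivity
  have e : ∀ y : Fin n → Bool, {y : Fin n → Bool | c * n < |∑ i, sgn y i|}.indicator
      (fun _ => (2 : ℝ≥0∞)⁻¹ ^ n) y ≤
      ENNReal.ofReal ((2⁻¹) ^ n * ((∑ i, sgn y i) ^ 2 / (c * n) ^ 2)) := by
    intro y
    by_cases hy : c * n < |∑ i, sgn y i|
    · rw [Set.indicator_of_mem (by simpa using hy)]
      have : (2 : ℝ≥0∞)⁻¹ ^ n = ENNReal.ofReal ((2⁻¹) ^ n) := by
        rw [ENNReal.ofReal_pow (by norm_num), ENNReal.ofReal_inv_of_pos (by norm_num)]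
        simp
      rw [this]
      refine ENNReal.ofReal_le_ofReal (le_mul_of_one_le_right (by positivity) ?_)
      rw [one_le_div (by positivity), ← sq_abs (∑ i, sgn y i)]
      exact pow_le_pow_left₀ (by positivity) hy.le 2
    · rw [Set.indicator_of_notMem (by simpa using hy)]
      exact zero_le
  refine (Finset.sum_le_sum fun y _ => e y).trans ?_
  rw [← ENNReal.ofReal_sum_of_nonneg fun y _ => by positivity, ← Finset.mul_sum, ← Finset.sum_div,
    sum_imbalance_sq]
  refine ENNReal.ofReal_le_ofReal (le_of_eq ?_)
  rw [← mul_div_assoc, ← mul_assoc, ← mul_pow]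
  norm_num
  field_simp

theorem dirac_prod_le {X Y : Type*} [MeasurableSpace X] [MeasurableSpace Y]
    [MeasurableSingletonClass X] (x : X) (ν : Measure Y) [SFinite ν] (B : Set (X × Y)) :
    (Measure.dirac x).prod ν B ≤ ν {r | (x, r) ∈ B} := by
  have hsub : B ⊆ ({x}ᶜ ×ˢ Set.univ) ∪ ({x} ×ˢ {r | (x, r) ∈ B}) := by
    rintro ⟨a, r⟩ h
    by_cases ha : a = x
    · right; subst ha; exact ⟨rfl, h⟩
    · left; exact ⟨ha, trivial⟩
  refine (measure_mono hsub).trans ((measure_union_le _ _).trans ?_)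
  rw [Measure.prod_prod, Measure.prod_prod]
  simp

instance (μ ν : EuclideanSpace ℝ (Fin d)) (σ : ℝ) (y : Fin n → Bool) :
    IsProbabilityMeasure (featureLaw μ ν σ y) := by
  unfold featureLaw; infer_instance

instance (p q : unitInterval) (μ ν : EuclideanSpace ℝ (Fin d)) (σ : ℝ) :
    IsProbabilityMeasure (csbm n d p q μ ν σ) := by
  constructor
  unfold csbm
  rw [Measure.finsetSum_apply]
  simp only [Measure.smul_apply, measure_univ, smul_eq_mul, mul_one]
  exact sum_two_inv_pow

/-- Union bound in stages: an event of small probability for the labels, an event for the edges that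
is unlikely given any other labels, and an event for the features that is unlikely given any other
labels and edges. No measurability is needed, as labels and edges are discrete. -/
theorem csbm_le (p q : unitInterval) (μ ν : EuclideanSpace ℝ (Fin d)) (σ : ℝ)
    (L : Set (Fin n → Bool)) (E : (Fin n → Bool) → Set (Pair n → Bool))
    (F : (Fin n → Bool) → (Pair n → Bool) → Set (Fin n → EuclideanSpace ℝ (Fin d)))
    {a b c : ℝ≥0∞} (hL : labelProb L ≤ a) (hE : ∀ y ∉ L, edgeLaw p q y (E y) ≤ b)
    (hF : ∀ y ∉ L, ∀ e ∉ E y, featureLaw μ ν σ y (F y e) ≤ c) :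
    csbm n d p q μ ν σ {s | s.1 ∈ L ∨ s.2.1 ∈ E s.1 ∨ s.2.2 ∈ F s.1 s.2.1} ≤ a + b + c := by
  classical
  set B : Set (Sample n d) := {s | s.1 ∈ L ∨ s.2.1 ∈ E s.1 ∨ s.2.2 ∈ F s.1 s.2.1} with hB
  have hy : ∀ y ∉ L, ((Measure.dirac y).prod ((edgeLaw p q y).prod (featureLaw μ ν σ y))) B ≤
      b + c := by
    intro y hyL
    refine (dirac_prod_le _ _ _).trans ?_
    have hsub : {r : (Pair n → Bool) × (Fin n → EuclideanSpace ℝ (Fin d)) | (y, r) ∈ B} ⊆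
        (E y ×ˢ Set.univ) ∪ ⋃ e ∈ (Finset.univ.filter fun e => e ∉ E y), {e} ×ˢ F y e := by
      rintro ⟨e, x⟩ hr
      by_cases he : e ∈ E y
      · left; exact ⟨he, trivial⟩
      · right
        rcases hr with hr | hr | hr
        · exact absurd hr hyL
        · exact absurd hr he
        · exact Set.mem_biUnion (by simpa using he) ⟨rfl, hr⟩
    refine (measure_mono hsub).trans ((measure_union_le _ _).trans (add_le_add ?_ ?_))
    · rw [Measure.prod_prod, measure_univ, mul_one]; exact hE y hyL
    · refine (measure_biUnion_finset_le _ _).trans ?_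
      calc _ ≤ ∑ e ∈ (Finset.univ.filter fun e => e ∉ E y), edgeLaw p q y {e} * c := by
            refine Finset.sum_le_sum fun e he => ?_
            rw [Measure.prod_prod]
            gcongr
            exact hF y hyL e (by simpa using he)
        _ ≤ ∑ e, edgeLaw p q y {e} * c :=
            Finset.sum_le_sum_of_subset (Finset.filter_subset _ _)
        _ = c := by rw [← Finset.sum_mul, sum_measure_singleton]; simp
  unfold csbm
  rw [Measure.finsetSum_apply]
  simp only [Measure.smul_apply, smul_eq_mul]
  calc _ ≤ ∑ y : Fin n → Bool, (L.indicator (fun _ => (2 : ℝ≥0∞)⁻¹ ^ n) y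
        + (2 : ℝ≥0∞)⁻¹ ^ n * (b + c)) := by
        refine Finset.sum_le_sum fun y _ => ?_
        by_cases h : y ∈ L
        · rw [Set.indicator_of_mem h]
          exact le_add_right ((mul_le_mul_right prob_le_one _).trans (mul_one _).le)
        · exact le_add_left (mul_le_mul_right (hy y h) _)
    _ ≤ _ := by
        rw [Finset.sum_add_distrib, ← Finset.sum_mul, sum_two_inv_pow, one_mul, add_assoc]
        exact add_le_add_left hL _

/-! ### The Gaussian features -/

theorem posSemidef_sq_smul_one (σ : ℝ) : (σ ^ 2 • (1 : Matrix (Fin d) (Fin d) ℝ)).PosSemidef :=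
  Matrix.PosSemidef.one.smul (sq_nonneg σ)

theorem memLp_inner_gaussian (m w : EuclideanSpace ℝ (Fin d)) (S : Matrix (Fin d) (Fin d) ℝ) :
    MemLp (fun x => inner ℝ x w) 2 (multivariateGaussian m S) := by
  have h := IsGaussian.memLp_two_id (μ := multivariateGaussian m S)
  have := (innerSL ℝ w).comp_memLp' h
  refine this.congr_norm (by fun_prop) (ae_of_all _ fun x => ?_)
  simp [real_inner_comm]

theorem integral_inner_gaussian (m w : EuclideanSpace ℝ (Fin d)) (S : Matrix (Fin d) (Fin d) ℝ) :
    ∫ x, inner ℝ x w ∂(multivariateGaussian m S) = inner ℝ m w := by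
  have h := IsGaussian.integrable_id (μ := multivariateGaussian m S)
  have := (innerSL ℝ w).integral_comp_comm h
  simp only [id, integral_id_multivariateGaussian, innerSL_apply_apply] at this
  simpa only [real_inner_comm w] using this

theorem variance_inner_gaussian (m w : EuclideanSpace ℝ (Fin d)) (σ : ℝ) :
    Var[fun x => inner ℝ x w; multivariateGaussian m (σ ^ 2 • (1 : Matrix (Fin d) (Fin d) ℝ))] =
      σ ^ 2 * ‖w‖ ^ 2 := by
  have h := covarianceBilin_multivariateGaussian (μ := m) (posSemidef_sq_smul_one σ) w w
  rw [covarianceBilin_self IsGaussian.memLp_two_id] at h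
  simp only [real_inner_comm w]
  rw [h, Matrix.smul_mulVec, Matrix.one_mulVec, dotProduct_smul, smul_eq_mul,
    EuclideanSpace.real_norm_sq_eq]
  simp only [dotProduct, sq]

/-- The noise, projected to one direction and averaged with weights `c`, is centred with variance
`σ² ‖w‖² ∑ cⱼ²`. -/
theorem integral_sq_inner_noise (μ ν w : EuclideanSpace ℝ (Fin d)) (σ : ℝ) (y : Fin n → Bool)
    (c : Fin n → ℝ) :
    Integrable (fun x => inner ℝ (∑ j, c j • (x j - if y j then ν else μ)) w ^ 2)
      (featureLaw μ ν σ y) ∧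
    ∫ x, inner ℝ (∑ j, c j • (x j - if y j then ν else μ)) w ^ 2 ∂featureLaw μ ν σ y =
      σ ^ 2 * ‖w‖ ^ 2 * ∑ j, c j ^ 2 := by
  set G : Fin n → Measure (EuclideanSpace ℝ (Fin d)) := fun j =>
    multivariateGaussian (if y j then ν else μ) (σ ^ 2 • (1 : Matrix (Fin d) (Fin d) ℝ)) with hG
  have hL : ∀ j, MemLp (fun x => c j * inner ℝ x w) 2 (G j) := fun j =>
    (memLp_inner_gaussian _ w _).const_mul _
  have hvar := variance_sum_pi (μ := G) hL
  have hLs : MemLp (∑ j, fun x : Fin n → EuclideanSpace ℝ (Fin d) => c j * inner ℝ (x j) w) 2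
      (Measure.pi G) :=
    memLp_finsetSum' _ fun j _ => (hL j).comp_measurePreserving (measurePreserving_eval G j)
  have hfun : (∑ j, fun x : Fin n → EuclideanSpace ℝ (Fin d) => c j * inner ℝ (x j) w) =
      fun x => ∑ j, c j * inner ℝ (x j) w := by ext x; simp
  rw [hfun] at hvar hLs
  have hmean : ∫ x, ∑ j, c j * inner ℝ (x j) w ∂(Measure.pi G) =
      ∑ j, c j * inner ℝ (if y j then ν else μ) w := by
    have hI : ∀ j, Integrable (fun x : Fin n → EuclideanSpace ℝ (Fin d) => c j * inner ℝ (x j) w)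
        (Measure.pi G) := fun j =>
      ((hL j).comp_measurePreserving (measurePreserving_eval G j)).integrable one_le_two
    rw [integral_finsetSum _ fun j _ => hI j]
    refine Finset.sum_congr rfl fun j _ => ?_
    rw [integral_comp_eval (μ := G) (i := j) (f := fun x => c j * inner ℝ x w)
      (hL j).aestronglyMeasurable, integral_const_mul, hG, integral_inner_gaussian]
  have hexp : ∀ x : Fin n → EuclideanSpace ℝ (Fin d),
      inner ℝ (∑ j, c j • (x j - if y j then ν else μ)) w =
      ∑ j, c j * inner ℝ (x j) w - ∑ j, c j * inner ℝ (if y j then ν else μ) w := fun x => by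
    simp only [sum_inner, real_inner_smul_left, inner_sub_left, mul_sub, Finset.sum_sub_distrib]
  rw [variance_eq_integral hLs.aestronglyMeasurable.aemeasurable, hmean] at hvar
  simp only [hexp]
  refine ⟨(hLs.sub (memLp_const _)).integrable_sq, ?_⟩
  change ∫ x, _ ∂(Measure.pi G) = _
  rw [hvar, Finset.mul_sum]
  refine Finset.sum_congr rfl fun j _ => ?_
  rw [variance_const_mul, hG, variance_inner_gaussian]
  ring

theorem featureLaw_inner_noise_le (μ ν w : EuclideanSpace ℝ (Fin d)) (σ : ℝ) (y : Fin n → Bool)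
    (c : Fin n → ℝ) {ζ : ℝ} (hζ : 0 < ζ) :
    featureLaw μ ν σ y {x | ζ ≤ |inner ℝ (∑ j, c j • (x j - if y j then ν else μ)) w|} ≤
      ENNReal.ofReal (σ ^ 2 * ‖w‖ ^ 2 * (∑ j, c j ^ 2) / ζ ^ 2) := by
  obtain ⟨h1, h2⟩ := integral_sq_inner_noise μ ν w σ y c
  have := mul_meas_ge_le_integral_of_nonneg (ae_of_all _ fun x => sq_nonneg _) h1 (ζ ^ 2)
  rw [h2] at this
  rw [← ofReal_measureReal]
  refine ENNReal.ofReal_le_ofReal ((measureReal_mono fun x hx => ?_).trans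
    ((le_div_iff₀' (by positivity)).2 this))
  simp only [Set.mem_ofPred_eq] at hx ⊢
  rw [← sq_abs (inner ℝ _ _)]
  exact pow_le_pow_left₀ hζ.le hx 2

theorem featureLaw_norm_noise_le (μ ν : EuclideanSpace ℝ (Fin d)) (σ : ℝ) (y : Fin n → Bool)
    (c : Fin n → ℝ) {ζ : ℝ} (hζ : 0 < ζ) :
    featureLaw μ ν σ y {x | ζ ≤ ‖∑ j, c j • (x j - if y j then ν else μ)‖} ≤
      ENNReal.ofReal (σ ^ 2 * d * (∑ j, c j ^ 2) / ζ ^ 2) := by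
  have h := fun k : Fin d => integral_sq_inner_noise μ ν (EuclideanSpace.single k 1) σ y c
  have hn : ∀ v : EuclideanSpace ℝ (Fin d), ‖v‖ ^ 2 =
      ∑ k, inner ℝ v (EuclideanSpace.single k (1 : ℝ)) ^ 2 := fun v => by
    rw [EuclideanSpace.real_norm_sq_eq]
    simp [EuclideanSpace.inner_single_right]
  have h1 : Integrable (fun x => ‖∑ j, c j • (x j - if y j then ν else μ)‖ ^ 2)
      (featureLaw μ ν σ y) := by
    simp only [hn]
    exact integrable_finsetSum _ fun k _ => (h k).1
  have h2 : ∫ x, ‖∑ j, c j • (x j - if y j then ν else μ)‖ ^ 2 ∂featureLaw μ ν σ y =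
      σ ^ 2 * d * ∑ j, c j ^ 2 := by
    simp only [hn]
    rw [integral_finsetSum _ fun k _ => (h k).1]
    simp only [fun k => (h k).2]
    simp
    ring
  have := mul_meas_ge_le_integral_of_nonneg (ae_of_all _ fun x => sq_nonneg _) h1 (ζ ^ 2)
  rw [h2] at this
  rw [← ofReal_measureReal]
  refine ENNReal.ofReal_le_ofReal ((measureReal_mono fun x hx => ?_).trans
    ((le_div_iff₀' (by positivity)).2 this))
  exact pow_le_pow_left₀ hζ.le hx 2

theorem featureLaw_sum_abs_noise_le (μ ν w : EuclideanSpace ℝ (Fin d)) (σ : ℝ) (y : Fin n → Bool)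
    (A : Matrix (Fin n) (Fin n) ℝ) {ζ : ℝ} (hζ : 0 < ζ) :
    featureLaw μ ν σ y {x | ζ ≤ ∑ i, |∑ j, A i j * inner ℝ (x j - if y j then ν else μ) w|} ≤
      ENNReal.ofReal (σ ^ 2 * ‖w‖ ^ 2 * (n * ∑ i, ∑ j, A i j ^ 2) / ζ ^ 2) := by
  have h := fun i : Fin n => integral_sq_inner_noise μ ν w σ y (A i)
  simp only [sum_inner, real_inner_smul_left] at h
  have h1 : Integrable (fun x => (n : ℝ) * ∑ i, (∑ j, A i j *
      inner ℝ (x j - if y j then ν else μ) w) ^ 2) (featureLaw μ ν σ y) :=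
    (integrable_finsetSum _ fun k _ => (h k).1).const_mul _
  have h2 : ∫ x, (n : ℝ) * ∑ i, (∑ j, A i j *
      inner ℝ (x j - if y j then ν else μ) w) ^ 2 ∂featureLaw μ ν σ y =
      σ ^ 2 * ‖w‖ ^ 2 * (n * ∑ i, ∑ j, A i j ^ 2) := by
    rw [integral_const_mul, integral_finsetSum _ fun k _ => (h k).1]
    simp only [fun k => (h k).2]
    rw [← Finset.mul_sum]
    ring
  have := mul_meas_ge_le_integral_of_nonneg (ae_of_all _ fun x => mul_nonneg (by positivity)
    (Finset.sum_nonneg fun i _ => sq_nonneg _)) h1 (ζ ^ 2)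
  rw [h2] at this
  rw [← ofReal_measureReal]
  refine ENNReal.ofReal_le_ofReal ((measureReal_mono fun x hx => ?_).trans
    ((le_div_iff₀' (by positivity)).2 this))
  simp only [Set.mem_ofPred_eq] at hx ⊢
  have hcs := sq_sum_le_card_mul_sum_sq (s := Finset.univ)
    (f := fun i => |∑ j, A i j * inner ℝ (x j - if y j then ν else μ) w|)
  simp only [sq_abs, Finset.card_univ, Fintype.card_fin] at hcs
  exact (pow_le_pow_left₀ hζ.le hx 2).trans hcs

/-! ### The rank of the adjacency matrix -/

theorem rank_add_le (A B : Matrix (Fin n) (Fin n) ℝ) : (A + B).rank ≤ A.rank + B.rank := by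
  unfold Matrix.rank
  have h : LinearMap.range (A + B).mulVecLin ≤
      LinearMap.range A.mulVecLin ⊔ LinearMap.range B.mulVecLin := by
    rintro _ ⟨v, rfl⟩
    rw [Matrix.mulVecLin_add]
    exact Submodule.add_mem_sup ⟨v, rfl⟩ ⟨v, rfl⟩
  exact (Submodule.finrank_mono h).trans (Submodule.finrank_add_le_finrank_add_finrank _ _)

/-- The Cauchy–Schwarz lower bound for the rank of a symmetric matrix in terms of the traces of the
matrix and of its square. -/
theorem trace_sq_le_rank_mul (M : Matrix (Fin n) (Fin n) ℝ) (hM : M.IsHermitian) :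
    M.trace ^ 2 ≤ M.rank * (M * M).trace := by
  have h1 : M.trace = ∑ i, hM.eigenvalues i := by simpa using hM.trace_eq_sum_eigenvalues
  have h2 : (M * M).trace = ∑ i, hM.eigenvalues i ^ 2 := by
    have h3 : (M * M).trace = (Matrix.diagonal hM.eigenvalues * Matrix.diagonal hM.eigenvalues).trace := by
      conv_lhs => rw [hM.spectral_theorem]
      rw [← map_mul, Unitary.conjStarAlgAut_apply, Matrix.trace_mul_cycle]
      simp
    rw [h3, Matrix.diagonal_mul_diagonal, Matrix.trace_diagonal]
    exact Finset.sum_congr rfl fun i _ => (sq _).symm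
  rw [h1, h2, hM.rank_eq_card_non_zero_eigs, Fintype.card_subtype]
  have h4 : ∑ i, hM.eigenvalues i = ∑ i ∈ Finset.univ.filter (fun i => hM.eigenvalues i ≠ 0),
      hM.eigenvalues i := (Finset.sum_filter_ne_zero _).symm
  rw [h4]
  refine sq_sum_le_card_mul_sum_sq.trans ?_
  gcongr
  exact Finset.filter_subset _ _

/-- A matrix with a small Gram matrix off the diagonal, compared with its entries, has large rank. -/
theorem sum_sq_sq_le_rank_mul (C : Matrix (Fin n) (Fin n) ℝ) :
    (∑ i, ∑ j, C i j ^ 2) ^ 2 ≤ C.rank * ∑ i, ∑ k, (∑ j, C i j * C k j) ^ 2 := by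
  have hM : (C * C.transpose).IsHermitian := by
    rw [Matrix.IsHermitian, Matrix.conjTranspose_eq_transpose_of_trivial, Matrix.transpose_mul,
      Matrix.transpose_transpose]
  have h := trace_sq_le_rank_mul _ hM
  rw [Matrix.rank_self_mul_transpose] at h
  have e1 : (C * C.transpose).trace = ∑ i, ∑ j, C i j ^ 2 := by
    simp [Matrix.trace, Matrix.mul_apply, sq]
  have e2 : (C * C.transpose * (C * C.transpose)).trace = ∑ i, ∑ k, (∑ j, C i j * C k j) ^ 2 := by
    simp only [Matrix.trace, Matrix.mul_apply, Matrix.diag_apply, Matrix.transpose_apply]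
    refine Finset.sum_congr rfl fun i _ => Finset.sum_congr rfl fun k _ => ?_
    rw [sq]
    congr 1
    exact Finset.sum_congr rfl fun j _ => mul_comm _ _
  rwa [e1, e2] at h

/-- The edge joining two distinct nodes. -/
def link (i j : Fin n) (h : i ≠ j) : Pair n :=
  if hij : i < j then ⟨(i, j), hij⟩ else ⟨(j, i), lt_of_le_of_ne (not_lt.1 hij) h.symm⟩

theorem edgeMat_link (x : Pair n → Bool) {i j : Fin n} (h : i ≠ j) :
    edgeMat x i j = ind (x (link i j h)) := by
  unfold link
  split_ifs with hij
  · exact edgeMat_pair x ⟨(i, j), hij⟩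
  · rw [edgeMat_symm]
    exact edgeMat_pair x ⟨(j, i), _⟩

theorem linkProb_link (p q : unitInterval) (y : Fin n → Bool) {i j : Fin n} (h : i ≠ j) :
    linkProb p q y (link i j h).1.1 (link i j h).1.2 = linkProb p q y i j := by
  unfold link linkProb
  split_ifs <;> simp_all

theorem link_inj {y : Fin n → Bool} {i j i' j' : Fin n} (h : i ≠ j) (h' : i' ≠ j')
    (hi : y i = false) (hj : y j = true) (hi' : y i' = false) (hj' : y j' = true)
    (he : link i j h = link i' j' h') : i = i' ∧ j = j' := by
  unfold link at he
  split_ifs at he <;> simp only [Subtype.mk.injEq, Prod.mk.injEq] at he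
  · exact he
  · obtain ⟨rfl, rfl⟩ := he; simp [hi] at hj'
  · obtain ⟨rfl, rfl⟩ := he; simp [hi'] at hj
  · exact he.symm

/-- A monomial in independent edge variables with one centred variable to the first power has mean
zero. -/
theorem integral_monomial_eq_zero (p q : unitInterval) (y : Fin n → Bool) (f : Bool → ℝ)
    (e₁ e₂ e₃ e₄ : Pair n) (h2 : e₂ ≠ e₁) (h3 : e₃ ≠ e₁) (h4 : e₄ ≠ e₁)
    (hf : ∫ x, f x ∂(bernoulliMeasure true false (if y e₁.1.1 = y e₁.1.2 then p else q)) = 0) :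
    ∫ x, f (x e₁) * f (x e₂) * f (x e₃) * f (x e₄) ∂edgeLaw p q y = 0 := by
  have hprod : ∀ x : Pair n → Bool, f (x e₁) * f (x e₂) * f (x e₃) * f (x e₄) =
      ∏ e, ((if e = e₁ then f (x e) else 1) * (if e = e₂ then f (x e) else 1) *
        (if e = e₃ then f (x e) else 1) * (if e = e₄ then f (x e) else 1)) := fun x => by
    simp only [Finset.prod_mul_distrib, Finset.prod_ite_eq', Finset.mem_univ, if_true]
  simp only [hprod]
  unfold edgeLaw
  rw [integral_fintype_prod_eq_prod (μ := fun e : Pair n =>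
      bernoulliMeasure true false (if y e.1.1 = y e.1.2 then p else q))
      (f := fun e b => (if e = e₁ then f b else 1) * (if e = e₂ then f b else 1) *
        (if e = e₃ then f b else 1) * (if e = e₄ then f b else 1))]
  refine Finset.prod_eq_zero (Finset.mem_univ e₁) ?_
  simpa [h2.symm, h3.symm, h4.symm] using hf

theorem integral_mul_of_ne (p q : unitInterval) (y : Fin n → Bool) (f : Bool → ℝ)
    (e₁ e₂ : Pair n) (h : e₁ ≠ e₂) :
    ∫ x, f (x e₁) * f (x e₂) ∂edgeLaw p q y =
      (∫ x, f x ∂(bernoulliMeasure true false (if y e₁.1.1 = y e₁.1.2 then p else q))) *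
      ∫ x, f x ∂(bernoulliMeasure true false (if y e₂.1.1 = y e₂.1.2 then p else q)) := by
  have hprod : ∀ x : Pair n → Bool, f (x e₁) * f (x e₂) =
      ∏ e, ((if e = e₁ then f (x e) else 1) * (if e = e₂ then f (x e) else 1)) := fun x => by
    simp only [Finset.prod_mul_distrib, Finset.prod_ite_eq', Finset.mem_univ, if_true]
  simp only [hprod]
  unfold edgeLaw
  rw [integral_fintype_prod_eq_prod (μ := fun e : Pair n =>
      bernoulliMeasure true false (if y e.1.1 = y e.1.2 then p else q))
      (f := fun e b => (if e = e₁ then f b else 1) * (if e = e₂ then f b else 1))]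
  rw [← Finset.mul_prod_erase _ _ (Finset.mem_univ e₁),
    ← Finset.mul_prod_erase _ _ (Finset.mem_erase.2 ⟨h.symm, Finset.mem_univ e₂⟩),
    Finset.prod_eq_one]
  · simp [h, h.symm]
  · intro e he
    simp only [Finset.mem_erase] at he
    simp [he.1, he.2.1]

/-- The indicator that `i` is in class `0` and `j` in class `1`. -/
noncomputable def cross (y : Fin n → Bool) (i j : Fin n) : ℝ := (1 + sgn y i) / 2 * ((1 - sgn y j) / 2)

theorem cross_eq (y : Fin n → Bool) (i j : Fin n) :
    cross y i j = if y i = false ∧ y j = true then 1 else 0 := by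
  unfold cross sgn
  cases y i <;> cases y j <;> simp

/-- The centred adjacency matrix between the two classes: rows are in class `0`, columns in class
`1`, and the other entries vanish. -/
noncomputable def crossMat (q : unitInterval) (y : Fin n → Bool) (A : Matrix (Fin n) (Fin n) ℝ) :
    Matrix (Fin n) (Fin n) ℝ := fun i j => cross y i j * (A i j - q)

/-- Centring by the constant `q` changes the rank by at most one, and the restriction to a block does
not increase it. -/
theorem rank_crossMat_le (q : unitInterval) (y : Fin n → Bool) (A : Matrix (Fin n) (Fin n) ℝ) :
    (crossMat q y A).rank ≤ A.rank + 1 := by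
  have e : crossMat q y A = Matrix.diagonal (fun i => (1 + sgn y i) / 2) *
      ((A + Matrix.vecMulVec (fun _ => -(q : ℝ)) (fun _ => 1)) *
        Matrix.diagonal (fun j => (1 - sgn y j) / 2)) := by
    ext i j
    rw [Matrix.diagonal_mul, Matrix.mul_diagonal]
    simp [crossMat, cross, Matrix.vecMulVec_apply]
    ring
  rw [e]
  exact (Matrix.rank_mul_le_right _ _).trans ((Matrix.rank_mul_le_left _ _).trans
    ((rank_add_le _ _).trans (Nat.add_le_add_left (Matrix.rank_vecMulVec_le _ _) _)))

/-- The entries of `crossMat` are independent, centred, and of variance `q (1 - q)`, so that a product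
of four of them has mean zero unless its factors coincide in pairs. -/
theorem integral_cross_moment_le (p q : unitInterval) (y : Fin n → Bool) (i k j l : Fin n) :
    ∫ x, crossMat q y (edgeMat x) i j * crossMat q y (edgeMat x) k j *
      (crossMat q y (edgeMat x) i l * crossMat q y (edgeMat x) k l) ∂edgeLaw p q y ≤
      (if i = k then ((q : ℝ) * (1 - q)) ^ 2 else 0) + (if j = l then ((q : ℝ) * (1 - q)) ^ 2 else 0)
        + (if i = k ∧ j = l then (q : ℝ) * (1 - q) else 0) := by
  have hq0 := unitInterval.nonneg q
  have hq1 := unitInterval.one_minus_nonneg q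
  set v := (q : ℝ) * (1 - q) with hv
  have hv0 : 0 ≤ v := mul_nonneg hq0 hq1
  have hrhs : 0 ≤ (if i = k then v ^ 2 else 0) + (if j = l then v ^ 2 else 0)
      + (if i = k ∧ j = l then v else 0) := by
    split_ifs <;> positivity
  -- all four nodes have to be in the right classes
  by_cases hm : y i = false ∧ y j = true ∧ y k = false ∧ y l = true
  swap
  · refine le_trans (le_of_eq ?_) hrhs
    have : ∀ x, crossMat q y (edgeMat x) i j * crossMat q y (edgeMat x) k j *
        (crossMat q y (edgeMat x) i l * crossMat q y (edgeMat x) k l) = 0 := fun x => by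
      simp only [crossMat, cross_eq]
      by_cases h1 : y i = false <;> by_cases h2 : y j = true <;> by_cases h3 : y k = false <;>
        by_cases h4 : y l = true <;> simp_all
    simp only [this, integral_zero]
  obtain ⟨hi, hj, hk, hl⟩ := hm
  have ne : ∀ {a b : Fin n}, y a = false → y b = true → a ≠ b := fun ha hb h => by
    subst h; simp [ha] at hb
  set f : Bool → ℝ := fun b => ind b - q with hf
  have hC : ∀ x, ∀ {a b : Fin n} (ha : y a = false) (hb : y b = true),
      crossMat q y (edgeMat x) a b = f (x (link a b (ne ha hb))) := fun x a b ha hb => by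
    rw [crossMat, cross_eq, if_pos ⟨ha, hb⟩, edgeMat_link x (ne ha hb), one_mul]
  have hE : ∀ {a b : Fin n} (ha : y a = false) (hb : y b = true) (g : Bool → ℝ),
      ∫ x, g x ∂(bernoulliMeasure true false (if y (link a b (ne ha hb)).1.1 =
        y (link a b (ne ha hb)).1.2 then p else q)) = q * g true + (1 - q) * g false := by
    intro a b ha hb g
    rw [integral_edge, linkProb_link]
    simp [linkProb, ha, hb]
  have hmean : ∀ {a b : Fin n} (ha : y a = false) (hb : y b = true),
      ∫ x, f x ∂(bernoulliMeasure true false (if y (link a b (ne ha hb)).1.1 =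
        y (link a b (ne ha hb)).1.2 then p else q)) = 0 := by
    intro a b ha hb
    rw [hE ha hb]
    simp [hf, ind]
    ring
  have hsq : ∀ {a b : Fin n} (ha : y a = false) (hb : y b = true),
      ∫ x, f x * f x ∂(bernoulliMeasure true false (if y (link a b (ne ha hb)).1.1 =
        y (link a b (ne ha hb)).1.2 then p else q)) = v := by
    intro a b ha hb
    rw [hE ha hb (fun b => f b * f b)]
    simp [hf, ind, hv]
    ring
  have hij := fun x => hC x hi hj
  have hkj := fun x => hC x hk hj
  have hil := fun x => hC x hi hl
  have hkl := fun x => hC x hk hl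
  simp only [hij, hkj, hil, hkl]
  by_cases hik : i = k
  · subst hik
    by_cases hjl : j = l
    · subst hjl
      simp only [if_true, and_self]
      have hb : ∀ b : Bool, f b * f b * (f b * f b) ≤ f b * f b := fun b => by
        have : f b * f b ≤ 1 := by
          rw [hf]
          cases b <;> simp [ind] <;> nlinarith
        exact mul_le_of_le_one_right (mul_self_nonneg _) this
      have : ∫ x, f (x (link i j (ne hi hj))) * f (x (link i j (ne hi hj))) *
          (f (x (link i j (ne hi hj))) * f (x (link i j (ne hi hj)))) ∂edgeLaw p q y ≤ v := by
        calc _ ≤ ∫ x, f (x (link i j (ne hi hj))) * f (x (link i j (ne hi hj))) ∂edgeLaw p q y :=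
              integral_mono Integrable.of_finite Integrable.of_finite fun x => hb _
          _ = v := by
              rw [← hsq hi hj]
              unfold edgeLaw
              exact integral_comp_eval (μ := fun e : Pair n =>
                bernoulliMeasure true false (if y e.1.1 = y e.1.2 then p else q))
                (f := fun b => f b * f b) (measurable_of_finite _).aestronglyMeasurable
      nlinarith [sq_nonneg v]
    · simp only [if_true, if_neg hjl, true_and]
      have hne : link i j (ne hi hj) ≠ link i l (ne hi hl) := fun h =>
        hjl (link_inj _ _ hi hj hi hl h).2
      rw [integral_mul_of_ne p q y (fun b => f b * f b) _ _ hne, hsq hi hj, hsq hi hl]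
      nlinarith
  · have h1 : link i j (ne hi hj) ≠ link k j (ne hk hj) := fun h =>
      hik (link_inj _ _ hi hj hk hj h).1
    have h2 : link i j (ne hi hj) ≠ link k l (ne hk hl) := fun h =>
      hik (link_inj _ _ hi hj hk hl h).1
    by_cases hjl : j = l
    · subst hjl
      have : ∀ x : Pair n → Bool, f (x (link i j (ne hi hj))) * f (x (link k j (ne hk hj))) *
          (f (x (link i j (ne hi hj))) * f (x (link k j (ne hk hj)))) =
          (f (x (link i j (ne hi hj))) * f (x (link i j (ne hi hj)))) *
          (f (x (link k j (ne hk hj))) * f (x (link k j (ne hk hj)))) := fun x => by ring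
      simp only [this]
      rw [integral_mul_of_ne p q y (fun b => f b * f b) _ _ h1, hsq hi hj, hsq hk hj]
      simp only [hik, false_and, if_true, if_false]
      nlinarith
    · have h3 : link i j (ne hi hj) ≠ link i l (ne hi hl) := fun h =>
        hjl (link_inj _ _ hi hj hi hl h).2
      simp only [← mul_assoc]
      rw [integral_monomial_eq_zero p q y f _ _ _ _ h1.symm h3.symm h2.symm (hmean hi hj)]
      simp [hik, hjl]

/-- The second moment of the Gram matrix of the rows of `crossMat`. -/
theorem integral_gram_le (p q : unitInterval) (y : Fin n → Bool) :
    ∫ x, (∑ i, ∑ k, (∑ j, crossMat q y (edgeMat x) i j * crossMat q y (edgeMat x) k j) ^ 2)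
      ∂edgeLaw p q y ≤ 2 * n ^ 3 * ((q : ℝ) * (1 - q)) ^ 2 + n ^ 2 * ((q : ℝ) * (1 - q)) := by
  simp only [sq (∑ j, _), Finset.sum_mul_sum]
  rw [integral_finsetSum _ fun _ _ => Integrable.of_finite]
  simp only [fun i => integral_finsetSum (μ := edgeLaw p q y) (Finset.univ : Finset (Fin n))
    (f := fun k x => ∑ j, ∑ l, crossMat q y (edgeMat x) i j * crossMat q y (edgeMat x) k j *
      (crossMat q y (edgeMat x) i l * crossMat q y (edgeMat x) k l))
      fun _ _ => Integrable.of_finite,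
    fun i k => integral_finsetSum (μ := edgeLaw p q y) (Finset.univ : Finset (Fin n))
    (f := fun j x => ∑ l, crossMat q y (edgeMat x) i j * crossMat q y (edgeMat x) k j *
      (crossMat q y (edgeMat x) i l * crossMat q y (edgeMat x) k l))
      fun _ _ => Integrable.of_finite,
    fun i k j => integral_finsetSum (μ := edgeLaw p q y) (Finset.univ : Finset (Fin n))
    (f := fun l x => crossMat q y (edgeMat x) i j * crossMat q y (edgeMat x) k j *
      (crossMat q y (edgeMat x) i l * crossMat q y (edgeMat x) k l))
      fun _ _ => Integrable.of_finite]
  calc _ ≤ ∑ i : Fin n, ∑ k : Fin n, ∑ j : Fin n, ∑ l : Fin n,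
        ((if i = k then ((q : ℝ) * (1 - q)) ^ 2 else 0) +
        (if j = l then ((q : ℝ) * (1 - q)) ^ 2 else 0)
        + (if i = k then if j = l then (q : ℝ) * (1 - q) else 0 else 0)) :=
        Finset.sum_le_sum fun i _ => Finset.sum_le_sum fun k _ => Finset.sum_le_sum fun j _ =>
          Finset.sum_le_sum fun l _ => (integral_cross_moment_le p q y i k j l).trans
            (le_of_eq (by rw [ite_and]))
    _ = _ := by
        simp only [Finset.sum_add_distrib, Finset.sum_ite_eq, Finset.mem_univ, if_true,
          Finset.sum_const, Finset.card_univ, Fintype.card_fin, nsmul_eq_mul, ← Finset.mul_sum]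
        have : ∀ i k : Fin n, (∑ j : Fin n, ∑ l : Fin n, if i = k then if j = l then
            (q : ℝ) * (1 - q) else 0 else 0) = if i = k then n * ((q : ℝ) * (1 - q)) else 0 := by
          intro i k; split_ifs <;> simp
        simp only [this, Finset.sum_ite_eq, Finset.mem_univ, if_true, Finset.sum_const,
          Finset.card_univ, Fintype.card_fin, nsmul_eq_mul]
        ring

theorem sum_cross (y : Fin n → Bool) :
    ∑ i, ∑ j, cross y i j = ((n : ℝ) ^ 2 - (∑ i, sgn y i) ^ 2) / 4 := by
  unfold cross
  rw [← Finset.sum_mul_sum, ← Finset.sum_div, ← Finset.sum_div, Finset.sum_add_distrib,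
    Finset.sum_sub_distrib]
  simp
  ring

/-- Given balanced labels, the adjacency matrix is likely to have rank larger than the feature
dimension. By `sum_sq_sq_le_rank_mul` this follows from a lower bound for the entries of `crossMat`
and an upper bound for its Gram matrix. -/
theorem edgeLaw_rank_lt_le (p q : unitInterval) (y : Fin n → Bool) {M : ℝ} (hM : 0 < M)
    (hy : |∑ i, sgn y i| ≤ n / 4) (hv : 1 ≤ n * ((q : ℝ) * (1 - q)))
    (hd : (d + 2) * (768 * M) ≤ n) :
    (edgeLaw p q y).real {x | (edgeMat x).rank < d + 1} ≤
      1 / M + 300 / (n * ((q : ℝ) * (1 - q))) ^ 2 := by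
  have hq0 := unitInterval.nonneg q
  have hq1 := unitInterval.one_minus_nonneg q
  have hp0 := unitInterval.nonneg p
  have hp1 := unitInterval.le_one p
  set v := (q : ℝ) * (1 - q) with hvdef
  have hv0 : 0 < v := by
    by_contra h
    have : (n : ℝ) * v ≤ 0 := mul_nonpos_of_nonneg_of_nonpos (by positivity) (not_lt.1 h)
    linarith
  have hn' : (0 : ℝ) < n := by
    by_contra h
    have : (n : ℝ) * v ≤ 0 := mul_nonpos_of_nonpos_of_nonneg (not_lt.1 h) hv0.le
    linarith
  -- the squared Frobenius norm is a linear statistic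
  set C : Fin n → Fin n → ℝ := fun i j => (1 - 2 * (q : ℝ)) * cross y i j with hC
  set Z : ℝ := ∑ i, ∑ j, cross y i j with hZ
  have hZn : 15 / 64 * (n : ℝ) ^ 2 ≤ Z := by
    rw [hZ, sum_cross]
    have : (∑ i, sgn y i) ^ 2 ≤ (n / 4 : ℝ) ^ 2 := by
      rw [← sq_abs]; exact pow_le_pow_left₀ (abs_nonneg _) hy 2
    linarith
  have hcr : ∀ i j, cross y i j = 0 ∨ cross y i j = 1 := fun i j => by
    rw [cross_eq]; split_ifs <;> simp
  have hfrob : ∀ x, ∑ i, ∑ j, crossMat q y (edgeMat x) i j ^ 2 =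
      ∑ i, ∑ j, C i j * edgeMat x i j + (q : ℝ) ^ 2 * Z := fun x => by
    rw [hZ, Finset.mul_sum, ← Finset.sum_add_distrib]
    refine Finset.sum_congr rfl fun i _ => ?_
    rw [Finset.mul_sum, ← Finset.sum_add_distrib]
    refine Finset.sum_congr rfl fun j _ => ?_
    have ha : edgeMat x i j ^ 2 = edgeMat x i j := by
      unfold edgeMat; split_ifs <;> norm_num
    have hm : cross y i j ^ 2 = cross y i j := by rcases hcr i j with h | h <;> rw [h] <;> norm_num
    rw [crossMat, mul_pow, hm, hC]
    linear_combination cross y i j * ha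
  have hmean : edgeMean p q y C = (1 - 2 * (q : ℝ)) * q * Z := by
    unfold edgeMean
    rw [hZ, Finset.mul_sum]
    refine Finset.sum_congr rfl fun i _ => ?_
    rw [Finset.mul_sum]
    refine Finset.sum_congr rfl fun j _ => ?_
    rw [hC]
    simp only [cross_eq, linkProb]
    by_cases h : y i = false ∧ y j = true
    · have hij : i ≠ j := fun hij => by subst hij; simp [h.1] at h
      simp [h, hij]
    · simp [h]
  have hT : (edgeLaw p q y).real {x | ∑ i, ∑ j, crossMat q y (edgeMat x) i j ^ 2 < v * Z / 2} ≤
      300 / (n * v) ^ 2 := by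
    have h1 := integral_sq_sub_edgeMean_le p q y C
    have h2 := mul_meas_ge_le_integral_of_nonneg (μ := edgeLaw p q y)
      (f := fun x => (∑ i, ∑ j, C i j * edgeMat x i j - edgeMean p q y C) ^ 2)
      (ae_of_all _ fun x => sq_nonneg _) Integrable.of_finite ((v * Z / 2) ^ 2)
    have h3 : ∑ i, ∑ j, C i j ^ 2 ≤ (n : ℝ) ^ 2 := by
      calc _ ≤ ∑ _i : Fin n, ∑ _j : Fin n, (1 : ℝ) := by
            refine Finset.sum_le_sum fun i _ => Finset.sum_le_sum fun j _ => ?_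
            rw [hC]
            simp only
            rcases hcr i j with h | h <;> rw [h] <;> nlinarith
        _ = _ := by simp [sq]
    have h4 : (edgeLaw p q y).real
        {x | ∑ i, ∑ j, crossMat q y (edgeMat x) i j ^ 2 < v * Z / 2} ≤
        (edgeLaw p q y).real {x | (v * Z / 2) ^ 2 ≤
          (∑ i, ∑ j, C i j * edgeMat x i j - edgeMean p q y C) ^ 2} := by
      refine measureReal_mono fun x hx => ?_
      simp only [Set.mem_ofPred_eq] at hx ⊢
      rw [hfrob] at hx
      rw [hmean, ← neg_sq (_ - _)]
      have hZ0 : 0 ≤ Z := le_trans (by positivity) hZn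
      refine pow_le_pow_left₀ (by positivity) ?_ 2
      rw [hvdef] at hx ⊢
      linarith
    refine h4.trans ?_
    set P := (edgeLaw p q y).real {x | (v * Z / 2) ^ 2 ≤
          (∑ i, ∑ j, C i j * edgeMat x i j - edgeMean p q y C) ^ 2}
    have hP : 0 ≤ P := measureReal_nonneg
    rw [le_div_iff₀ (by positivity)]
    have h5 : 2 * ((p : ℝ) + q) * ∑ i, ∑ j, C i j ^ 2 ≤ 4 * (n : ℝ) ^ 2 := by
      refine mul_le_mul ?_ h3 (Finset.sum_nonneg fun i _ => Finset.sum_nonneg fun j _ =>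
        sq_nonneg _) (by norm_num)
      linarith
    have h6 : (v * (15 / 64 * (n : ℝ) ^ 2) / 2) ^ 2 ≤ (v * Z / 2) ^ 2 :=
      pow_le_pow_left₀ (by positivity) (by gcongr) 2
    have h7 := (mul_le_mul_of_nonneg_right h6 hP).trans (h2.trans (h1.trans h5))
    have h8 : (n : ℝ) ^ 2 * (P * (n * v) ^ 2 * (225 / 16384)) ≤ (n : ℝ) ^ 2 * 4 := by linarith
    have h9 := le_of_mul_le_mul_left h8 (by positivity)
    linarith
  set W : ℝ := 2 * n ^ 3 * v ^ 2 + n ^ 2 * v with hW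
  have hW0 : 0 < W := by positivity
  have hG : (edgeLaw p q y).real {x | M * W ≤ ∑ i, ∑ k, (∑ j, crossMat q y (edgeMat x) i j *
      crossMat q y (edgeMat x) k j) ^ 2} ≤ 1 / M := by
    have h2 := mul_meas_ge_le_integral_of_nonneg (μ := edgeLaw p q y)
      (f := fun x => ∑ i, ∑ k, (∑ j, crossMat q y (edgeMat x) i j *
        crossMat q y (edgeMat x) k j) ^ 2)
      (ae_of_all _ fun x => Finset.sum_nonneg fun i _ => Finset.sum_nonneg fun k _ => sq_nonneg _)
      Integrable.of_finite (M * W)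
    have h3 := h2.trans (integral_gram_le p q y)
    rw [le_div_iff₀ hM]
    have h4 : W * ((edgeLaw p q y).real {x | M * W ≤ ∑ i, ∑ k, (∑ j, crossMat q y (edgeMat x) i j *
      crossMat q y (edgeMat x) k j) ^ 2} * M) ≤ W * 1 := by
      rw [mul_one]
      refine le_trans (le_of_eq ?_) h3
      ring
    exact le_of_mul_le_mul_left h4 hW0
  have hsub : {x | (edgeMat x).rank < d + 1} ⊆
      {x | M * W ≤ ∑ i, ∑ k, (∑ j, crossMat q y (edgeMat x) i j *
        crossMat q y (edgeMat x) k j) ^ 2} ∪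
      {x | ∑ i, ∑ j, crossMat q y (edgeMat x) i j ^ 2 < v * Z / 2} := by
    intro x hx
    by_contra hc
    simp only [Set.mem_union, Set.mem_ofPred_eq, not_or, not_le, not_lt] at hc hx
    have h1 := sum_sq_sq_le_rank_mul (crossMat q y (edgeMat x))
    have h2 := rank_crossMat_le q y (edgeMat x)
    have h3 : ((crossMat q y (edgeMat x)).rank : ℝ) ≤ d + 1 := by
      have : (crossMat q y (edgeMat x)).rank ≤ d + 1 := by omega
      exact_mod_cast this
    have h4 : (v * (15 / 64 * (n : ℝ) ^ 2) / 2) ^ 2 ≤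
        (∑ i, ∑ j, crossMat q y (edgeMat x) i j ^ 2) ^ 2 := by
      refine pow_le_pow_left₀ (by positivity) (le_trans ?_ hc.2) 2
      gcongr
    have h5 : ((crossMat q y (edgeMat x)).rank : ℝ) * ∑ i, ∑ k, (∑ j, crossMat q y (edgeMat x) i j *
        crossMat q y (edgeMat x) k j) ^ 2 ≤ (d + 1) * (M * W) := by
      refine mul_le_mul h3 hc.1.le (Finset.sum_nonneg fun i _ => Finset.sum_nonneg fun k _ =>
        sq_nonneg _) (by positivity)
    have h6 := h4.trans (h1.trans h5)
    have h7 : W ≤ 3 * (n ^ 3 * v ^ 2) := by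
      rw [hW]
      have : (n : ℝ) ^ 2 * v * 1 ≤ n ^ 2 * v * (n * v) := by gcongr
      linarith
    have h8 : (n : ℝ) ^ 3 * v ^ 2 * (225 / 16384 * n) ≤ n ^ 3 * v ^ 2 * ((d + 1) * (3 * M)) := by
      have := mul_le_mul_of_nonneg_left h7 (show 0 ≤ ((d : ℝ) + 1) * M by positivity)
      linarith
    have h9 := le_of_mul_le_mul_left h8 (by positivity)
    have : (0 : ℝ) ≤ d * M := by positivity
    linarith
  refine (measureReal_mono hsub).trans ((measureReal_union_le _ _).trans ?_)
  linarith

/-! ### Uniqueness of the classifier -/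

/-- The projection of a closed set along a compact set is closed. -/
theorem isClosed_exists_mem {X Y : Type*} [TopologicalSpace X] [TopologicalSpace Y] {K : Set Y}
    (hK : IsCompact K) {R : Set (X × Y)} (hR : IsClosed R) : IsClosed {x | ∃ y ∈ K, (x, y) ∈ R} := by
  have : CompactSpace K := isCompact_iff_compactSpace.1 hK
  have h := isClosedMap_fst_of_compactSpace (X := X) (Y := K) _
    (hR.preimage (f := fun z : X × K => (z.1, (z.2 : Y))) (by fun_prop))
  convert h using 1
  ext x
  simp only [Set.mem_ofPred_eq, Set.mem_image, Set.mem_preimage, Prod.exists, Subtype.exists,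
    exists_and_right, exists_eq_right, exists_prop]

/-- Independent vectors, none of which puts mass on a hyperplane, do not satisfy a common linear
relation as soon as the vectors `a j` span a space of sufficient dimension. The proof exposes one
vector at a time: if `a 0` is not in the span of the others, this cuts down the space of relations,
and otherwise it leaves the span unchanged. -/
theorem pi_exists_relation_eq_zero {E F : Type} [NormedAddCommGroup E] [InnerProductSpace ℝ E]
    [FiniteDimensional ℝ E] [MeasurableSpace E] [BorelSpace E] [NormedAddCommGroup F]
    [NormedSpace ℝ F] [FiniteDimensional ℝ F] (N : ℕ) (Q : Fin N → Measure E)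
    [∀ j, IsProbabilityMeasure (Q j)]
    (hQ : ∀ j (v : E) (r : ℝ), v ≠ 0 → Q j {x | inner ℝ x v = r} = 0) (a : Fin N → F)
    (L : E × ℝ →L[ℝ] F) (W : Submodule ℝ (E × ℝ))
    (hW : Module.finrank ℝ W ≤ Module.finrank ℝ (Submodule.span ℝ (Set.range a))) :
    Measure.pi Q {x | ∃ u ∈ W, u.1 ≠ 0 ∧ L u + ∑ j, inner ℝ (x j) u.1 • a j = 0} = 0 := by
  induction N generalizing L W with
  | zero =>
    have h0 : W = ⊥ := by
      rw [Set.range_eq_empty a, Submodule.span_empty, finrank_bot] at hW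
      exact Submodule.finrank_eq_zero.1 (Nat.le_zero.1 hW)
    subst h0
    have : {x : Fin 0 → E | ∃ u ∈ (⊥ : Submodule ℝ (E × ℝ)), u.1 ≠ 0 ∧
        L u + ∑ j, inner ℝ (x j) u.1 • a j = 0} = ∅ := by
      ext x
      simp only [Set.mem_ofPred_eq, Set.mem_empty_iff_false, iff_false, not_exists, not_and]
      intro u hu h
      rw [Submodule.mem_bot] at hu
      exact absurd (by rw [hu]; rfl) h
    rw [this, measure_empty]
  | succ N ih =>
    set S : Set (Fin (N + 1) → E) :=
      {x | ∃ u ∈ W, u.1 ≠ 0 ∧ L u + ∑ j, inner ℝ (x j) u.1 • a j = 0} with hS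
    -- normalize the relation, to write the event as a countable union of closed sets
    have hSm : MeasurableSet S := by
      have e : S = ⋃ m : ℕ, {x | ∃ u ∈ Metric.sphere (0 : E) 1 ×ˢ Set.Icc (-(m : ℝ)) m,
          (x, u) ∈ {z : (Fin (N + 1) → E) × (E × ℝ) | z.2 ∈ W ∧
            L z.2 + ∑ j, inner ℝ (z.1 j) z.2.1 • a j = 0}} := by
        ext x
        simp only [hS, Set.mem_ofPred_eq, Set.mem_iUnion]
        constructor
        · rintro ⟨u, hu, hu1, h⟩
          obtain ⟨m, hm⟩ := exists_nat_ge |(‖u.1‖⁻¹ • u).2|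
          refine ⟨m, ‖u.1‖⁻¹ • u, ⟨?_, abs_le.1 hm⟩, W.smul_mem _ hu, ?_⟩
          · have : ‖u.1‖ ≠ 0 := norm_ne_zero_iff.2 hu1
            simp [norm_smul, this]
          · have := congrArg (fun z => ‖u.1‖⁻¹ • z) h
            simp only [smul_add, smul_zero, Finset.smul_sum] at this
            simp only [map_smul, Prod.smul_fst, inner_smul_right, mul_smul]
            exact this
        · rintro ⟨m, u, ⟨hu1, -⟩, hu, h⟩
          refine ⟨u, hu, fun h0 => ?_, h⟩
          rw [mem_sphere_zero_iff_norm, h0, norm_zero] at hu1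
          exact zero_ne_one hu1
      rw [e]
      refine MeasurableSet.iUnion fun m => (isClosed_exists_mem
        ((isCompact_sphere _ _).prod isCompact_Icc) (IsClosed.inter ?_ ?_)).measurableSet
      · exact W.closed_of_finiteDimensional.preimage continuous_snd
      · exact isClosed_eq (by fun_prop) continuous_const
    have hmp := measurePreserving_piFinSuccAbove Q 0
    rw [← hmp.symm.measure_preimage_equiv, Measure.measure_prod_null
      ((MeasurableEquiv.measurable _) hSm)]
    set b : Fin N → F := fun j => a j.succ with hb
    have hpre : ∀ x₀ : E, (Prod.mk x₀ ⁻¹' ((MeasurableEquiv.piFinSuccAbove (fun _ => E) 0).symm ⁻¹' S))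
        = {x | ∃ u ∈ W, u.1 ≠ 0 ∧ (L u + inner ℝ x₀ u.1 • a 0)
          + ∑ j, inner ℝ (x j) u.1 • b j = 0} := by
      intro x₀
      ext x
      simp only [hS, Set.mem_preimage, Set.mem_ofPred_eq, MeasurableEquiv.piFinSuccAbove_symm_apply,
        Fin.insertNthEquiv_zero, Fin.consEquiv_apply, Fin.sum_univ_succ, Fin.cons_zero,
        Fin.cons_succ, hb, add_assoc]
    have hL' : ∀ x₀ : E, ∃ L' : E × ℝ →L[ℝ] F, ∀ u, L' u = L u + inner ℝ x₀ u.1 • a 0 := fun x₀ =>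
      ⟨L + ((innerSL ℝ x₀).comp (ContinuousLinearMap.fst ℝ E ℝ)).smulRight (a 0), fun u => by simp⟩
    have hrange : Set.range a = insert (a 0) (Set.range b) := by
      rw [hb, ← Fin.range_cons]
      congr 1
      ext j
      refine Fin.cases ?_ (fun j => ?_) j <;> simp
    by_cases hmem : a 0 ∈ Submodule.span ℝ (Set.range b)
    · rw [hrange, Submodule.span_insert_eq_span hmem] at hW
      refine ae_of_all _ fun x₀ => ?_
      refine (congrArg (Measure.pi fun j => Q (Fin.succAbove 0 j)) (hpre x₀)).trans ?_
      obtain ⟨L', hL'⟩ := hL' x₀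
      have := ih (fun j => Q (Fin.succAbove 0 j)) (fun j => hQ _) b L' W hW
      simp only [hL'] at this
      exact this
    · -- a functional that isolates the coefficient of `a 0`
      obtain ⟨φ, hφ1, hφ2⟩ := Submodule.exists_dual_map_eq_bot_of_notMem hmem inferInstance
      have hφb : ∀ j, φ (b j) = 0 := fun j => by
        have : φ (b j) ∈ (Submodule.span ℝ (Set.range b)).map φ :=
          Submodule.mem_map_of_mem (Submodule.subset_span ⟨j, rfl⟩)
        rwa [hφ2, Submodule.mem_bot] at this
      have hfr : Module.finrank ℝ (Submodule.span ℝ (Set.range a)) ≤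
          Module.finrank ℝ (Submodule.span ℝ (Set.range b)) + 1 := by
        rw [hrange, Submodule.span_insert]
        refine (Submodule.finrank_add_le_finrank_add_finrank _ _).trans ?_
        have := finrank_span_singleton (K := ℝ) (v := a 0) fun h => hmem (h ▸ zero_mem _)
        omega
      by_cases hex : ∃ u ∈ W, u.1 ≠ 0
      · obtain ⟨u₀, hu₀, hu₀1⟩ := hex
        have hnull := hQ 0 u₀.1 (-(φ (L u₀) / φ (a 0))) hu₀1
        refine (measure_eq_zero_iff_ae_notMem.1 hnull).mono fun x₀ hx₀ => ?_
        refine (congrArg (Measure.pi fun j => Q (Fin.succAbove 0 j)) (hpre x₀)).trans ?_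
        obtain ⟨L', hL'⟩ := hL' x₀
        set W' : Submodule ℝ (E × ℝ) := W ⊓ LinearMap.ker (φ ∘ₗ (L' : E × ℝ →ₗ[ℝ] F)) with hW'
        have hlt : W' < W := by
          refine lt_of_le_of_ne inf_le_left fun h => hx₀ ?_
          have hu' : u₀ ∈ W' := h ▸ hu₀
          have h2 : φ (L' u₀) = 0 := hu'.2
          rw [hL', map_add, map_smul, smul_eq_mul] at h2
          simp only [Set.mem_ofPred_eq]
          field_simp
          linarith
        have h3 := Submodule.finrank_lt_finrank_of_lt hlt
        have := ih (fun j => Q (Fin.succAbove 0 j)) (fun j => hQ _) b L' W' (by omega)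
        refine measure_mono_null ?_ this
        rintro x ⟨u, hu, hu1, h⟩
        refine ⟨u, ⟨hu, ?_⟩, hu1, by rw [hL']; exact h⟩
        have h4 := congrArg φ h
        rw [map_add, map_sum, map_zero] at h4
        simp only [map_smul, hφb, smul_zero, Finset.sum_const_zero, add_zero, ← hL'] at h4
        exact h4
      · refine ae_of_all _ fun x₀ => ?_
        refine (congrArg (Measure.pi fun j => Q (Fin.succAbove 0 j)) (hpre x₀)).trans ?_
        have : {x : Fin N → E | ∃ u ∈ W, u.1 ≠ 0 ∧ (L u + inner ℝ x₀ u.1 • a 0)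
            + ∑ j, inner ℝ (x j) u.1 • b j = 0} = ∅ := by
          ext x
          simp only [Set.mem_ofPred_eq, Set.mem_empty_iff_false, iff_false]
          rintro ⟨u, hu, hu1, -⟩
          exact hex ⟨u, hu, hu1⟩
        rw [this, measure_empty]; rfl

theorem gaussian_hyperplane_eq_zero (m v : EuclideanSpace ℝ (Fin d)) {σ : ℝ} (hσ : σ ≠ 0)
    (hv : v ≠ 0) (r : ℝ) :
    multivariateGaussian m (σ ^ 2 • (1 : Matrix (Fin d) (Fin d) ℝ)) {x | inner ℝ x v = r} = 0 := by
  have h := IsGaussian.map_eq_gaussianReal (μ := multivariateGaussian m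
    (σ ^ 2 • (1 : Matrix (Fin d) (Fin d) ℝ))) (innerSL ℝ v)
  have hvar : Var[innerSL ℝ v; multivariateGaussian m
      (σ ^ 2 • (1 : Matrix (Fin d) (Fin d) ℝ))] = σ ^ 2 * ‖v‖ ^ 2 := by
    rw [← variance_inner_gaussian m v σ]
    congr 1
    ext x
    simp [real_inner_comm]
  have hpos : 0 < σ ^ 2 * ‖v‖ ^ 2 := by
    have := norm_pos_iff.2 hv
    positivity
  rw [hvar] at h
  have hna := nullSingletonClass_gaussianReal (μ := (multivariateGaussian m
    (σ ^ 2 • (1 : Matrix (Fin d) (Fin d) ℝ)))[innerSL ℝ v]) (v := (σ ^ 2 * ‖v‖ ^ 2).toNNReal)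
    (by simpa using hpos)
  have h1 := congrArg (fun μ => μ {r}) h
  simp only [measure_singleton] at h1
  rw [Measure.map_apply (by fun_prop) (measurableSet_singleton r)] at h1
  convert h1 using 2
  ext x
  simp [real_inner_comm]

/-- If the features are not degenerate and the adjacency matrix has rank at least `d + 1`, then almost
surely distinct weight vectors are told apart by some node. -/
theorem featureLaw_exists_relation_eq_zero (μ ν : EuclideanSpace ℝ (Fin d)) {σ : ℝ} (hσ : σ ≠ 0)
    (y : Fin n → Bool) (A : Matrix (Fin n) (Fin n) ℝ) (hA : d + 1 ≤ A.rank) :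
    featureLaw μ ν σ y {x | ∃ (v : EuclideanSpace ℝ (Fin d)) (c : ℝ), v ≠ 0 ∧
      ∀ i, ∑ j, A i j * (inner ℝ (x j) v + c) = 0} = 0 := by
  have h := pi_exists_relation_eq_zero n (fun j => multivariateGaussian (if y j then ν else μ)
    (σ ^ 2 • (1 : Matrix (Fin d) (Fin d) ℝ))) (fun j v r hv => gaussian_hyperplane_eq_zero _ _ hσ hv r)
    (fun j i => A i j) ((ContinuousLinearMap.snd ℝ _ ℝ).smulRight (∑ j, fun i => A i j)) ⊤ (by
      rw [finrank_top, Module.finrank_prod, finrank_euclideanSpace_fin, Module.finrank_self]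
      rw [Matrix.rank_eq_finrank_span_cols] at hA
      exact hA)
  refine measure_mono_null ?_ h
  rintro x ⟨v, c, hv, hx⟩
  refine ⟨(v, c), trivial, hv, ?_⟩
  ext i
  have := hx i
  simp only [mul_add, Finset.sum_add_distrib] at this
  simp [Finset.mul_sum]
  rw [add_comm] at this
  simpa only [mul_comm] using this

theorem IsOptimal.eq_of_no_relation {R : ℝ} {s : Sample n d} {w₁ w₂ : EuclideanSpace ℝ (Fin d)}
    {b₁ b₂ : ℝ} (h₁ : IsOptimal R s w₁ b₁) (h₂ : IsOptimal R s w₂ b₂) (hd : ∀ i, deg s i ≠ 0)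
    (hs : ¬ ∃ (v : EuclideanSpace ℝ (Fin d)) (c : ℝ), v ≠ 0 ∧
      ∀ i, ∑ j, adj s i j * (inner ℝ (s.2.2 j) v + c) = 0) : w₁ = w₂ := by
  by_contra hne
  refine hs ⟨w₁ - w₂, b₁ - b₂, sub_ne_zero.2 hne, fun i => ?_⟩
  have h := h₁.margin_eq h₂ i
  have e := congrArg (fun z => inner ℝ z (w₁ - w₂)) (deg_smul_sgc s i (hd i))
  simp only [real_inner_smul_left, sum_inner] at e
  simp only [mul_add, Finset.sum_add_distrib, ← Finset.sum_mul]
  rw [← e]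
  change deg s i * _ + deg s i * _ = 0
  rw [← mul_add, h, mul_zero]

/-! ### The training sample and the test sample -/

/-- The contrast between the noise of the two classes, as it enters the lower bound for the loss. -/
noncomputable def contrast (μ ν : EuclideanSpace ℝ (Fin d)) (s : Sample n d) :
    EuclideanSpace ℝ (Fin d) := ∑ j, coef s.1 (adj s) j • noise μ ν s j

/-- Some direction `v ≠ 0` cannot be told from a change `-c` of the bias by the average features of
the neighbourhoods (summed instead of averaged here, to avoid the division by the degree). -/
def HasRelation (s : Sample n d) : Prop :=
  ∃ (v : EuclideanSpace ℝ (Fin d)) (c : ℝ), v ≠ 0 ∧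
    ∀ i, ∑ j, adj s i j * (inner ℝ (s.2.2 j) v + c) = 0

/-- The properties of a typical training sample: the graph is regular, the noise of the features is
small both in the contrast between the classes (in all directions) and in the direction of the ideal
weight vector `w`, and unless there is no noise the optimal weight vector is unique. -/
structure IsTypical (R : ℝ) (μ ν w : EuclideanSpace ℝ (Fin d)) (σ D Γ θ η : ℝ) (s : Sample n d) :
    Prop where
  regular : IsRegular s.1 (adj s) D Γ θ η
  contrast_le : R * ‖contrast μ ν s‖ ≤ θ * n * D
  noise_le : ∑ i, |∑ j, adj s i j * inner ℝ (noise μ ν s j) w| ≤ θ * n * D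
  no_relation : σ = 0 ∨ ¬ HasRelation s

theorem sum_sq_edgeMat_le {y : Fin n → Bool} {e : Pair n → Bool} {D Γ θ η : ℝ}
    (h : IsRegular y (edgeMat e) D Γ θ η) (hD : 0 < D) (hη : η ≤ 1 / 2) :
    ∑ i, ∑ j, edgeMat e i j ^ 2 ≤ n * (3 / 2 * D) := by
  have ha : ∀ i j, edgeMat e i j ^ 2 = edgeMat e i j := fun i j => by
    unfold edgeMat; split_ifs <;> norm_num
  simp only [ha]
  calc _ ≤ ∑ _i : Fin n, 3 / 2 * D := Finset.sum_le_sum fun i _ => h.rowSum_le hD hη i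
    _ = _ := by simp

/-- The three terms of the bound stem from the labels, the edges and the features. In the last one,
`d / n` is the price for controlling the contrast in all directions; the other factor stays bounded
if the accuracy `θ` is proportional to `Γ`. -/
theorem csbm_not_isTypical_le (p q : unitInterval) (μ ν w : EuclideanSpace ℝ (Fin d)) (σ : ℝ)
    {R D Γ θ η M : ℝ} (hR : 0 < R) (hw : ‖w‖ ≤ R) (hn : 0 < n) (hD : 0 < D)
    (hDα : D = n * (((p : ℝ) + q) / 2)) (hΓ : Γ = ((p : ℝ) - q) / (p + q)) (hθ : 0 < θ)
    (hθη : θ ≤ η / 2) (hη : η ≤ 1 / 2) (hθn : 8 ≤ θ * n) (hM : 0 < M)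
    (hv : 1 ≤ n * ((q : ℝ) * (1 - q))) (hd : (d + 2) * (768 * M) ≤ n) :
    csbm n d p q μ ν σ {s | ¬ IsTypical R μ ν w σ D Γ θ η s} ≤
      ENNReal.ofReal (16 / (θ ^ 2 * n)) +
      ENNReal.ofReal (80 / (θ ^ 2 * D) + n * (2 * Real.exp (-(D * η ^ 2 / 16))) +
        (1 / M + 300 / (n * ((q : ℝ) * (1 - q))) ^ 2)) +
      ENNReal.ofReal (120 * σ ^ 2 * R ^ 2 * (d / n) * ((Γ ^ 2 + θ ^ 2) / θ ^ 2) +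
        2 * σ ^ 2 * R ^ 2 / (θ ^ 2 * D)) := by
  have hn' : (0 : ℝ) < n := by positivity
  set L : Set (Fin n → Bool) := {y | θ / 4 * n < |∑ i, sgn y i|} with hL
  set E : (Fin n → Bool) → Set (Pair n → Bool) := fun y =>
    {x | ¬ IsRegular y (edgeMat x) D Γ θ η} ∪ {x | (edgeMat x).rank < d + 1} with hE
  set F₁ : (Fin n → Bool) → (Pair n → Bool) → Set (Fin n → EuclideanSpace ℝ (Fin d)) := fun y e =>
    {x | θ * n * D / R ≤ ‖∑ j, coef y (edgeMat e) j • (x j - if y j then ν else μ)‖} with hF₁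
  set F₂ : (Fin n → Bool) → (Pair n → Bool) → Set (Fin n → EuclideanSpace ℝ (Fin d)) := fun y e =>
    {x | θ * n * D ≤ ∑ i, |∑ j, edgeMat e i j * inner ℝ (x j - if y j then ν else μ) w|} with hF₂
  set F₃ : (Fin n → Bool) → (Pair n → Bool) → Set (Fin n → EuclideanSpace ℝ (Fin d)) := fun y e =>
    {x | σ ≠ 0 ∧ ∃ (v : EuclideanSpace ℝ (Fin d)) (c : ℝ), v ≠ 0 ∧
      ∀ i, ∑ j, edgeMat e i j * (inner ℝ (x j) v + c) = 0} with hF₃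
  refine (measure_mono ?_).trans (csbm_le p q μ ν σ L E (fun y e => F₁ y e ∪ F₂ y e ∪ F₃ y e)
    ?_ ?_ ?_)
  · intro s hs
    by_contra hc
    simp only [Set.mem_ofPred_eq, not_or, Set.mem_union, hE, hF₁, hF₂, hF₃, not_and, not_not,
      not_le] at hc hs
    refine hs ⟨hc.2.1.1, ?_, hc.2.2.1.2.le, ?_⟩
    · have h := hc.2.2.1.1
      rw [lt_div_iff₀ hR, mul_comm] at h
      exact h.le
    · by_cases h0 : σ = 0
      · exact Or.inl h0
      · exact Or.inr (hc.2.2.2 h0)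
  · refine (labelProb_unbalanced_le hn (by positivity)).trans (le_of_eq ?_)
    congr 1
    field_simp
    norm_num
  · intro y hy
    simp only [hL, Set.mem_ofPred_eq, not_lt] at hy
    rw [← ofReal_measureReal]
    refine ENNReal.ofReal_le_ofReal ((measureReal_union_le _ _).trans (add_le_add ?_ ?_))
    · rw [hΓ]
      exact edgeLaw_not_isRegular_le p q y hn hD hDα hθ hθη (by linarith) hθn (by linarith)
    · refine edgeLaw_rank_lt_le p q y hM (hy.trans ?_) hv hd
      nlinarith
  · intro y hy e he
    simp only [hE, Set.mem_union, Set.mem_ofPred_eq, not_or, not_not, not_lt] at he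
    obtain ⟨hreg, hrank⟩ := he
    have h3 : featureLaw μ ν σ y (F₃ y e) = 0 := by
      by_cases h0 : σ = 0
      · simp [hF₃, h0]
      · simp only [hF₃, ne_eq, h0, not_false_eq_true, true_and]
        exact featureLaw_exists_relation_eq_zero μ ν h0 y _ hrank
    refine (measure_union_le _ _).trans ?_
    rw [h3, add_zero]
    refine (measure_union_le _ _).trans ?_
    rw [ENNReal.ofReal_add (by positivity) (by positivity)]
    refine add_le_add ?_ ?_
    · refine (featureLaw_norm_noise_le μ ν σ y _ (by positivity)).trans
        (ENNReal.ofReal_le_ofReal ?_)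
      have h1 := hreg.sum_coef_sq hn hD hθ.le hη (edgeMat_symm e)
      rw [div_le_iff₀ (by positivity)]
      refine (mul_le_mul_of_nonneg_left h1 (by positivity)).trans (le_of_eq ?_)
      field_simp
    · refine (featureLaw_sum_abs_noise_le μ ν w σ y _ (by positivity)).trans
        (ENNReal.ofReal_le_ofReal ?_)
      have h1 := sum_sq_edgeMat_le hreg hD hη
      have h2 : ‖w‖ ^ 2 ≤ R ^ 2 := pow_le_pow_left₀ (norm_nonneg _) hw 2
      have h4 : σ ^ 2 * ‖w‖ ^ 2 * (n * ∑ i, ∑ j, edgeMat e i j ^ 2) ≤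
          σ ^ 2 * R ^ 2 * (n * (n * (2 * D))) := by
        gcongr
        refine h1.trans ?_
        gcongr
        norm_num
      rw [div_le_iff₀ (by positivity)]
      refine h4.trans (le_of_eq ?_)
      field_simp

/-- An optimal classifier of a typical training sample has almost the largest possible correlation
with the difference of the class means. -/
theorem IsTypical.le_of_isOptimal {R D Γ θ η κ γ b : ℝ} {μ ν w₀ w : EuclideanSpace ℝ (Fin d)} {σ : ℝ}
    {s : Sample n d} (h : IsTypical R μ ν w₀ σ D Γ θ η s) (hopt : IsOptimal R s w b) (hR : 0 < R)
    (hn : 0 < n) (hD : 0 < D) (hΓ0 : 0 < Γ) (hΓ1 : Γ ≤ 1) (hκ : 0 < κ) (hθ : θ = κ * Γ)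
    (hη : 0 ≤ η) (hηθ : η + 6 * θ ≤ Real.sigmoid (-R) / 2)
    (hμ : ‖μ‖ ≤ 1) (hν : ‖ν‖ ≤ 1) (hγ0 : 0 ≤ γ) (hγ : γ ≤ 2) (hw₀ : ‖w₀‖ ≤ R)
    (hw₀γ : inner ℝ (μ - ν) w₀ = -(R * γ)) :
    R * γ + inner ℝ (μ - ν) w ≤ 2 * (lossConst R + 3 + 2 * R) * κ / Real.sigmoid (-R) := by
  have hθ0 : 0 < θ := by rw [hθ]; positivity
  have hsR := Real.sigmoid_pos (-R)
  have hsR1 := Real.sigmoid_lt_one (-R)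
  set t := -Γ * (R * γ) / 2 with ht
  have htR : |t| ≤ R := by
    rw [ht, abs_le]
    have h1 : R * γ ≤ R * 2 := by gcongr
    have h2 : Γ * (R * γ) ≤ 1 * (R * 2) := mul_le_mul hΓ1 h1 (by positivity) (by norm_num)
    have h3 : 0 ≤ Γ * (R * γ) := by positivity
    constructor <;> linarith
  have hz : |inner ℝ (∑ j, coef s.1 (adj s) j • noise μ ν s j) w| ≤ θ * n * D := by
    refine (abs_real_inner_le_norm _ _).trans (le_trans ?_ h.contrast_le)
    rw [mul_comm]
    exact mul_le_mul_of_nonneg_right hopt.1 (norm_nonneg _)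
  have hlow := le_loss h.regular hn hD hθ0.le (by rw [abs_of_pos hΓ0]; exact hΓ1) hη hηθ hμ hν
    hopt.1 htR b hz
  have hup := loss_le (R := R) h.regular hn hD hθ0.le (by linarith) hw₀γ (by positivity)
    (by nlinarith) h.noise_le
  have hle := hopt.2 w₀ (-inner ℝ ((1 / 2 : ℝ) • (μ + ν)) w₀) hw₀
  rw [← ht] at hup
  have hu : Real.sigmoid (-R) ≤ Real.sigmoid t := Real.sigmoid_le (abs_le.1 htR).1
  set u := Real.sigmoid t
  have hkey : u * (Γ / 2) * (R * γ + inner ℝ (μ - ν) w) ≤ (lossConst R + 3 + 2 * R) * (κ * Γ) := by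
    have e : u * t = -(u * (Γ / 2) * (R * γ)) := by rw [ht]; ring
    rw [← hθ]
    linarith
  have hkey2 : Γ * (u * (R * γ + inner ℝ (μ - ν) w)) ≤
      Γ * (2 * (lossConst R + 3 + 2 * R) * κ) := by linarith
  have hkey3 := le_of_mul_le_mul_left hkey2 hΓ0
  rw [le_div_iff₀ hsR]
  have hC := lossConst_pos hR
  rcases le_total 0 (R * γ + inner ℝ (μ - ν) w) with h0 | h0
  · have := mul_le_mul_of_nonneg_right hu h0
    linarith
  · have h1 : 0 ≤ 2 * (lossConst R + 3 + 2 * R) * κ := by positivity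
    have h2 := mul_nonpos_of_nonpos_of_nonneg h0 hsR.le
    linarith

/-- On a regular test graph of the opposite regime, a classifier with almost maximal correlation with
the difference of the class means has a large loss. -/
theorem le_test_loss {R D Γ θ η γ ξ b : ℝ} {μ ν w : EuclideanSpace ℝ (Fin d)} {s : Sample n d}
    (h : IsRegular s.1 (adj s) D Γ θ η) (hR : 0 < R) (hn : 0 < n) (hD : 0 < D)
    (hΓ0 : Γ ≤ 0) (hΓ1 : -1 ≤ Γ) (hθ0 : 0 ≤ θ)
    (hη : 0 ≤ η) (hηθ : η + 6 * θ ≤ Real.sigmoid (-R) / 2)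
    (hμ : ‖μ‖ ≤ 1) (hν : ‖ν‖ ≤ 1) (hγ : γ = ‖μ - ν‖) (hw : ‖w‖ ≤ R)
    (hz : |inner ℝ (contrast μ ν s) w| ≤ θ * n * D)
    (hξ : R * γ + inner ℝ (μ - ν) w ≤ ξ)
    (hsmall : ξ / 2 + (lossConst R + 1) * θ ≤ softplus (-R)) :
    R * (-Γ) / 2 * γ ≤ loss s w b := by
  have hγ0 : 0 ≤ γ := by rw [hγ]; exact norm_nonneg _
  have hγ2 : γ ≤ 2 := by rw [hγ]; exact (norm_sub_le _ _).trans (by linarith)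
  set t := -Γ * (R * γ) / 2 with ht
  have ht0 : 0 ≤ t := by
    rw [ht]
    have := mul_nonneg (neg_nonneg.2 hΓ0) (mul_nonneg hR.le hγ0)
    linarith
  have htR : t ≤ R := by
    have h1 : R * γ ≤ R * 2 := by gcongr
    have h2 : -Γ * (R * γ) ≤ 1 * (R * 2) :=
      mul_le_mul (by linarith) h1 (by positivity) (by norm_num)
    rw [ht]; linarith
  have hlow := le_loss h hn hD hθ0 (by rw [abs_le]; constructor <;> linarith) hη hηθ hμ hν hw
    (by rw [abs_of_nonneg ht0]; exact htR) b hz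
  have hsp : t + softplus (-R) ≤ softplus t := by
    rw [softplus_eq_add_neg t]
    have := softplus_mono (neg_le_neg htR)
    linarith
  have hu0 := Real.sigmoid_pos t
  have hu1 := Real.sigmoid_lt_one t
  set u := Real.sigmoid t
  have e : u * t = -(u * (Γ / 2) * (R * γ)) := by rw [ht]; ring
  have hnn : 0 ≤ R * γ + inner ℝ (μ - ν) w := by
    have h1 := (abs_le.1 (abs_real_inner_le_norm (μ - ν) w)).1
    have h2 := mul_le_mul_of_nonneg_left hw hγ0
    rw [← hγ] at h1
    linarith
  have hs : -(ξ / 2) ≤ u * (Γ / 2) * (R * γ + inner ℝ (μ - ν) w) := by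
    have h1 : u * (-Γ) ≤ 1 := mul_le_one₀ hu1.le (by linarith) (by linarith)
    have h2 := mul_le_mul_of_nonneg_right h1 hnn
    linarith
  have e2 : R * (-Γ) / 2 * γ = t := by rw [ht]; ring
  rw [e2]
  linarith

/-- The contrast of the test noise in the directions `𝒲` is small with high probability. The dimension
does not enter, so `𝒲` may have only one element, unless there is no noise. -/
theorem csbm_test_le (p q : unitInterval) (μ ν : EuclideanSpace ℝ (Fin d)) (σ : ℝ)
    {R D Γ θ η : ℝ} (𝒲 : Set (EuclideanSpace ℝ (Fin d))) (h𝒲 : σ = 0 ∨ 𝒲.Subsingleton)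
    (hR : 0 < R) (h𝒲R : ∀ w ∈ 𝒲, ‖w‖ ≤ R) (hn : 0 < n) (hD : 0 < D)
    (hDα : D = n * (((p : ℝ) + q) / 2)) (hΓ : Γ = ((p : ℝ) - q) / (p + q)) (hΓ1 : |Γ| ≤ 1)
    (hθ : 0 < θ) (hθη : θ ≤ η / 2) (hη : η ≤ 1 / 2) (hθn : 8 ≤ θ * n) :
    csbm n d p q μ ν σ {s | ¬ IsRegular s.1 (adj s) D Γ θ η ∨
        ∃ w ∈ 𝒲, θ * n * D ≤ |inner ℝ (contrast μ ν s) w|} ≤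
      ENNReal.ofReal (16 / (θ ^ 2 * n)) +
      ENNReal.ofReal (80 / (θ ^ 2 * D) + n * (2 * Real.exp (-(D * η ^ 2 / 16)))) +
      ENNReal.ofReal (240 * σ ^ 2 * R ^ 2 / (θ ^ 2 * n)) := by
  have hn' : (0 : ℝ) < n := by positivity
  set L : Set (Fin n → Bool) := {y | θ / 4 * n < |∑ i, sgn y i|} with hL
  set F : (Fin n → Bool) → (Pair n → Bool) → Set (Fin n → EuclideanSpace ℝ (Fin d)) := fun y e =>
    {x | ∃ w ∈ 𝒲, θ * n * D ≤
      |inner ℝ (∑ j, coef y (edgeMat e) j • (x j - if y j then ν else μ)) w|} with hF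
  refine (measure_mono ?_).trans (csbm_le p q μ ν σ L
    (fun y => {x | ¬ IsRegular y (edgeMat x) D Γ θ η}) F ?_ ?_ ?_)
  · rintro s (hs | hs)
    · exact Or.inr (Or.inl hs)
    · exact Or.inr (Or.inr hs)
  · refine (labelProb_unbalanced_le hn (by positivity)).trans (le_of_eq ?_)
    congr 1
    field_simp
    norm_num
  · intro y hy
    simp only [hL, Set.mem_ofPred_eq, not_lt] at hy
    rw [← ofReal_measureReal]
    refine ENNReal.ofReal_le_ofReal ?_
    rw [hΓ]
    exact edgeLaw_not_isRegular_le p q y hn hD hDα hθ hθη (by linarith) hθn (by linarith)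
  · intro y hy e he
    simp only [Set.mem_ofPred_eq, not_not] at he
    rcases h𝒲 with h0 | hsub
    · have hsub : F y e ⊆ {x | θ * n * D / R ≤
          ‖∑ j, coef y (edgeMat e) j • (x j - if y j then ν else μ)‖} := by
        rintro x ⟨w, hw, hx⟩
        simp only [Set.mem_ofPred_eq]
        rw [div_le_iff₀ hR]
        exact hx.trans ((abs_real_inner_le_norm _ _).trans
          (mul_le_mul_of_nonneg_left (h𝒲R w hw) (norm_nonneg _)))
      refine (measure_mono hsub).trans ((featureLaw_norm_noise_le μ ν σ y _ (by positivity)).trans ?_)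
      rw [h0]
      simp
    · rcases hsub.eq_empty_or_singleton with h0 | ⟨w, h0⟩
      · simp [hF, h0]
      · simp only [hF, h0, Set.mem_singleton_iff, exists_eq_left]
        refine (featureLaw_inner_noise_le μ ν w σ y _ (by positivity)).trans
          (ENNReal.ofReal_le_ofReal ?_)
        have hw : ‖w‖ ≤ R := h𝒲R w (h0 ▸ rfl)
        have h1 := he.sum_coef_sq hn hD hθ.le hη (edgeMat_symm e)
        have h2 : ‖w‖ ^ 2 ≤ R ^ 2 := pow_le_pow_left₀ (norm_nonneg _) hw 2
        have h3 : Γ ^ 2 + θ ^ 2 ≤ 2 := by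
          have h4 : Γ ^ 2 ≤ 1 := by rw [← sq_abs]; exact pow_le_one₀ (abs_nonneg _) hΓ1
          nlinarith
        have h4 : σ ^ 2 * ‖w‖ ^ 2 * ∑ j, coef y (edgeMat e) j ^ 2 ≤
            σ ^ 2 * R ^ 2 * (120 * n * D ^ 2 * 2) := by
          gcongr
          exact h1.trans (by gcongr)
        rw [div_le_iff₀ (by positivity)]
        refine h4.trans (le_of_eq ?_)
        field_simp
        ring

/-! ### Measurability, and combining training and test sample -/

/-- A function of a sample is continuous if it is continuous in the features, as labels and edges are
discrete. -/
theorem continuous_sample {Y Z : Type*} [TopologicalSpace Y] [TopologicalSpace Z]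
    {f : Sample n d × Z → Y} (h : ∀ y e, Continuous fun x : (Fin n → EuclideanSpace ℝ (Fin d)) × Z =>
      f ((y, e, x.1), x.2)) : Continuous f := by
  have hg : Continuous fun a : (Fin n → Bool) × ((Pair n → Bool) ×
      ((Fin n → EuclideanSpace ℝ (Fin d)) × Z)) => f ((a.1, a.2.1, a.2.2.1), a.2.2.2) :=
    continuous_prod_of_discrete_left.2 fun y => continuous_prod_of_discrete_left.2 fun e => h y e
  exact hg.comp (f := fun z : Sample n d × Z => (z.1.1, (z.1.2.1, (z.1.2.2, z.2)))) (by fun_prop)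

theorem continuous_loss_sample : Continuous fun z : Sample n d × (EuclideanSpace ℝ (Fin d) × ℝ) =>
    loss z.1 z.2.1 z.2.2 := by
  refine continuous_sample fun y e => ?_
  simp only [loss_eq]
  refine continuous_const.mul (continuous_finsetSum _ fun i _ => continuous_softplus.comp
    (continuous_const.mul (Continuous.add (Continuous.inner ?_ (by fun_prop)) (by fun_prop))))
  change Continuous fun x : (Fin n → EuclideanSpace ℝ (Fin d)) × (EuclideanSpace ℝ (Fin d) × ℝ) =>
    (rowSum (edgeMat e) i)⁻¹ • ∑ j, edgeMat e i j • x.1 j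
  fun_prop

theorem continuous_contrast (μ ν : EuclideanSpace ℝ (Fin d)) :
    Continuous fun s : Sample n d => contrast μ ν s := by
  have h : Continuous fun z : Sample n d × Unit => contrast μ ν z.1 := by
    refine continuous_sample fun y e => ?_
    change Continuous fun x : (Fin n → EuclideanSpace ℝ (Fin d)) × Unit =>
      ∑ j, coef y (edgeMat e) j • (x.1 j - if y j then ν else μ)
    fun_prop
  exact h.comp (f := fun s => (s, ())) (by fun_prop)

theorem isClosed_isOptimal (R : ℝ) : IsClosed
    {z : Sample n d × (EuclideanSpace ℝ (Fin d) × ℝ) | IsOptimal R z.1 z.2.1 z.2.2} := by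
  unfold IsOptimal
  refine IsClosed.and (isClosed_le (by fun_prop) continuous_const) ?_
  simp only [Set.ofPred_forall]
  refine isClosed_iInter fun v => isClosed_iInter fun c => isClosed_iInter fun _ =>
    isClosed_le continuous_loss_sample ?_
  exact continuous_loss_sample.comp (f := fun z : Sample n d × (EuclideanSpace ℝ (Fin d) × ℝ) =>
    (z.1, (v, c))) (by fun_prop)

instance : BorelSpace (Sample n d) := Prod.borelSpace

/-- The event that some optimal classifier of the training sample is correlated with the noise of the
test sample is a countable union of projections of closed sets along compact sets. -/
theorem measurableSet_exists_isOptimal {m : ℕ} (R ζ : ℝ) (μ ν : EuclideanSpace ℝ (Fin d)) :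
    MeasurableSet {s : Sample n d × Sample m d |
      ∃ w b, IsOptimal R s.1 w b ∧ ζ ≤ |inner ℝ (contrast μ ν s.2) w|} := by
  have e : {s : Sample n d × Sample m d |
      ∃ w b, IsOptimal R s.1 w b ∧ ζ ≤ |inner ℝ (contrast μ ν s.2) w|} =
      ⋃ k : ℕ, {s | ∃ u ∈ Metric.closedBall (0 : EuclideanSpace ℝ (Fin d)) R ×ˢ
        Set.Icc (-(k : ℝ)) k, (s, u) ∈ {z : (Sample n d × Sample m d) ×
          (EuclideanSpace ℝ (Fin d) × ℝ) | IsOptimal R z.1.1 z.2.1 z.2.2 ∧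
            ζ ≤ |inner ℝ (contrast μ ν z.1.2) z.2.1|}} := by
    ext s
    simp only [Set.mem_ofPred_eq, Set.mem_iUnion]
    constructor
    · rintro ⟨w, b, h, hz⟩
      obtain ⟨k, hk⟩ := exists_nat_ge |b|
      exact ⟨k, (w, b), ⟨by simpa using h.1, abs_le.1 hk⟩, h, hz⟩
    · rintro ⟨k, u, -, h⟩
      exact ⟨u.1, u.2, h⟩
  rw [e]
  refine MeasurableSet.iUnion fun k => (isClosed_exists_mem
    ((isCompact_closedBall _ _).prod isCompact_Icc) (IsClosed.and ?_ ?_)).measurableSet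
  · exact (isClosed_isOptimal R).preimage (f := fun z : (Sample n d × Sample m d) ×
      (EuclideanSpace ℝ (Fin d) × ℝ) => (z.1.1, z.2)) (by fun_prop)
  · refine isClosed_le continuous_const (continuous_abs.comp (Continuous.inner ?_ (by fun_prop)))
    exact (continuous_contrast μ ν).comp (f := fun z : (Sample n d × Sample m d) ×
      (EuclideanSpace ℝ (Fin d) × ℝ) => z.1.2) (by fun_prop)

/-- Union bound for two independent stages; `B` need not be measurable. -/
theorem prod_le_add_of_forall_notMem {X Y : Type*} [MeasurableSpace X] [MeasurableSpace Y]
    (P : Measure X) (Q : Measure Y) [IsProbabilityMeasure P] [IsProbabilityMeasure Q]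
    {S : Set (X × Y)} (hS : MeasurableSet S) (B : Set X) {c : ℝ≥0∞}
    (h : ∀ x ∉ B, Q (Prod.mk x ⁻¹' S) ≤ c) : P.prod Q S ≤ P B + c := by
  rw [Measure.prod_apply hS]
  calc _ ≤ ∫⁻ x, ((toMeasurable P B).indicator 1 x + c) ∂P := by
        refine lintegral_mono fun x => ?_
        by_cases hx : x ∈ toMeasurable P B
        · rw [Set.indicator_of_mem hx]
          exact le_add_right prob_le_one
        · exact le_add_left (h x fun hB => hx (subset_toMeasurable P B hB))
    _ = _ := by
        rw [lintegral_add_right _ measurable_const,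
          lintegral_indicator_one (measurableSet_toMeasurable P B), measure_toMeasurable]
        simp

/-! ### The failure probability for given sizes -/

variable {m : ℕ}

/-- A minimizer exists as soon as both classes occur. -/
theorem csbm_forall_not_isOptimal_le (p q : unitInterval) (μ ν : EuclideanSpace ℝ (Fin d)) (σ : ℝ)
    {R : ℝ} (hR : 0 ≤ R) (hn : 0 < n) :
    csbm n d p q μ ν σ {s | ¬ ∃ w b, IsOptimal R s w b} ≤ ENNReal.ofReal (4 / n) := by
  have hn' : (0 : ℝ) < n := by positivity
  refine (measure_mono ?_).trans ((csbm_le p q μ ν σ {y | 1 / 2 * (n : ℝ) < |∑ i, sgn y i|}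
    (fun _ => ∅) (fun _ _ => ∅) (labelProb_unbalanced_le hn (by norm_num)) (b := 0) (c := 0)
    (by simp) (by simp)).trans (le_of_eq ?_))
  · intro s hs
    refine Or.inl ?_
    by_contra hc
    simp only [Set.mem_ofPred_eq, not_lt] at hc hs
    refine hs (exists_isOptimal hR s ?_ ?_)
    · by_contra h
      push Not at h
      have e : ∑ i, sgn s.1 i = -n := by
        simp only [sgn, Bool.not_eq_false] at h ⊢
        simp [h]
      rw [e, abs_neg, abs_of_pos hn'] at hc
      linarith
    · by_contra h
      push Not at h
      have e : ∑ i, sgn s.1 i = n := by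
        simp only [sgn, Bool.not_eq_true] at h ⊢
        simp [h]
      rw [e, abs_of_pos hn'] at hc
      linarith
  · rw [add_zero, add_zero]
    congr 1
    field_simp
    norm_num

/-- If training samples are atypical with probability at most `T`, and the test sample is bad for a
given weight vector with probability at most `T'`, then the test loss is as large as claimed up to
probability `2 * (T + T')`. -/
theorem prod_csbm_le (p q p' q' : unitInterval) {μ ν : EuclideanSpace ℝ (Fin d)} {σ : ℝ}
    {R D Γ κ η D' Γ' θ' : ℝ} {w₀ : EuclideanSpace ℝ (Fin d)} {T T' : ℝ≥0∞}
    (hR : 0 < R) (hn : 0 < n) (hm : 0 < m) (hD : 0 < D) (hD' : 0 < D') (hΓ0 : 0 < Γ) (hΓ1 : Γ ≤ 1)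
    (hΓ'0 : Γ' ≤ 0) (hΓ'1 : -1 ≤ Γ') (hκ : 0 < κ) (hη : η = Real.sigmoid (-R) / 8)
    (hκη : κ ≤ η / 2)
    (hκR : 2 * (lossConst R + 3 + 2 * R) * κ / Real.sigmoid (-R) ≤ softplus (-R))
    (hθ' : 0 < θ') (hθη : θ' ≤ η / 2) (hθR : (lossConst R + 1) * θ' ≤ softplus (-R) / 2)
    (hμ : ‖μ‖ ≤ 1) (hν : ‖ν‖ ≤ 1) (hw₀ : ‖w₀‖ ≤ R)
    (hw₀γ : inner ℝ (μ - ν) w₀ = -(R * ‖μ - ν‖))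
    (hT : csbm n d p q μ ν σ {s | ¬ IsTypical R μ ν w₀ σ D Γ (κ * Γ) η s} ≤ T)
    (hT' : ∀ 𝒲 : Set (EuclideanSpace ℝ (Fin d)), (σ = 0 ∨ 𝒲.Subsingleton) → (∀ w ∈ 𝒲, ‖w‖ ≤ R) →
      csbm m d p' q' μ ν σ {s | ¬ IsRegular s.1 (adj s) D' Γ' θ' η ∨
        ∃ w ∈ 𝒲, θ' * m * D' ≤ |inner ℝ (contrast μ ν s) w|} ≤ T') :
    (csbm n d p q μ ν σ).prod (csbm m d p' q' μ ν σ)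
      {s | (∃ w b, IsOptimal R s.1 w b) ∧ ∀ w b, IsOptimal R s.1 w b →
        R * (-Γ') / 2 * ‖μ - ν‖ ≤ loss s.2 w b}ᶜ ≤ 2 * (T + T') := by
  have hs0 := Real.sigmoid_pos (-R)
  have hs1 := Real.sigmoid_lt_one (-R)
  have hθΓ : κ * Γ ≤ η / 2 := by
    have := mul_le_mul_of_nonneg_left hΓ1 hκ.le
    linarith
  set B₁ : Set (Sample n d) := {s | ¬ IsTypical R μ ν w₀ σ D Γ (κ * Γ) η s} with hB₁
  set B₂ : Set (Sample m d) := {s | ¬ IsRegular s.1 (adj s) D' Γ' θ' η} with hB₂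
  set S : Set (Sample n d × Sample m d) :=
    {s | ∃ w b, IsOptimal R s.1 w b ∧ θ' * m * D' ≤ |inner ℝ (contrast μ ν s.2) w|} with hS
  have hsub : {s : Sample n d × Sample m d | (∃ w b, IsOptimal R s.1 w b) ∧
      ∀ w b, IsOptimal R s.1 w b → R * (-Γ') / 2 * ‖μ - ν‖ ≤ loss s.2 w b}ᶜ ⊆
      B₁ ×ˢ Set.univ ∪ S ∪ Set.univ ×ˢ B₂ := by
    intro s hs
    by_contra hc
    simp only [hB₁, hB₂, hS, Set.mem_union, Set.mem_prod, Set.mem_univ, and_true, true_and,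
      Set.mem_ofPred_eq, not_or, not_not, not_exists, not_and, not_le] at hc
    obtain ⟨⟨htyp, hz⟩, hreg⟩ := hc
    refine hs ⟨?_, fun w b hopt => ?_⟩
    · obtain ⟨h0, h1⟩ := htyp.regular.exists_label hn (by linarith)
      exact exists_isOptimal hR.le s.1 h0 h1
    · exact le_test_loss hreg hR hm hD' hΓ'0 hΓ'1 hθ'.le (by linarith) (by linarith) hμ hν rfl hopt.1
        (hz w b hopt).le
        ((htyp.le_of_isOptimal hopt hR hn hD hΓ0 hΓ1 hκ rfl (by linarith) (by linarith) hμ hν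
          (norm_nonneg _) ((norm_sub_le _ _).trans (by linarith)) hw₀ hw₀γ).trans hκR)
        (by linarith)
  have h1 : (csbm n d p q μ ν σ).prod (csbm m d p' q' μ ν σ) (B₁ ×ˢ Set.univ) ≤ T := by
    rw [Measure.prod_prod, measure_univ, mul_one]
    exact hT
  have h2 : (csbm n d p q μ ν σ).prod (csbm m d p' q' μ ν σ) (Set.univ ×ˢ B₂) ≤ T' := by
    rw [Measure.prod_prod, measure_univ, one_mul]
    exact (measure_mono fun s hs => Or.inl hs).trans
      (hT' ∅ (Or.inr Set.subsingleton_empty) (by simp))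
  have h3 : (csbm n d p q μ ν σ).prod (csbm m d p' q' μ ν σ) S ≤ T + T' := by
    refine (prod_le_add_of_forall_notMem _ _ (measurableSet_exists_isOptimal R _ μ ν) B₁
      fun s hs => ?_).trans (add_le_add_left hT T')
    simp only [hB₁, Set.mem_ofPred_eq, not_not] at hs
    refine (measure_mono ?_).trans (hT' {w | ∃ b, IsOptimal R s w b} ?_ ?_)
    · rintro s' ⟨w, b, hopt, hz⟩
      exact Or.inr ⟨w, ⟨b, hopt⟩, hz⟩
    · refine hs.no_relation.imp_right fun hrel => ?_
      rintro w₁ ⟨b₁, h₁⟩ w₂ ⟨b₂, h₂⟩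
      refine h₁.eq_of_no_relation h₂ (fun i => ?_) hrel
      have := hs.regular.half_le_rowSum hD (by linarith) i
      rw [deg_eq_rowSum]
      exact (lt_of_lt_of_le (by positivity) this).ne'
    · rintro w ⟨b, h⟩
      exact h.1
  calc _ ≤ _ := measure_mono hsub
    _ ≤ (T + (T + T')) + T' := (measure_union_le _ _).trans
        (add_le_add ((measure_union_le _ _).trans (add_le_add h1 h3)) h2)
    _ = 2 * (T + T') := by ring

/-! ### The bounds tend to zero -/

section Limits

variable {ι : Type*} {l : Filter ι} {N : ι → ℕ} {p q : ι → unitInterval}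

/-- The form in which the sparsity hypotheses are used. -/
theorem eventually_log_sq_le (hN : Tendsto N l atTop)
    (hp : (fun k => Real.log (N k) ^ 2 / (N k : ℝ)) =o[l] fun k => (p k : ℝ)) :
    ∀ᶠ k in l, Real.log (N k) ^ 2 ≤ N k * (p k : ℝ) := by
  filter_upwards [hp.bound one_pos, hN.eventually_gt_atTop 0] with k hk hk0
  have h0 : (0 : ℝ) < N k := by exact_mod_cast hk0
  rw [Real.norm_of_nonneg (by positivity), Real.norm_of_nonneg (p k).2.1, one_mul,
    div_le_iff₀ h0] at hk
  linarith

theorem tendsto_log_atTop (hN : Tendsto N l atTop) :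
    Tendsto (fun k => Real.log (N k)) l atTop :=
  Real.tendsto_log_atTop.comp (tendsto_natCast_atTop_atTop.comp hN)

theorem tendsto_mul_prob_atTop (hN : Tendsto N l atTop)
    (hp : (fun k => Real.log (N k) ^ 2 / (N k : ℝ)) =o[l] fun k => (p k : ℝ)) :
    Tendsto (fun k => N k * (p k : ℝ)) l atTop :=
  tendsto_atTop_mono' l (eventually_log_sq_le hN hp)
    ((tendsto_pow_atTop two_ne_zero).comp (tendsto_log_atTop hN))

theorem eventually_log_sq_le_degree (hN : Tendsto N l atTop)
    (hp : (fun k => Real.log (N k) ^ 2 / (N k : ℝ)) =o[l] fun k => (p k : ℝ))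
    (hq : (fun k => Real.log (N k) ^ 2 / (N k : ℝ)) =o[l] fun k => (q k : ℝ)) :
    ∀ᶠ k in l, Real.log (N k) ^ 2 ≤ N k * (((p k : ℝ) + q k) / 2) := by
  filter_upwards [eventually_log_sq_le hN hp, eventually_log_sq_le hN hq] with k h1 h2
  linarith

theorem tendsto_degree_atTop (hN : Tendsto N l atTop)
    (hp : (fun k => Real.log (N k) ^ 2 / (N k : ℝ)) =o[l] fun k => (p k : ℝ))
    (hq : (fun k => Real.log (N k) ^ 2 / (N k : ℝ)) =o[l] fun k => (q k : ℝ)) :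
    Tendsto (fun k => N k * (((p k : ℝ) + q k) / 2)) l atTop :=
  tendsto_atTop_mono' l (eventually_log_sq_le_degree hN hp hq)
    ((tendsto_pow_atTop two_ne_zero).comp (tendsto_log_atTop hN))

/-- The union bound over all nodes in the concentration of the degrees. -/
theorem tendsto_mul_exp_degree (hN : Tendsto N l atTop)
    (hp : (fun k => Real.log (N k) ^ 2 / (N k : ℝ)) =o[l] fun k => (p k : ℝ))
    (hq : (fun k => Real.log (N k) ^ 2 / (N k : ℝ)) =o[l] fun k => (q k : ℝ)) {η : ℝ} (hη : 0 < η) :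
    Tendsto (fun k => N k * (2 * Real.exp (-(N k * (((p k : ℝ) + q k) / 2) * η ^ 2 / 16)))) l
      (𝓝 0) := by
  have hN' : Tendsto (fun k => (N k : ℝ)) l atTop := tendsto_natCast_atTop_atTop.comp hN
  refine tendsto_of_tendsto_of_tendsto_of_le_of_le' tendsto_const_nhds
    (hN'.const_div_atTop 2) (Eventually.of_forall fun k => by positivity) ?_
  filter_upwards [eventually_log_sq_le_degree hN hp hq, hN.eventually_gt_atTop 0,
    (tendsto_log_atTop hN).eventually_ge_atTop (32 / η ^ 2)] with k h1 h2 h3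
  have h0 : (0 : ℝ) < N k := by exact_mod_cast h2
  have hη2 : 0 < η ^ 2 := by positivity
  rw [div_le_iff₀ hη2] at h3
  have hlog : 0 ≤ Real.log (N k) := Real.log_natCast_nonneg _
  have h4 : 2 * Real.log (N k) ≤ N k * (((p k : ℝ) + q k) / 2) * η ^ 2 / 16 := by
    have h5 := mul_le_mul_of_nonneg_right h1 hη2.le
    have h6 := mul_le_mul_of_nonneg_right h3 hlog
    nlinarith
  have h5 : Real.exp (-(N k * (((p k : ℝ) + q k) / 2) * η ^ 2 / 16)) ≤ ((N k : ℝ) ^ 2)⁻¹ := by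
    refine (Real.exp_le_exp.2 (neg_le_neg h4)).trans (le_of_eq ?_)
    rw [Real.exp_neg, two_mul, Real.exp_add, Real.exp_log h0, sq]
  calc _ ≤ (N k : ℝ) * (2 * ((N k : ℝ) ^ 2)⁻¹) := by gcongr
    _ = _ := by field_simp

theorem tendsto_ofReal_zero {f : ι → ℝ} (hf : Tendsto f l (𝓝 0)) :
    Tendsto (fun k => ENNReal.ofReal (f k)) l (𝓝 0) := by
  simpa using ENNReal.tendsto_ofReal hf

theorem tendsto_div_of_isLittleO {d : ι → ℕ} (hN : Tendsto N l atTop)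
    (hd : (fun k => (d k : ℝ) * Real.log (d k)) =o[l] fun k => (N k : ℝ)) :
    Tendsto (fun k => ((d k : ℝ) + 2) / N k) l (𝓝 0) := by
  have hN' : Tendsto (fun k => (N k : ℝ)) l atTop := tendsto_natCast_atTop_atTop.comp hN
  have hlim : Tendsto (fun k => (d k : ℝ) * Real.log (d k) / N k + 5 / N k) l (𝓝 0) := by
    simpa using hd.tendsto_div_nhds_zero.add (hN'.const_div_atTop 5)
  refine squeeze_zero (fun k => by positivity) (fun k => ?_) hlim
  rw [← add_div]
  refine div_le_div_of_nonneg_right ?_ (Nat.cast_nonneg _)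
  have hl : 0 ≤ Real.log (d k) := Real.log_natCast_nonneg _
  rcases le_or_gt (d k) 3 with h | h
  · have h3 : (d k : ℝ) ≤ 3 := by exact_mod_cast h
    have := mul_nonneg (Nat.cast_nonneg (α := ℝ) (d k)) hl
    linarith
  · have h4 : (4 : ℝ) ≤ d k := by exact_mod_cast h
    have h5 : 1 ≤ Real.log (d k) := by
      rw [Real.le_log_iff_exp_le (by linarith)]
      linarith [Real.exp_one_lt_three]
    nlinarith

/-- The number of edges between the classes fluctuates enough: if `q` is close to `1`, then `p - q` is
at most `1 - q`, and the gap condition keeps `1 - q` from being small. -/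
theorem tendsto_mul_one_sub_atTop (hq : Tendsto (fun k => N k * (q k : ℝ)) l atTop)
    (hgap : Tendsto (fun k => (N k : ℝ) * ((p k : ℝ) - q k) ^ 2 / ((p k : ℝ) + q k)) l atTop)
    (hpq : ∀ᶠ k in l, (q k : ℝ) < p k) :
    Tendsto (fun k => N k * ((q k : ℝ) * (1 - q k))) l atTop := by
  have hmin : Tendsto (fun k => min (N k * (q k : ℝ))
      ((N k : ℝ) * ((p k : ℝ) - q k) ^ 2 / ((p k : ℝ) + q k)) / 2) l atTop :=
    (tendsto_atTop.2 fun c => by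
      filter_upwards [hq.eventually_ge_atTop c, hgap.eventually_ge_atTop c] with k h1 h2
      exact le_min h1 h2 : Tendsto _ l atTop).atTop_div_const two_pos
  refine tendsto_atTop_mono' l ?_ hmin
  filter_upwards [hpq] with k hk
  have h0 : (0 : ℝ) ≤ q k := (q k).2.1
  have h1 : (p k : ℝ) ≤ 1 := (p k).2.2
  have hN0 : (0 : ℝ) ≤ N k := Nat.cast_nonneg _
  rcases le_total (q k : ℝ) (1 / 2) with h | h
  · have h2 : (q k : ℝ) / 2 ≤ q k * (1 - q k) := by nlinarith
    have h3 := mul_le_mul_of_nonneg_left h2 hN0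
    have h4 := min_le_left (N k * (q k : ℝ))
      ((N k : ℝ) * ((p k : ℝ) - q k) ^ 2 / ((p k : ℝ) + q k))
    linarith
  · have h2 : (N k : ℝ) * ((p k : ℝ) - q k) ^ 2 / ((p k : ℝ) + q k) ≤ N k * (1 - q k) := by
      rw [div_le_iff₀ (by linarith), mul_assoc]
      refine mul_le_mul_of_nonneg_left ?_ hN0
      nlinarith
    have h3 : (1 - (q k : ℝ)) / 2 ≤ q k * (1 - q k) := by nlinarith
    have h5 := mul_le_mul_of_nonneg_left h3 hN0
    have h4 := min_le_right (N k * (q k : ℝ))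
      ((N k : ℝ) * ((p k : ℝ) - q k) ^ 2 / ((p k : ℝ) + q k))
    linarith

theorem tendsto_const_div_of_sq_le {c C : ℝ} {f σ : ι → ℝ} (hσ : ∀ k, 0 ≤ σ k ∧ σ k ≤ C)
    (hf : Tendsto f l atTop) : Tendsto (fun k => c * σ k ^ 2 / f k) l (𝓝 0) := by
  refine squeeze_zero_norm' ?_ (hf.const_div_atTop (|c| * C ^ 2))
  filter_upwards [hf.eventually_gt_atTop 0] with k hk
  rw [Real.norm_eq_abs, abs_div, abs_mul, abs_of_pos hk, abs_of_nonneg (sq_nonneg (σ k))]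
  have := pow_le_pow_left₀ (hσ k).1 (hσ k).2 2
  gcongr

/-- The test sample is regular, and its noise is harmless for a given classifier, with high
probability; the accuracy `θ` does not have to tend to zero. -/
theorem tendsto_csbm_test {d : ι → ℕ} {μ ν : ∀ k, EuclideanSpace ℝ (Fin (d k))} {σ : ι → ℝ}
    {σmax R η θ : ℝ} (hσ : ∀ k, 0 ≤ σ k ∧ σ k ≤ σmax) (hR : 0 < R) (hθ : 0 < θ) (hθη : θ ≤ η / 2)
    (hη : η ≤ 1 / 2) (hN : Tendsto N l atTop)
    (hp : (fun k => Real.log (N k) ^ 2 / (N k : ℝ)) =o[l] fun k => (p k : ℝ))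
    (hq : (fun k => Real.log (N k) ^ 2 / (N k : ℝ)) =o[l] fun k => (q k : ℝ)) :
    ∃ T : ι → ℝ≥0∞, Tendsto T l (𝓝 0) ∧ ∀ᶠ k in l, 0 < N k ∧ 0 < (p k : ℝ) + q k ∧
      ∀ 𝒲 : Set (EuclideanSpace ℝ (Fin (d k))), (σ k = 0 ∨ 𝒲.Subsingleton) →
        (∀ w ∈ 𝒲, ‖w‖ ≤ R) →
        csbm (N k) (d k) (p k) (q k) (μ k) (ν k) (σ k)
          {s | ¬ IsRegular s.1 (adj s) (N k * (((p k : ℝ) + q k) / 2))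
            (((p k : ℝ) - q k) / (p k + q k)) θ η ∨
          ∃ w ∈ 𝒲, θ * N k * (N k * (((p k : ℝ) + q k) / 2)) ≤
            |inner ℝ (contrast (μ k) (ν k) s) w|} ≤ T k := by
  have hN' : Tendsto (fun k => (N k : ℝ)) l atTop := tendsto_natCast_atTop_atTop.comp hN
  have hD := tendsto_degree_atTop hN hp hq
  have hθ2 : 0 < θ ^ 2 := by positivity
  have e1 : Tendsto (fun k => 16 / (θ ^ 2 * (N k : ℝ))) l (𝓝 0) :=
    (hN'.const_mul_atTop hθ2).const_div_atTop _
  have e2 : Tendsto (fun k => 80 / (θ ^ 2 * (N k * (((p k : ℝ) + q k) / 2)))) l (𝓝 0) :=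
    (hD.const_mul_atTop hθ2).const_div_atTop _
  have e3 := tendsto_mul_exp_degree hN hp hq (η := η) (by linarith)
  have e4 : Tendsto (fun k => 240 * σ k ^ 2 * R ^ 2 / (θ ^ 2 * (N k : ℝ))) l (𝓝 0) := by
    refine (tendsto_const_div_of_sq_le (c := 240 * R ^ 2) hσ
      (hN'.const_mul_atTop hθ2)).congr fun k => ?_
    ring
  have e23 := e2.add e3
  rw [add_zero] at e23
  have hlim := ((tendsto_ofReal_zero e1).add (tendsto_ofReal_zero e23)).add (tendsto_ofReal_zero e4)
  simp only [add_zero] at hlim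
  refine ⟨_, hlim, ?_⟩
  filter_upwards [hN.eventually_gt_atTop 0, hD.eventually_gt_atTop 0,
    hN'.eventually_ge_atTop (8 / θ)] with k h0 h1 h2
  have hN0 : (0 : ℝ) < N k := by exact_mod_cast h0
  have hpq : 0 < (p k : ℝ) + q k := by
    have := pos_of_mul_pos_right h1 hN0.le
    linarith
  refine ⟨h0, hpq, fun 𝒲 h𝒲 h𝒲R => ?_⟩
  refine csbm_test_le (p k) (q k) (μ k) (ν k) (σ k) 𝒲 h𝒲 hR h𝒲R h0 h1 rfl rfl ?_ hθ hθη hη ?_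
  · rw [abs_div, abs_of_pos hpq, div_le_one hpq, abs_le]
    have := (p k).2.1
    have := (q k).2.1
    constructor <;> linarith
  · rwa [div_le_iff₀' hθ] at h2

/-- The training sample is typical with high probability, to an accuracy proportional to the signal
`(p - q) / (p + q)`. -/
theorem tendsto_csbm_train {d : ι → ℕ} {μ ν w : ∀ k, EuclideanSpace ℝ (Fin (d k))} {σ : ι → ℝ}
    {σmax R η κ : ℝ} (hσ : ∀ k, 0 ≤ σ k ∧ σ k ≤ σmax) (hR : 0 < R) (hw : ∀ k, ‖w k‖ ≤ R)
    (hκ : 0 < κ) (hκη : κ ≤ η / 2) (hη : η ≤ 1 / 2) (hN : Tendsto N l atTop)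
    (hd : (fun k => (d k : ℝ) * Real.log (d k)) =o[l] fun k => (N k : ℝ))
    (hp : (fun k => Real.log (N k) ^ 2 / (N k : ℝ)) =o[l] fun k => (p k : ℝ))
    (hq : (fun k => Real.log (N k) ^ 2 / (N k : ℝ)) =o[l] fun k => (q k : ℝ))
    (hgap : Tendsto (fun k => (N k : ℝ) * ((p k : ℝ) - q k) ^ 2 / ((p k : ℝ) + q k)) l atTop)
    (hpq : ∀ᶠ k in l, (q k : ℝ) < p k) :
    ∃ T : ι → ℝ≥0∞, Tendsto T l (𝓝 0) ∧ ∀ᶠ k in l, 0 < N k ∧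
      csbm (N k) (d k) (p k) (q k) (μ k) (ν k) (σ k)
        {s | ¬ IsTypical R (μ k) (ν k) (w k) (σ k) (N k * (((p k : ℝ) + q k) / 2))
          (((p k : ℝ) - q k) / (p k + q k)) (κ * (((p k : ℝ) - q k) / (p k + q k))) η s} ≤
        T k := by
  set Γ : ι → ℝ := fun k => ((p k : ℝ) - q k) / (p k + q k) with hΓ
  have hN' : Tendsto (fun k => (N k : ℝ)) l atTop := tendsto_natCast_atTop_atTop.comp hN
  have hD := tendsto_degree_atTop hN hp hq
  have hV := tendsto_mul_one_sub_atTop (tendsto_mul_prob_atTop hN hq) hgap hpq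
  have hdN := tendsto_div_of_isLittleO hN hd
  have hM : Tendsto (fun k => (N k : ℝ) / (768 * (d k + 2))) l atTop := by
    have h1 : Tendsto (fun k => ((d k : ℝ) + 2) / N k) l (𝓝[>] 0) := by
      refine tendsto_nhdsWithin_iff.2 ⟨hdN, ?_⟩
      filter_upwards [hN.eventually_gt_atTop 0] with k hk
      have hN0 : (0 : ℝ) < N k := by exact_mod_cast hk
      exact Set.mem_Ioi.2 (by positivity)
    refine ((h1.inv_tendsto_nhdsGT_zero).atTop_div_const (r := 768) (by norm_num)).congr fun k => ?_
    simp only [Pi.inv_apply, inv_div]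
    rw [div_div, mul_comm]
  -- the squared accuracy, multiplied by the expected degree, tends to infinity by the gap condition
  have hX : Tendsto (fun k => (κ * Γ k) ^ 2 * (N k * (((p k : ℝ) + q k) / 2))) l atTop := by
    refine (hgap.const_mul_atTop (r := κ ^ 2 / 2) (by positivity)).congr' ?_
    filter_upwards [hpq] with k hk
    have : 0 < (p k : ℝ) + q k := by have := (q k).2.1; linarith
    simp only [hΓ]
    field_simp
  have hX' : Tendsto (fun k => (κ * Γ k) ^ 2 * (N k : ℝ)) l atTop := by
    refine tendsto_atTop_mono (fun k => mul_le_mul_of_nonneg_left ?_ (sq_nonneg _)) hX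
    have h1 : ((p k : ℝ) + q k) / 2 ≤ 1 := by
      have := (p k).2.2
      have := (q k).2.2
      linarith
    exact mul_le_of_le_one_right (Nat.cast_nonneg _) h1
  have e1 : Tendsto (fun k => 16 / ((κ * Γ k) ^ 2 * (N k : ℝ))) l (𝓝 0) := hX'.const_div_atTop _
  have e2 : Tendsto (fun k => 80 / ((κ * Γ k) ^ 2 * (N k * (((p k : ℝ) + q k) / 2)))) l (𝓝 0) :=
    hX.const_div_atTop _
  have e3 := tendsto_mul_exp_degree hN hp hq (η := η) (by linarith)
  have e4 := hM.const_div_atTop 1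
  have e5 : Tendsto (fun k => 300 / (N k * ((q k : ℝ) * (1 - q k))) ^ 2) l (𝓝 0) :=
    ((tendsto_pow_atTop two_ne_zero).comp hV).const_div_atTop 300
  have e6 : Tendsto (fun k => 120 * σ k ^ 2 * R ^ 2 * (d k / N k) *
      ((Γ k ^ 2 + (κ * Γ k) ^ 2) / (κ * Γ k) ^ 2)) l (𝓝 0) := by
    have h1 : Tendsto (fun k => 120 * σmax ^ 2 * R ^ 2 * (((d k : ℝ) + 2) / N k) *
        ((1 + κ ^ 2) / κ ^ 2)) l (𝓝 0) := by
      simpa using (hdN.const_mul (120 * σmax ^ 2 * R ^ 2)).mul_const ((1 + κ ^ 2) / κ ^ 2)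
    refine tendsto_of_tendsto_of_tendsto_of_le_of_le' tendsto_const_nhds h1
      (Eventually.of_forall fun k => by positivity) ?_
    filter_upwards [hpq] with k hk
    have hΓ0 : 0 < Γ k := div_pos (by linarith) (by have := (q k).2.1; linarith)
    have e : (Γ k ^ 2 + (κ * Γ k) ^ 2) / (κ * Γ k) ^ 2 = (1 + κ ^ 2) / κ ^ 2 := by
      field_simp
    have hs := pow_le_pow_left₀ (hσ k).1 (hσ k).2 2
    rw [e]
    gcongr
    linarith
  have e7 : Tendsto (fun k => 2 * σ k ^ 2 * R ^ 2 /
      ((κ * Γ k) ^ 2 * (N k * (((p k : ℝ) + q k) / 2)))) l (𝓝 0) := by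
    refine (tendsto_const_div_of_sq_le (c := 2 * R ^ 2) hσ hX).congr fun k => ?_
    ring
  have e25 := (e2.add e3).add (e4.add e5)
  have e67 := e6.add e7
  simp only [add_zero] at e25 e67
  have hlim := ((tendsto_ofReal_zero e1).add (tendsto_ofReal_zero e25)).add
    (tendsto_ofReal_zero e67)
  simp only [add_zero] at hlim
  refine ⟨_, hlim, ?_⟩
  filter_upwards [hN.eventually_gt_atTop 0, hD.eventually_gt_atTop 0, hpq,
    hX'.eventually_ge_atTop 8, hV.eventually_ge_atTop 1, hM.eventually_gt_atTop 0]
    with k h0 h1 h2 h3 h4 h5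
  have hN0 : (0 : ℝ) < N k := by exact_mod_cast h0
  have hq0 : 0 ≤ (q k : ℝ) := (q k).2.1
  have hpq0 : 0 < (p k : ℝ) + q k := by linarith
  have hΓ0 : 0 < Γ k := div_pos (by linarith) hpq0
  have hΓ1 : Γ k ≤ 1 := (div_le_one hpq0).2 (by linarith)
  have hθ : κ * Γ k ≤ κ := mul_le_of_le_one_right hκ.le hΓ1
  have hθ0 : 0 < κ * Γ k := by positivity
  refine ⟨h0, csbm_not_isTypical_le (M := (N k : ℝ) / (768 * (d k + 2))) (p k) (q k) (μ k) (ν k)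
    (w k) (σ k) hR (hw k) h0 h1 rfl rfl hθ0 (by linarith) hη ?_ h5 h4 ?_⟩
  · refine h3.trans (mul_le_mul_of_nonneg_right ?_ hN0.le)
    rw [sq]
    exact mul_le_of_le_one_right hθ0.le (by linarith)
  · refine le_of_eq ?_
    field_simp

end Limits

/-- The weight vector of norm at most `R` that separates the class means best. -/
theorem exists_ideal_weight {d : ℕ} (μ ν : EuclideanSpace ℝ (Fin d)) {R : ℝ} (hR : 0 ≤ R) :
    ∃ w : EuclideanSpace ℝ (Fin d), ‖w‖ ≤ R ∧ inner ℝ (μ - ν) w = -(R * ‖μ - ν‖) := by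
  rcases eq_or_ne (μ - ν) 0 with h | h
  · exact ⟨0, by simpa using hR, by simp [h]⟩
  · have h0 : ‖μ - ν‖ ≠ 0 := norm_ne_zero_iff.2 h
    refine ⟨(-(R / ‖μ - ν‖)) • (μ - ν), ?_, ?_⟩
    · rw [norm_smul, norm_neg, Real.norm_of_nonneg (by positivity), div_mul_cancel₀ _ h0]
    · rw [real_inner_smul_right, real_inner_self_eq_norm_sq]
      field_simp

end SGC

theorem theorem1
    -- `n` training nodes, `m n` test nodes, features in `ℝ ^ (d n)`
    (d m : ℕ → ℕ) (p q p' q' : ℕ → unitInterval)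
    (μ ν : (n : ℕ) → EuclideanSpace ℝ (Fin (d n)))
    (σ : ℕ → ℝ) (σmax R : ℝ) (hR : 0 < R)
    (hσ : ∀ n, 0 ≤ σ n ∧ σ n ≤ σmax)
    (hμ : ∀ n, ‖μ n‖ ≤ 1) (hν : ∀ n, ‖ν n‖ ≤ 1)
    -- the sample sizes
    (hd : (fun n => (d n : ℝ) * Real.log (d n)) =o[atTop] (fun n => (n : ℝ)))
    (hm : Tendsto m atTop atTop)
    -- the graphs are not too sparse
    (hp : (fun n : ℕ => Real.log n ^ 2 / n) =o[atTop] (fun n => (p n : ℝ)))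
    (hq : (fun n : ℕ => Real.log n ^ 2 / n) =o[atTop] (fun n => (q n : ℝ)))
    (hp' : (fun n : ℕ => Real.log (m n) ^ 2 / (m n : ℝ)) =o[atTop] (fun n => (p' n : ℝ)))
    (hq' : (fun n : ℕ => Real.log (m n) ^ 2 / (m n : ℝ)) =o[atTop] (fun n => (q' n : ℝ)))
    -- the two classes of the training graph can be told apart
    (hgap : Tendsto (fun n : ℕ => (n : ℝ) * ((p n : ℝ) - q n) ^ 2 / ((p n : ℝ) + q n))
      atTop atTop)
    -- the homophily regimes disagree
    (hregime : ∀ n, ((p n : ℝ) - q n) * ((p' n : ℝ) - q' n) ≤ 0) :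
    ∃ ε : ℕ → ℝ, Tendsto ε atTop (𝓝 0) ∧
      SGC.WithHighProbability
        (fun n => (SGC.csbm n (d n) (p n) (q n) (μ n) (ν n) (σ n)).prod
          (SGC.csbm (m n) (d n) (p' n) (q' n) (μ n) (ν n) (σ n)))
        (fun n => {s | (∃ w b, SGC.IsOptimal R s.1 w b) ∧
          ∀ w b, SGC.IsOptimal R s.1 w b →
            SGC.loss s.2 w b ≥
              R * ((q' n : ℝ) - p' n) / (2 * ((p' n : ℝ) + q' n)) * ‖μ n - ν n‖ * (1 + ε n)}) := by
  refine ⟨fun _ => 0, tendsto_const_nhds, ?_⟩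
  unfold SGC.WithHighProbability
  set S : Set ℕ := {n | (p' n : ℝ) < q' n} with hS
  have hsplit : (atTop : Filter ℕ) ≤ atTop ⊓ 𝓟 S ⊔ atTop ⊓ 𝓟 Sᶜ := by
    rw [← inf_sup_left, sup_principal, Set.union_compl_self, principal_univ, inf_top_eq]
  refine (tendsto_sup.2 ⟨?_, ?_⟩).mono_left hsplit
  · -- the interesting case: a homophilous training graph and a heterophilous test graph
    set l : Filter ℕ := atTop ⊓ 𝓟 S
    have hl : l ≤ atTop := inf_le_left
    have hlS : ∀ᶠ n in l, (p' n : ℝ) < q' n := mem_inf_of_right (mem_principal_self S)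
    have hpq : ∀ᶠ n in l, (q n : ℝ) < p n := by
      filter_upwards [hlS, hl (hgap.eventually_gt_atTop 0)] with n h1 h2
      have h3 : (p n : ℝ) ≠ q n := fun h => by simp [h] at h2
      refine lt_of_le_of_ne ?_ h3.symm
      by_contra hc
      exact absurd (hregime n)
        (not_le.2 (mul_pos_of_neg_of_neg (by linarith [not_le.1 hc]) (by linarith)))
    have hs0 := Real.sigmoid_pos (-R)
    have hs1 := Real.sigmoid_lt_one (-R)
    have hC := SGC.lossConst_pos hR
    have hsp := SGC.softplus_pos (-R)
    obtain ⟨η, hη⟩ : ∃ η, η = Real.sigmoid (-R) / 8 := ⟨_, rfl⟩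
    have hη0 : 0 < η := by rw [hη]; positivity
    obtain ⟨κ, hκ0, hκη, hκR⟩ : ∃ κ : ℝ, 0 < κ ∧ κ ≤ η / 2 ∧
        2 * (SGC.lossConst R + 3 + 2 * R) * κ / Real.sigmoid (-R) ≤ SGC.softplus (-R) := by
      refine ⟨min (η / 2) (SGC.softplus (-R) * Real.sigmoid (-R) /
        (2 * (SGC.lossConst R + 3 + 2 * R))), by positivity, min_le_left _ _, ?_⟩
      rw [div_le_iff₀ hs0, mul_comm, ← le_div_iff₀ (by positivity)]
      exact min_le_right _ _
    obtain ⟨θ, hθ0, hθη, hθR⟩ : ∃ θ : ℝ, 0 < θ ∧ θ ≤ η / 2 ∧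
        (SGC.lossConst R + 1) * θ ≤ SGC.softplus (-R) / 2 := by
      refine ⟨min (η / 2) (SGC.softplus (-R) / 2 / (SGC.lossConst R + 1)), by positivity,
        min_le_left _ _, ?_⟩
      rw [mul_comm, ← le_div_iff₀ (by positivity)]
      exact min_le_right _ _
    choose w hw hwγ using fun n => SGC.exists_ideal_weight (μ n) (ν n) hR.le
    obtain ⟨T, hT, hTb⟩ := SGC.tendsto_csbm_train (N := fun n => n) (μ := μ) (ν := ν) hσ hR hw hκ0
      hκη (by linarith) (tendsto_id.mono_left hl) (hd.mono hl) (hp.mono hl) (hq.mono hl)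
      (hgap.mono_left hl) hpq
    obtain ⟨T', hT', hTb'⟩ := SGC.tendsto_csbm_test (μ := μ) (ν := ν) hσ hR hθ0 hθη (by linarith)
      (hm.mono_left hl) (hp'.mono hl) (hq'.mono hl)
    refine tendsto_of_tendsto_of_tendsto_of_le_of_le' tendsto_const_nhds
      (h := fun n => 2 * (T n + T' n)) ?_ (Eventually.of_forall fun _ => zero_le) ?_
    · simpa using ENNReal.Tendsto.const_mul (hT.add hT') (Or.inr (by norm_num : (2 : ℝ≥0∞) ≠ ⊤))
    · filter_upwards [hTb, hTb', hlS, hpq] with n h1 h2 h3 h4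
      obtain ⟨hn, h1⟩ := h1
      obtain ⟨hm0, hpq', h2⟩ := h2
      have hq0 : (0 : ℝ) ≤ q n := (q n).2.1
      have hpq0 : 0 < (p n : ℝ) + q n := by linarith
      have hn' : (0 : ℝ) < n := by exact_mod_cast hn
      have hm' : (0 : ℝ) < m n := by exact_mod_cast hm0
      have hp0' : (0 : ℝ) ≤ p' n := (p' n).2.1
      refine le_trans (le_of_eq ?_) (SGC.prod_csbm_le (p n) (q n) (p' n) (q' n) hR hn hm0
        (by positivity) (by positivity) (div_pos (by linarith) hpq0)
        ((div_le_one hpq0).2 (by linarith)) (div_nonpos_of_nonpos_of_nonneg (by linarith) hpq'.le)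
        ((le_div_iff₀ hpq').2 (by linarith)) hκ0 hη hκη hκR hθ0 hθη hθR (hμ n) (hν n) (hw n) (hwγ n)
        h1 h2)
      have e : R * ((q' n : ℝ) - p' n) / (2 * ((p' n : ℝ) + q' n)) * ‖μ n - ν n‖ * (1 + 0) =
          R * (-(((p' n : ℝ) - q' n) / (p' n + q' n))) / 2 * ‖μ n - ν n‖ := by
        field_simp
        ring
      simp only [ge_iff_le, e]
  · -- otherwise the bound is not positive, and only the existence of a minimizer has to be shown
    refine tendsto_of_tendsto_of_tendsto_of_le_of_le' tendsto_const_nhds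
      (h := fun n : ℕ => ENNReal.ofReal (4 / n)) ?_ (Eventually.of_forall fun _ => zero_le) ?_
    · exact (SGC.tendsto_ofReal_zero (tendsto_natCast_atTop_atTop.const_div_atTop 4)).mono_left
        inf_le_left
    · have hlS : ∀ᶠ n in atTop ⊓ 𝓟 Sᶜ, n ∈ Sᶜ := mem_inf_of_right (mem_principal_self _)
      filter_upwards [hlS, inf_le_left (b := 𝓟 Sᶜ) (eventually_gt_atTop 0)] with n h1 hn
      simp only [hS, Set.mem_compl_iff, Set.mem_ofPred_eq, not_lt] at h1
      have hp0' : (0 : ℝ) ≤ p' n := (p' n).2.1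
      have hq0' : (0 : ℝ) ≤ q' n := (q' n).2.1
      have hle : R * ((q' n : ℝ) - p' n) / (2 * ((p' n : ℝ) + q' n)) * ‖μ n - ν n‖ * (1 + 0) ≤ 0 := by
        rw [add_zero, mul_one]
        exact mul_nonpos_of_nonpos_of_nonneg (div_nonpos_of_nonpos_of_nonneg
          (mul_nonpos_of_nonneg_of_nonpos hR.le (by linarith)) (by positivity)) (norm_nonneg _)
      refine (measure_mono (t := {s | ¬ ∃ w b, SGC.IsOptimal R s w b} ×ˢ Set.univ) ?_).trans ?_
      · intro s hs
        refine ⟨fun hex => hs ⟨hex, fun w b _ => ?_⟩, Set.mem_univ _⟩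
        exact hle.trans (SGC.loss_nonneg _ _ _)
      · rw [Measure.prod_prod, measure_univ, mul_one]
        exact SGC.csbm_forall_not_isOptimal_le (p n) (q n) (μ n) (ν n) (σ n) hR.le hn
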